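/- For a complex number $q$ with $|q|<1$ and an integer $s\ge 1$ put $$\beta_q(s)=\sum_{k\ge 1}k^{s-1}\frac{q^k}{1+q^{2k}}.$$ For positive integers $r$ and $A$ put $$f(r;A)=\frac{4rA+A-4r^2}{\left(\frac{48}{\pi^2}+2\right)A+8r^2-\frac{16}{\pi^2}+\frac{16r}{3}},$$ and for every integer $A\ge 3$ put $$f(A)=\max_{r\in\mathbb{Z},\ 1\le r<A/2}f(r;A).$$ Theorem 1.1. Let $q$ be a nonzero number such that $1/q\in\mathbb{Z}\setminus\{-1,1\}$, and let $A\ge 3$ be an odd integer. Then the $\mathbb{Q}$-vector space spanned by $1$ and the numbers $\beta_q(s)$ with $s$ even, $2\le s\le A-1$, satisfies $$\dim_{\mathbb{Q}}\bigl(\mathbb{Q}+\mathbb{Q}\beta_q(2)+\mathbb{Q}\beta_q(4)+\dots+\mathbb{Q}\beta_q(A-1)\bigr)\ge f(A).$$ Moreover, as $A\to+\infty$, $$f(A)\sim\frac{\pi}{2\sqrt{\pi^2+24}}\,\sqrt{A}.$$ -/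

import Mathlib

/-- The `q`-analogue `β_q(s) = ∑_{k ≥ 1} k^(s-1) q^k / (1 + q^(2k))` of the value of Dirichlet's
beta function at the integer `s ≥ 1`, for complex `q` with `|q| < 1`. -/
noncomputable def qBeta (q : ℂ) (s : ℕ) : ℂ :=
  ∑' k : ℕ+, (k : ℂ) ^ (s - 1) * (q ^ (k : ℕ) / (1 + q ^ (2 * (k : ℕ))))

/-- The series defining `qBeta` converges absolutely for `|q| < 1`. -/
theorem summable_qBeta {q : ℂ} (hq : ‖q‖ < 1) (s : ℕ) :
    Summable fun k : ℕ+ => (k : ℂ) ^ (s - 1) * (q ^ (k : ℕ) / (1 + q ^ (2 * (k : ℕ)))) := by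
  have h0 : Summable fun n : ℕ => ‖((n : ℂ) ^ (s - 1) * q ^ n : ℂ)‖ * (1 - ‖q‖)⁻¹ :=
    (summable_norm_pow_mul_geometric_of_norm_lt_one (s - 1) hq).mul_right _
  have h1 := h0.comp_injective PNat.coe_injective
  refine Summable.of_norm_bounded h1 fun k => ?_
  have hpos : 0 < 1 - ‖q‖ := by linarith
  have hk : ‖q ^ (2 * (k : ℕ))‖ ≤ ‖q‖ := by
    rw [norm_pow]
    have : 2 * (k : ℕ) ≠ 0 := by have := k.pos; omega
    exact pow_le_of_le_one (norm_nonneg _) hq.le this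
  have hden : 1 - ‖q‖ ≤ ‖1 + q ^ (2 * (k : ℕ))‖ := by
    have h := norm_sub_norm_le (1 : ℂ) (-(q ^ (2 * (k : ℕ))))
    rw [norm_one, norm_neg, sub_neg_eq_add] at h
    linarith
  simp only [Function.comp_apply, ← mul_div_assoc]
  rw [norm_div, div_eq_mul_inv]
  gcongr

/-- The `ℚ`-subspace `ℚ + ℚ β_q(2) + ℚ β_q(4) + ⋯ + ℚ β_q(A-1)` of `ℂ`, for odd `A`. -/
noncomputable def qBetaSpace (q : ℂ) (A : ℕ) : Submodule ℚ ℂ :=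
  Submodule.span ℚ (insert 1 (qBeta q '' {s | Even s ∧ 2 ≤ s ∧ s ≤ A - 1}))

/-- The quantity `f(r; A)`. -/
noncomputable def boundTerm (r A : ℕ) : ℝ :=
  (4 * r * A + A - 4 * r ^ 2) /
    ((48 / Real.pi ^ 2 + 2) * A + 8 * r ^ 2 - 16 / Real.pi ^ 2 + 16 * r / 3)

/-- `f(A)`, the maximum of `f(r; A)` over the integers `r` with `1 ≤ r < A / 2`. -/
noncomputable def bound (A : ℕ) : ℝ :=
  sSup ((fun r : ℕ => boundTerm r A) '' {r | 1 ≤ r ∧ (r : ℝ) < (A : ℝ) / 2})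

/-- The supremum in the definition of `bound` is a maximum. -/
theorem bound_isGreatest {A : ℕ} (hA : 3 ≤ A) :
    IsGreatest ((fun r : ℕ => boundTerm r A) '' {r | 1 ≤ r ∧ (r : ℝ) < (A : ℝ) / 2})
      (bound A) := by
  have hfin : ({r : ℕ | 1 ≤ r ∧ (r : ℝ) < (A : ℝ) / 2}).Finite := by
    refine (Set.finite_Iio A).subset fun r hr => ?_
    have h2 : (r : ℝ) < (A : ℝ) / 2 := hr.2
    have h3 : (0 : ℝ) ≤ A := Nat.cast_nonneg A
    have : (r : ℝ) < A := by linarith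
    exact_mod_cast this
  have hne : ({r : ℕ | 1 ≤ r ∧ (r : ℝ) < (A : ℝ) / 2}).Nonempty := by
    refine ⟨1, le_rfl, ?_⟩
    have : (3 : ℝ) ≤ A := by exact_mod_cast hA
    push_cast
    linarith
  exact ⟨(hne.image _).csSup_mem (hfin.image _),
    fun x hx => le_csSup (hfin.image _).bddAbove hx⟩

/-!
Put `p = 1 / q`. A linear independence criterion of Nesterenko type is applied to integer linear
forms in `1` and the `β_q(s)` with `s` even. These forms come from alternating sums
`∑ (-1) ^ h R_N(q ^ (2 h + 1))` of values of a rational function `R_N` with poles of order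
`A = 2 (r + b) + 1` at the points `p ^ (2 j)`, `0 ≤ j ≤ 2 N`. Partial fractions express the sum
through series in the `1 / (1 - q ^ (2 h + 1)) ^ s`, and the symmetry `R_N(p ^ (4 N) / x) = R_N(x)`
leaves only the `β_q(s)` with `s` even.

Since `R_N` vanishes at the first `2 r N` points, its first nonzero value governs the sum. The
common denominator of the coefficients is a product of values at `p` of cyclotomic polynomials,
whose size is governed by the sums of Euler's totient over all integers and over the odd ones; this
is where `π ^ 2` comes from. With forms of size `exp (-α N ^ 2)` and coefficients of size at most
`exp (γ N ^ 2)`, the criterion bounds the dimension from below by `1 + α / γ = f(r; A)`.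
-/

open Filter Topology
open scoped ArithmeticFunction.Moebius

/-! ### A linear independence criterion -/

/-- Dirichlet's theorem on simultaneous approximation. -/
theorem exists_simultaneous_approx {ι : Type*} [Fintype ι] (θ : ι → ℝ) {H : ℕ} (hH : 0 < H) :
    ∃ (Q : ℕ) (w : ι → ℤ),
      0 < Q ∧ Q ≤ H ^ Fintype.card ι ∧ ∀ i, |Q * θ i - w i| ≤ 1 / H := by
  classical
  have hH' : (0 : ℝ) < H := by exact_mod_cast hH
  let box : ℕ → ι → Fin H := fun a i => ⟨⌊Int.fract (a * θ i) * H⌋₊, by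
    rw [Nat.floor_lt (by positivity)]
    exact mul_lt_of_lt_one_left hH' (Int.fract_lt_one _)⟩
  obtain ⟨x, hx, y, hy, hxy, hbox⟩ := Finset.exists_ne_map_eq_of_card_lt_of_maps_to
    (s := Finset.range (H ^ Fintype.card ι + 1)) (t := (Finset.univ : Finset (ι → Fin H)))
    (by simp) (f := box) (fun _ _ => Finset.mem_univ _)
  wlog hlt : x < y generalizing x y
  · exact this y hy x hx hxy.symm hbox.symm (lt_of_le_of_ne (not_lt.mp hlt) hxy.symm)
  refine ⟨y - x, fun i => ⌊y * θ i⌋ - ⌊x * θ i⌋, Nat.sub_pos_of_lt hlt,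
    (Nat.sub_le y x).trans (Nat.lt_succ_iff.mp (Finset.mem_range.mp hy)), fun i => ?_⟩
  have hfloor : ⌊Int.fract (y * θ i) * H⌋₊ = ⌊Int.fract (x * θ i) * H⌋₊ :=
    congrArg Fin.val (congrFun hbox i).symm
  have hdist : |Int.fract (y * θ i) * H - Int.fract (x * θ i) * H| < 1 := by
    refine Int.abs_sub_lt_one_of_floor_eq_floor ?_
    rw [← Int.natCast_floor_eq_floor (by positivity), ← Int.natCast_floor_eq_floor (by positivity),
      hfloor]
  have hfract : ((y - x : ℕ) : ℝ) * θ i - ((⌊y * θ i⌋ - ⌊x * θ i⌋ : ℤ) : ℝ)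
      = Int.fract (y * θ i) - Int.fract (x * θ i) := by
    rw [Nat.cast_sub hlt.le, Int.fract, Int.fract]
    push_cast
    ring
  rw [← sub_mul, abs_mul, Nat.abs_cast] at hdist
  rw [hfract, le_div_iff₀ hH']
  exact hdist.le

/-- A nonzero value `Λ = a + ∑ P i * θ i` of an integral linear form cannot be small compared with
the quality of a simultaneous approximation of `θ`: otherwise the nearby integer
`Q * a + ∑ P i * w i` would be nonzero and of absolute value less than `1`. -/
theorem mul_abs_form_le_of_approx {ι : Type*} [Fintype ι] {θ : ι → ℝ} {Q : ℕ} {w : ι → ℤ} {δ : ℝ}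
    (hw : ∀ i, |Q * θ i - w i| ≤ δ) (a : ℤ) (P : ι → ℤ)
    (hlt : Q * |a + ∑ i, P i * θ i| < 1 / 2) (hδ : (∑ i, |(P i : ℝ)|) * δ ≤ 1 / 2) :
    Q * |a + ∑ i, P i * θ i| ≤ (∑ i, |(P i : ℝ)|) * δ := by
  set Λ := a + ∑ i, P i * θ i with hΛ
  obtain ⟨Z, hZ⟩ : ∃ Z : ℤ, Z = Q * a + ∑ i, P i * w i := ⟨_, rfl⟩
  have hdist : |Q * Λ - Z| ≤ (∑ i, |(P i : ℝ)|) * δ := by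
    have hdiff : Q * Λ - Z = ∑ i, P i * (Q * θ i - w i) := by
      rw [hZ, hΛ]
      push_cast
      simp only [mul_sub, Finset.sum_sub_distrib, mul_add, Finset.mul_sum, mul_left_comm]
      ring
    rw [hdiff, Finset.sum_mul]
    refine (Finset.abs_sum_le_sum_abs _ _).trans (Finset.sum_le_sum fun i _ => ?_)
    rw [abs_mul]
    exact mul_le_mul_of_nonneg_left (hw i) (abs_nonneg _)
  have hQΛ : |Q * Λ| = Q * |Λ| := by rw [abs_mul, Nat.abs_cast]
  have hZ0 : Z = 0 := by
    rw [← Int.abs_lt_one_iff]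
    have : |(Z : ℝ)| < 1 := by
      have := abs_sub_abs_le_abs_sub (Z : ℝ) (Q * Λ)
      rw [abs_sub_comm, hQΛ] at this
      linarith
    exact_mod_cast this
  rwa [hZ0, Int.cast_zero, sub_zero, hQΛ] at hdist

theorem one_le_two_mul_mul_pow {Q H x y M : ℝ} {k : ℕ} (hH : 0 < H) (hx : 0 < x) (hy : 0 < y)
    (hQx : 1 ≤ Q * (2 * x)) (hQH : Q ≤ H ^ k) (hM : Q * y * H ≤ M) :
    1 ≤ 2 * x * (M * (2 * x) / y) ^ k := by
  have hHle : H ≤ M * (2 * x) / y := by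
    rw [le_div_iff₀ hy]
    calc H * y ≤ Q * (2 * x) * (H * y) := le_mul_of_one_le_left (by positivity) hQx
      _ = Q * y * H * (2 * x) := by ring
      _ ≤ M * (2 * x) := by gcongr
  refine hQx.trans ?_
  rw [mul_comm]
  gcongr
  exact hQH.trans (by gcongr)

theorem frequently_one_le_of_forms {ι : Type*} [Fintype ι] (θ : ι → ℝ) (a : ℕ → ℤ)
    (P : ℕ → ι → ℤ) {Λ M : ℕ → ℝ} (hΛ : ∀ N, Λ N = |a N + ∑ i, P N i * θ i|)
    (hpos : ∀ᶠ N in atTop, 0 < Λ N) (hlim : Tendsto Λ atTop (𝓝 0))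
    (hM : ∀ᶠ N in atTop, ∑ i, |(P N i : ℝ)| ≤ M N) :
    ∃ᶠ N in atTop, 1 ≤ 2 * Λ N * (M (N + 1) * (2 * Λ N) / Λ (N + 1)) ^ Fintype.card ι := by
  intro hcon
  obtain ⟨N₀, hN₀⟩ := eventually_atTop.mp (hcon.and (hpos.and hM))
  have hΛ0 : 0 < Λ N₀ := (hN₀ N₀ le_rfl).2.1
  obtain ⟨H, hH⟩ := exists_nat_gt (max 0 (M N₀ / Λ N₀))
  obtain ⟨hHpos, hH⟩ := max_lt_iff.mp hH
  obtain ⟨Q, w, hQ0, hQH, hw⟩ := exists_simultaneous_approx θ (Nat.cast_pos.mp hHpos)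
  have hQ1 : (1 : ℝ) ≤ Q := Nat.one_le_cast.mpr hQ0
  -- The form at the first `N` with `Q Λ_N < 1 / 2` gives the contradiction; minimality of `N` bounds
  -- `Q` from below by `1 / (2 Λ_{N - 1})`.
  have hsmall : ∃ N, N₀ ≤ N ∧ Q * Λ N < 1 / 2 := by
    have : Tendsto (fun N => Q * Λ N) atTop (𝓝 0) := by simpa using hlim.const_mul (Q : ℝ)
    exact ((eventually_ge_atTop N₀).and (this.eventually_lt_const one_half_pos)).exists
  classical
  obtain ⟨hN, hQΛ⟩ := Nat.find_spec hsmall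
  have hmin := fun n => Nat.find_min hsmall (m := n)
  set N := Nat.find hsmall
  obtain ⟨-, hΛN, hMN⟩ := hN₀ N hN
  have herr : M N * (1 / H) < Q * Λ N := by
    rw [mul_one_div, div_lt_iff₀ hHpos]
    rcases eq_or_lt_of_le hN with heq | hlt
    · rw [div_lt_iff₀ hΛ0] at hH
      rw [← heq]
      nlinarith [mul_pos hΛ0 hHpos]
    · obtain ⟨n, hn⟩ : ∃ n, N = n + 1 := ⟨N - 1, by omega⟩
      obtain ⟨hlt1, hΛn, -⟩ := hN₀ n (by omega)
      have hQn : 1 ≤ Q * (2 * Λ n) := by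
        by_contra! h
        exact hmin n (by omega) ⟨by omega, by linarith⟩
      by_contra! hle
      refine hlt1 ?_
      beta_reduce
      rw [← hn]
      exact one_le_two_mul_mul_pow hHpos hΛn hΛN hQn (by exact_mod_cast hQH) hle
  have hle := mul_abs_form_le_of_approx hw (a N) (P N) (by rwa [← hΛ])
    ((mul_le_mul_of_nonneg_right hMN (by positivity)).trans (herr.trans hQΛ).le)
  rw [← hΛ] at hle
  exact absurd (hle.trans (mul_le_mul_of_nonneg_right hMN (by positivity))) (not_le.mpr herr)

theorem tendsto_log_atBot_of_tendsto_div {Λ σ : ℕ → ℝ} {α : ℝ} (hα : 0 < α)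
    (hσ : Tendsto σ atTop atTop)
    (h : Tendsto (fun N => Real.log (Λ N) / σ N) atTop (𝓝 (-α))) :
    Tendsto (fun N => Real.log (Λ N)) atTop atBot := by
  refine (h.neg_mul_atTop (neg_neg_of_pos hα) hσ).congr' ?_
  filter_upwards [hσ.eventually_ne_atTop 0] with N hN
  rw [div_mul_cancel₀ _ hN]

theorem tendsto_log_div_succ {Λ σ : ℕ → ℝ} {l : ℝ} (hσ : Tendsto σ atTop atTop)
    (hσ' : Tendsto (fun N => σ N / σ (N + 1)) atTop (𝓝 1))
    (h : Tendsto (fun N => Real.log (Λ N) / σ N) atTop (𝓝 l)) :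
    Tendsto (fun N => Real.log (Λ N) / σ (N + 1)) atTop (𝓝 l) := by
  simpa using (h.mul hσ').congr' <| by
    filter_upwards [hσ.eventually_ne_atTop 0] with N hN
    rw [div_mul_div_cancel₀ hN]

theorem le_mul_of_forall_pos_add {α γ k : ℝ} (hk : 0 ≤ k)
    (h : ∀ ε > 0, 0 ≤ -α + k * (γ + ε)) : α ≤ k * γ := by
  refine le_of_forall_pos_le_add fun δ hδ => ?_
  have := h (δ / (k + 1)) (by positivity)
  have : k * (δ / (k + 1)) ≤ δ := by
    rw [mul_div_assoc', div_le_iff₀ (by positivity)]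
    nlinarith
  linarith

/-- Nesterenko's criterion, in the form of an upper bound for the rate of decay `α` of linear
forms in `1` and the `θ i`. -/
theorem le_card_mul_of_forms {ι : Type*} [Fintype ι] (θ : ι → ℝ) (a : ℕ → ℤ) (P : ℕ → ι → ℤ)
    {Λ : ℕ → ℝ} (hΛ : ∀ N, Λ N = |a N + ∑ i, P N i * θ i|) {σ : ℕ → ℝ} (hσ : Tendsto σ atTop atTop)
    (hσ' : Tendsto (fun N => σ N / σ (N + 1)) atTop (𝓝 1)) {α γ : ℝ} (hα : 0 < α)
    (hform : Tendsto (fun N => Real.log (Λ N) / σ N) atTop (𝓝 (-α)))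
    (hcoef : ∀ ε > 0, ∀ᶠ N in atTop, ∑ i, |(P N i : ℝ)| ≤ Real.exp ((γ + ε) * σ N)) :
    α ≤ Fintype.card ι * γ := by
  have hlog := tendsto_log_atBot_of_tendsto_div hα hσ hform
  have hpos : ∀ᶠ N in atTop, 0 < Λ N := by
    filter_upwards [hlog.eventually_lt_atBot 0] with N hN
    refine ((abs_nonneg _).trans_eq (hΛ N).symm).lt_of_ne' fun h => ?_
    simp [h] at hN
  have hlim : Tendsto Λ atTop (𝓝 0) := by
    refine (Real.tendsto_exp_atBot.comp hlog).congr' ?_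
    filter_upwards [hpos] with N hN
    exact Real.exp_log hN
  set k : ℝ := ((Fintype.card ι : ℕ) : ℝ) with hk
  refine le_mul_of_forall_pos_add (Nat.cast_nonneg _) fun ε hε => ?_
  have hfreq := (frequently_one_le_of_forms θ a P hΛ hpos hlim (hcoef ε hε)).and_eventually
    (hpos.and (((tendsto_add_atTop_nat 1).eventually hpos).and
      ((tendsto_add_atTop_nat 1).eventually (hσ.eventually_gt_atTop 0))))
  have hrate : Tendsto (fun N => (Real.log 2 / σ (N + 1) + Real.log (Λ N) / σ (N + 1)) +
      k * ((γ + ε) + (Real.log 2 / σ (N + 1) + Real.log (Λ N) / σ (N + 1)) -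
        Real.log (Λ (N + 1)) / σ (N + 1))) atTop (𝓝 (-α + k * (γ + ε))) := by
    have h2 : Tendsto (fun N => Real.log 2 / σ (N + 1)) atTop (𝓝 0) :=
      (hσ.comp (tendsto_add_atTop_nat 1)).const_div_atTop _
    have h2Λ := h2.add (tendsto_log_div_succ hσ hσ' hform)
    have hΛ' := hform.comp (tendsto_add_atTop_nat 1)
    simpa using h2Λ.add (((h2Λ.const_add (γ + ε)).sub hΛ').const_mul k)
  refine ge_of_tendsto_of_frequently hrate (hfreq.mono ?_)
  rintro N ⟨hle, hΛN, hΛN', hσN⟩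
  have := Real.log_nonneg hle
  rw [Real.log_mul (by positivity) (by positivity), Real.log_pow,
    Real.log_div (by positivity) hΛN'.ne', Real.log_mul two_ne_zero hΛN.ne',
    Real.log_mul (Real.exp_ne_zero _) (by positivity), Real.log_exp,
    Real.log_mul two_ne_zero hΛN.ne', ← hk] at this
  refine (div_nonneg this hσN.le).trans_eq ?_
  field_simp

theorem exists_int_coords {ι : Type*} [Finite ι] {V : Submodule ℚ ℝ} {k : ℕ}
    (hV : Module.finrank ℚ V = k + 1) {ξ : ι → ℝ} (hξ : ∀ i, ξ i ∈ V) :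
    ∃ (c : ℝ) (θ : Fin k → ℝ) (a : ι → ℤ) (z : ι → Fin k → ℤ),
      c ≠ 0 ∧ ∀ i, c * ξ i = a i + ∑ l, z i l * θ l := by
  have : FiniteDimensional ℚ V := Module.finite_of_finrank_eq_succ hV
  let b := Module.finBasisOfFinrankEq ℚ V hV
  obtain ⟨⟨D, hD⟩, hmul⟩ := IsLocalization.exist_integer_multiples_of_finite (nonZeroDivisors ℤ)
    (fun x : ι × Fin (k + 1) => b.repr ⟨ξ x.1, hξ x.1⟩ x.2)
  have hD0 : (D : ℝ) ≠ 0 := Int.cast_ne_zero.mpr (nonZeroDivisors.ne_zero hD)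
  choose z hz using hmul
  have hz' (i l) : (z (i, l) : ℝ) = D * (b.repr ⟨ξ i, hξ i⟩ l : ℚ) := by
    have : ((z (i, l) : ℤ) : ℚ) = D * b.repr ⟨ξ i, hξ i⟩ l := by
      simpa [Submonoid.smul_def] using hz (i, l)
    exact_mod_cast congrArg (Rat.cast : ℚ → ℝ) this
  have hb0 : ((b 0 : V) : ℝ) ≠ 0 := by simpa using b.ne_zero 0
  have hsum (i) : (D : ℝ) * ξ i = ∑ l, (z (i, l) : ℝ) * ((b l : V) : ℝ) := by
    have hrepr := congrArg (Subtype.val : V → ℝ) (b.sum_repr ⟨ξ i, hξ i⟩)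
    simp only [Submodule.coe_sum, Submodule.coe_smul, Rat.smul_def] at hrepr
    rw [← hrepr, Finset.mul_sum]
    exact Finset.sum_congr rfl fun l _ => by rw [hz', mul_assoc]
  refine ⟨D / (b 0 : V), fun l => (b l.succ : V) / (b 0 : V), fun i => z (i, 0),
    fun i l => z (i, l.succ), div_ne_zero hD0 hb0, fun i => ?_⟩
  rw [div_mul_eq_mul_div, hsum, Fin.sum_univ_succ, add_div, mul_div_cancel_right₀ _ hb0,
    Finset.sum_div]
  simp only [mul_div_assoc]

theorem eventually_sum_abs_sum_mul_le_exp {ι κ : Type*} [Fintype ι] [Fintype κ] {p : ℕ → ι → ℤ}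
    (z : ι → κ → ℤ) {σ : ℕ → ℝ} (hσ : Tendsto σ atTop atTop) {γ : ℝ}
    (hcoef : ∀ ε > 0, ∀ᶠ N in atTop, ∀ i, |(p N i : ℝ)| ≤ Real.exp ((γ + ε) * σ N)) {ε : ℝ}
    (hε : 0 < ε) :
    ∀ᶠ N in atTop, ∑ l, |((∑ i, p N i * z i l : ℤ) : ℝ)| ≤ Real.exp ((γ + ε) * σ N) := by
  obtain ⟨C, hC⟩ : ∃ C, C = ∑ l, ∑ i, |(z i l : ℝ)| := ⟨_, rfl⟩
  have hexp : Tendsto (fun N => Real.exp (ε / 2 * σ N)) atTop atTop :=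
    Real.tendsto_exp_atTop.comp (hσ.const_mul_atTop (half_pos hε))
  filter_upwards [hcoef (ε / 2) (half_pos hε), hexp.eventually_ge_atTop C] with N hp hCN
  calc ∑ l, |((∑ i, p N i * z i l : ℤ) : ℝ)|
      ≤ ∑ l, ∑ i, Real.exp ((γ + ε / 2) * σ N) * |(z i l : ℝ)| := by
        push_cast
        gcongr with l
        refine (Finset.abs_sum_le_sum_abs _ _).trans (Finset.sum_le_sum fun i _ => ?_)
        rw [abs_mul]
        gcongr
        exact hp i
    _ = Real.exp ((γ + ε / 2) * σ N) * C := by simp only [hC, Finset.mul_sum]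
    _ ≤ Real.exp ((γ + ε / 2) * σ N) * Real.exp (ε / 2 * σ N) := by gcongr
    _ = Real.exp ((γ + ε) * σ N) := by rw [← Real.exp_add]; ring_nf

/-- A linear independence criterion in the spirit of Nesterenko: small linear forms with integer
coefficients at points of a finite dimensional `ℚ`-subspace of `ℝ` force its dimension to be
large. -/
theorem one_add_div_le_finrank_of_forms {ι : Type*} [Fintype ι] (V : Submodule ℚ ℝ)
    [FiniteDimensional ℚ V] {ξ : ι → ℝ} (hξ : ∀ i, ξ i ∈ V) (p : ℕ → ι → ℤ)
    {σ : ℕ → ℝ} (hσ : Tendsto σ atTop atTop)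
    (hσ' : Tendsto (fun N => σ N / σ (N + 1)) atTop (𝓝 1)) {α γ : ℝ} (hα : 0 < α) (hγ : 0 < γ)
    (hform : Tendsto (fun N => Real.log |∑ i, p N i * ξ i| / σ N) atTop (𝓝 (-α)))
    (hcoef : ∀ ε > 0, ∀ᶠ N in atTop, ∀ i, |(p N i : ℝ)| ≤ Real.exp ((γ + ε) * σ N)) :
    1 + α / γ ≤ Module.finrank ℚ V := by
  have hne : ∀ᶠ N in atTop, |∑ i, p N i * ξ i| ≠ 0 := by
    filter_upwards [hform.eventually_lt_const (neg_neg_of_pos hα)] with N hN h0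
    simp [h0] at hN
  obtain ⟨k, hk⟩ : ∃ k, Module.finrank ℚ V = k + 1 := by
    refine Nat.exists_eq_succ_of_ne_zero fun h => ?_
    obtain ⟨N, hN⟩ := hne.exists
    have := Module.finrank_zero_iff.mp h
    have hξ0 (i) : ξ i = 0 := congrArg Subtype.val (Subsingleton.elim (⟨ξ i, hξ i⟩ : V) 0)
    simp [hξ0] at hN
  obtain ⟨c, θ, a, z, hc, hcoord⟩ := exists_int_coords hk hξ
  have hform_eq (N) : ((∑ i, p N i * a i : ℤ) : ℝ) + ∑ l, ((∑ i, p N i * z i l : ℤ) : ℝ) * θ l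
      = c * ∑ i, p N i * ξ i := by
    simp only [Finset.mul_sum, mul_left_comm c, hcoord, mul_add, Finset.sum_add_distrib]
    push_cast
    simp only [Finset.sum_mul, mul_assoc]
    rw [Finset.sum_comm]
  have hle : α ≤ Fintype.card (Fin k) * γ := by
    refine le_card_mul_of_forms θ (fun N => ∑ i, p N i * a i) (fun N l => ∑ i, p N i * z i l)
      (fun _ => rfl) hσ hσ' hα ?_
        fun _ => eventually_sum_abs_sum_mul_le_exp z hσ hcoef
    have hconst : Tendsto (fun N => Real.log |c| / σ N) atTop (𝓝 0) := hσ.const_div_atTop _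
    rw [← zero_add (-α)]
    refine (hconst.add hform).congr' ?_
    filter_upwards [hne] with N hN
    rw [hform_eq, abs_mul, Real.log_mul (abs_ne_zero.mpr hc) hN, add_div]
  rw [Fintype.card_fin, ← div_le_iff₀ hγ] at hle
  rw [hk, Nat.cast_succ]
  linarith

/-! ### Sums of Euler's totient function -/

theorem natCast_totient_eq_sum_moebius {R : Type*} [CommRing R] {n : ℕ} (hn : 0 < n) :
    (n.totient : R) = ∑ x ∈ n.divisorsAntidiagonal, (μ x.1 : R) * (x.2 : R) := by
  have hsum : ∀ n : ℕ, n > 0 → ∑ i ∈ n.divisors, (i.totient : R) = (n : R) := fun n _ => by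
    rw [← Nat.cast_sum, Nat.sum_totient]
  exact ((ArithmeticFunction.sum_eq_iff_sum_mul_moebius_eq.mp hsum) n hn).symm

theorem sum_Ioc_weight_mul_totient {R : Type*} [CommRing R] {χ : ℕ → R}
    (hχ : ∀ a b, χ (a * b) = χ a * χ b) (N : ℕ) :
    ∑ d ∈ Finset.Ioc 0 N, χ d * d.totient
      = ∑ a ∈ Finset.Ioc 0 N, χ a * μ a * ∑ b ∈ Finset.Ioc 0 (N / a), χ b * b := by
  let f : ArithmeticFunction R := ⟨fun a => χ a * μ a, by simp⟩
  let g : ArithmeticFunction R := ⟨fun b => χ b * b, by simp⟩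
  refine (Finset.sum_congr rfl fun d hd => ?_).trans
    (ArithmeticFunction.sum_Ioc_mul_eq_sum_sum f g N)
  rw [natCast_totient_eq_sum_moebius (Finset.mem_Ioc.mp hd).1, ArithmeticFunction.mul_apply,
    Finset.mul_sum]
  refine Finset.sum_congr rfl fun x hx => ?_
  rw [← (Nat.mem_divisorsAntidiagonal.mp hx).1, hχ]
  simp only [f, g, ArithmeticFunction.coe_mk]
  ring

theorem tendsto_natCast_div_div_atTop (a : ℕ) :
    Tendsto (fun N : ℕ => ((N / a : ℕ) : ℝ) / N) atTop (𝓝 (1 / a)) := by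
  refine ((tendsto_nat_floor_mul_div_atTop (R := ℝ) (a := 1 / a) (by positivity)).comp
    tendsto_natCast_atTop_atTop).congr fun N => ?_
  rw [Function.comp_apply, one_div_mul_eq_div, Nat.floor_div_eq_div]

theorem sum_Ioc_weight_mul_le_sq {χ : ℕ → ℝ} (hχ : ∀ a, χ a ≤ 1) (x : ℕ) :
    ∑ b ∈ Finset.Ioc 0 x, χ b * b ≤ (x : ℝ) ^ 2 := by
  calc ∑ b ∈ Finset.Ioc 0 x, χ b * b ≤ ∑ _b ∈ Finset.Ioc 0 x, (x : ℝ) := by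
        refine Finset.sum_le_sum fun b hb => ?_
        exact (mul_le_of_le_one_left b.cast_nonneg (hχ b)).trans
          (Nat.cast_le.mpr (Finset.mem_Ioc.mp hb).2)
    _ = (x : ℝ) ^ 2 := by simp [sq]

theorem abs_moebius_cast_le_one (a : ℕ) : |((μ a : ℤ) : ℝ)| ≤ 1 := by
  exact_mod_cast ArithmeticFunction.abs_moebius_le_one

theorem tendsto_sum_weight_mul_totient {χ : ℕ → ℝ} (hχ : ∀ a b, χ (a * b) = χ a * χ b)
    (h0 : ∀ a, 0 ≤ χ a) (h1 : ∀ a, χ a ≤ 1) {κ : ℝ}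
    (hκ : Tendsto (fun x : ℕ => (∑ b ∈ Finset.Ioc 0 x, χ b * b) / (x : ℝ) ^ 2) atTop (𝓝 κ)) :
    Tendsto (fun N : ℕ => (∑ d ∈ Finset.Ioc 0 N, χ d * d.totient) / (N : ℝ) ^ 2) atTop
      (𝓝 (κ * ∑' a : ℕ, χ a * (μ a / (a : ℝ) ^ 2))) := by
  set S : ℕ → ℝ := fun x => ∑ b ∈ Finset.Ioc 0 x, χ b * b
  have hS0 (x) : 0 ≤ S x := Finset.sum_nonneg fun b _ => mul_nonneg (h0 b) b.cast_nonneg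
  have hseries (N : ℕ) : (∑ d ∈ Finset.Ioc 0 N, χ d * d.totient) / (N : ℝ) ^ 2
      = ∑' a : ℕ, χ a * μ a * S (N / a) / (N : ℝ) ^ 2 := by
    rw [sum_Ioc_weight_mul_totient hχ, Finset.sum_div]
    refine (tsum_eq_sum fun a ha => ?_).symm
    have : N / a = 0 := by
      rw [Nat.div_eq_zero_iff]
      rw [Finset.mem_Ioc] at ha
      omega
    simp [this]
  rw [← tsum_mul_left]
  simp_rw [hseries]
  refine tendsto_tsum_of_dominated_convergence (bound := fun a : ℕ => 1 / (a : ℝ) ^ 2)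
    (Real.summable_one_div_nat_pow.mpr one_lt_two) (fun a => ?_) (.of_forall fun N a => ?_)
  · rcases a.eq_zero_or_pos with rfl | ha
    · simp
    have hlim := ((hκ.comp (Nat.tendsto_div_const_atTop ha.ne')).mul
      ((tendsto_natCast_div_div_atTop a).pow 2)).const_mul (χ a * μ a)
    refine (hlim.congr' ?_).trans_eq (by congr 1; ring)
    filter_upwards [eventually_ge_atTop a] with N hN
    have hNa : ((N / a : ℕ) : ℝ) ≠ 0 := Nat.cast_ne_zero.mpr (Nat.div_pos hN ha).ne'
    simp only [Function.comp_apply, S]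
    field_simp
  · have hSle : S (N / a) ≤ (N : ℝ) ^ 2 / (a : ℝ) ^ 2 := by
      rw [← div_pow]
      exact (sum_Ioc_weight_mul_le_sq h1 _).trans (by gcongr; exact Nat.cast_div_le)
    have hχμ : χ a * |((μ a : ℤ) : ℝ)| ≤ 1 :=
      mul_le_one₀ (h1 a) (abs_nonneg _) (abs_moebius_cast_le_one a)
    rw [Real.norm_eq_abs, abs_div, abs_mul, abs_mul, abs_of_nonneg (h0 a), abs_of_nonneg (hS0 _),
      abs_of_nonneg (sq_nonneg (N : ℝ))]
    refine div_le_of_le_mul₀ (by positivity) (by positivity) ?_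
    calc χ a * |((μ a : ℤ) : ℝ)| * S (N / a) ≤ 1 * ((N : ℝ) ^ 2 / (a : ℝ) ^ 2) :=
          mul_le_mul hχμ hSle (hS0 _) zero_le_one
      _ = 1 / (a : ℝ) ^ 2 * (N : ℝ) ^ 2 := by ring

theorem tsum_moebius_div_sq : ∑' a : ℕ, (μ a : ℝ) / (a : ℝ) ^ 2 = 6 / Real.pi ^ 2 := by
  have hL := ArithmeticFunction.LSeries_zeta_mul_Lseries_moebius (s := 2) (by simp)
  have hcast : LSeries (fun n => ((μ n : ℤ) : ℂ)) 2
      = ((∑' a : ℕ, (μ a : ℝ) / (a : ℝ) ^ 2 : ℝ) : ℂ) := by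
    rw [LSeries, Complex.ofReal_tsum]
    refine tsum_congr fun n => ?_
    rcases n.eq_zero_or_pos with rfl | hn
    · simp
    · rw [LSeries.term_of_ne_zero hn.ne']
      push_cast
      norm_cast
  rw [ArithmeticFunction.LSeries_zeta_eq_riemannZeta (by simp), riemannZeta_two, hcast] at hL
  have hreal : Real.pi ^ 2 / 6 * ∑' a : ℕ, (μ a : ℝ) / (a : ℝ) ^ 2 = 1 := by exact_mod_cast hL
  rw [← inv_div]
  exact eq_inv_of_mul_eq_one_right hreal

theorem summable_moebius_div_sq : Summable fun a : ℕ => (μ a : ℝ) / (a : ℝ) ^ 2 := by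
  refine .of_norm_bounded (Real.summable_one_div_nat_pow.mpr one_lt_two) fun a => ?_
  rw [Real.norm_eq_abs, abs_div, abs_of_nonneg (sq_nonneg (a : ℝ))]
  gcongr
  exact abs_moebius_cast_le_one a

/-- The indicator function of the odd numbers, as a completely multiplicative weight. -/
noncomputable def oddWeight (a : ℕ) : ℝ := if Odd a then 1 else 0

theorem oddWeight_mul (a b : ℕ) : oddWeight (a * b) = oddWeight a * oddWeight b := by
  by_cases ha : Odd a <;> by_cases hb : Odd b <;> simp [oddWeight, Nat.odd_mul, ha, hb]

theorem oddWeight_nonneg (a : ℕ) : 0 ≤ oddWeight a := by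
  unfold oddWeight
  split_ifs <;> norm_num

theorem oddWeight_le_one (a : ℕ) : oddWeight a ≤ 1 := by
  unfold oddWeight
  split_ifs <;> norm_num

theorem moebius_two_mul (k : ℕ) : (μ (2 * k) : ℝ) = -(oddWeight k * μ k) := by
  by_cases hk : Odd k
  · rw [ArithmeticFunction.isMultiplicative_moebius.map_mul_of_coprime
      (Nat.coprime_two_left.mpr hk), ArithmeticFunction.moebius_apply_prime Nat.prime_two]
    simp [oddWeight, hk]
  · have hsq : ¬Squarefree (2 * k) := fun h => by
      obtain ⟨l, rfl⟩ := Nat.not_odd_iff_even.mp hk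
      simpa using h 2 ⟨l, by ring⟩
    simp [oddWeight, hk, ArithmeticFunction.moebius_eq_zero_of_not_squarefree hsq]

theorem tsum_oddWeight_mul {f : ℕ → ℝ} (hf : Summable f) :
    ∑' a, oddWeight a * f a = ∑' k, f (2 * k + 1) := by
  have hw : Summable fun a => oddWeight a * f a := .of_norm_bounded hf.norm fun a => by
    rw [norm_mul, Real.norm_of_nonneg (oddWeight_nonneg a)]
    exact mul_le_of_le_one_left (norm_nonneg _) (oddWeight_le_one a)
  have heven : Summable fun k => oddWeight (2 * k) * f (2 * k) :=
    hw.comp_injective fun a b h => by simpa using h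
  have hodd : Summable fun k => oddWeight (2 * k + 1) * f (2 * k + 1) :=
    hw.comp_injective fun a b h => by simpa using h
  rw [← tsum_even_add_odd (f := fun a => oddWeight a * f a) heven hodd]
  have hzero (k : ℕ) : oddWeight (2 * k) = 0 := if_neg (by simp)
  have hone (k : ℕ) : oddWeight (2 * k + 1) = 1 := if_pos (by simp)
  simp only [hzero, hone, zero_mul, one_mul, tsum_zero, zero_add]

theorem tsum_oddWeight_mul_moebius_div_sq :
    ∑' a : ℕ, oddWeight a * ((μ a : ℝ) / (a : ℝ) ^ 2) = 8 / Real.pi ^ 2 := by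
  set f : ℕ → ℝ := fun a => (μ a : ℝ) / (a : ℝ) ^ 2
  have hf : Summable f := summable_moebius_div_sq
  have heven : Summable fun k => f (2 * k) := hf.comp_injective fun a b h => by simpa using h
  have hodd : Summable fun k => f (2 * k + 1) := hf.comp_injective fun a b h => by simpa using h
  have hf_even (k : ℕ) : f (2 * k) = -(1 / 4) * (oddWeight k * f k) := by
    simp only [f, moebius_two_mul]
    push_cast
    ring
  have hsplit := tsum_even_add_odd heven hodd
  simp_rw [hf_even] at hsplit
  rw [tsum_mul_left, ← tsum_oddWeight_mul hf,
    show ∑' a, f a = 6 / Real.pi ^ 2 from tsum_moebius_div_sq] at hsplit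
  linear_combination (4 / 3) * hsplit

theorem sum_Ioc_natCast (x : ℕ) : ∑ b ∈ Finset.Ioc 0 x, (b : ℝ) = x * (x + 1) / 2 := by
  induction x with
  | zero => simp
  | succ x ih =>
    rw [Finset.sum_Ioc_succ_top x.zero_le, ih]
    push_cast
    ring

theorem tendsto_sum_totient :
    Tendsto (fun N : ℕ => (∑ d ∈ Finset.Ioc 0 N, (d.totient : ℝ)) / (N : ℝ) ^ 2) atTop
      (𝓝 (3 / Real.pi ^ 2)) := by
  have hκ : Tendsto (fun x : ℕ => (∑ b ∈ Finset.Ioc 0 x, (1 : ℝ) * b) / (x : ℝ) ^ 2) atTop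
      (𝓝 (1 / 2)) := by
    have hlim : Tendsto (fun x : ℕ => (1 / 2 : ℝ) + 1 / 2 * (1 / (x : ℝ))) atTop (𝓝 (1 / 2)) := by
      have := ((tendsto_one_div_atTop_nhds_zero_nat (𝕜 := ℝ)).const_mul (1 / 2)).const_add (1 / 2)
      rwa [mul_zero, add_zero] at this
    refine hlim.congr' ?_
    filter_upwards [eventually_ne_atTop 0] with x hx
    simp only [one_mul, sum_Ioc_natCast]
    field_simp
  have h := tendsto_sum_weight_mul_totient (χ := fun _ => 1) (by simp) (by simp) (by simp) hκ
  simp only [one_mul, tsum_moebius_div_sq] at h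
  exact h.trans_eq (by congr 1; ring)

theorem sum_Ioc_oddWeight_mul (x : ℕ) :
    ∑ b ∈ Finset.Ioc 0 x, oddWeight b * b = (((x + 1) / 2 : ℕ) : ℝ) ^ 2 := by
  induction x with
  | zero => simp
  | succ x ih =>
    rw [Finset.sum_Ioc_succ_top x.zero_le, ih]
    obtain ⟨k, rfl | rfl⟩ := x.even_or_odd'
    · rw [show (2 * k + 1) / 2 = k by omega, show (2 * k + 1 + 1) / 2 = k + 1 by omega]
      simp only [oddWeight, odd_two_mul_add_one, if_true]
      push_cast
      ring
    · rw [show (2 * k + 1 + 1) / 2 = k + 1 by omega, show (2 * k + 1 + 1 + 1) / 2 = k + 1 by omega]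
      have : ¬Odd (2 * k + 1 + 1) := by simp [parity_simps]
      simp [oddWeight, this]

theorem tendsto_sum_totient_odd :
    Tendsto (fun N : ℕ => (∑ d ∈ (Finset.Ioc 0 N).filter Odd, (d.totient : ℝ)) / (N : ℝ) ^ 2)
      atTop (𝓝 (2 / Real.pi ^ 2)) := by
  have hκ : Tendsto (fun x : ℕ => (∑ b ∈ Finset.Ioc 0 x, oddWeight b * b) / (x : ℝ) ^ 2) atTop
      (𝓝 (1 / 4)) := by
    have hsucc : Tendsto (fun x : ℕ => ((x + 1 : ℕ) : ℝ) / x) atTop (𝓝 1) := by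
      have := (tendsto_one_div_atTop_nhds_zero_nat (𝕜 := ℝ)).const_add 1
      rw [add_zero] at this
      refine this.congr' ?_
      filter_upwards [eventually_ne_atTop 0] with x hx
      push_cast
      field_simp
    have hhalf := ((tendsto_natCast_div_div_atTop 2).comp (tendsto_add_atTop_nat 1)).mul hsucc
    refine ((hhalf.pow 2).congr fun x => ?_).trans_eq (by norm_num)
    rw [sum_Ioc_oddWeight_mul, Function.comp_apply, div_mul_div_cancel₀ (by positivity), div_pow]
  have h := tendsto_sum_weight_mul_totient oddWeight_mul oddWeight_nonneg oddWeight_le_one hκ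
  rw [tsum_oddWeight_mul_moebius_div_sq] at h
  refine (h.congr fun N => ?_).trans_eq (by congr 1; ring)
  simp only [oddWeight, ite_mul, one_mul, zero_mul, ← Finset.sum_filter]

theorem tendsto_div_sq_of_abs_sub_le {f g : ℕ → ℝ} {C l : ℝ}
    (hfg : ∀ᶠ N : ℕ in atTop, |f N - g N| ≤ C * (N + 1))
    (hg : Tendsto (fun N : ℕ => g N / (N : ℝ) ^ 2) atTop (𝓝 l)) :
    Tendsto (fun N : ℕ => f N / (N : ℝ) ^ 2) atTop (𝓝 l) := by
  have hlim : Tendsto (fun N : ℕ => (2 * |C|) * (1 / (N : ℝ))) atTop (𝓝 0) := by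
    have := (tendsto_one_div_atTop_nhds_zero_nat (𝕜 := ℝ)).const_mul (2 * |C|)
    rwa [mul_zero] at this
  have hdiff : Tendsto (fun N : ℕ => f N / (N : ℝ) ^ 2 - g N / (N : ℝ) ^ 2) atTop (𝓝 0) := by
    refine squeeze_zero_norm' ?_ hlim
    filter_upwards [eventually_ge_atTop 1, hfg] with N hN hfgN
    have hN1 : (1 : ℝ) ≤ N := Nat.one_le_cast.mpr hN
    rw [← sub_div, Real.norm_eq_abs, abs_div, abs_of_nonneg (sq_nonneg (N : ℝ)),
      div_le_iff₀ (by positivity)]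
    calc |f N - g N| ≤ C * (N + 1) := hfgN
      _ ≤ |C| * (2 * N) := by gcongr <;> linarith [le_abs_self C]
      _ = 2 * |C| * (1 / (N : ℝ)) * (N : ℝ) ^ 2 := by field_simp
  simpa using hdiff.add hg

theorem tendsto_quadratic_div_sq (a b c : ℝ) :
    Tendsto (fun N : ℕ => (a * (N : ℝ) ^ 2 + b * N + c) / (N : ℝ) ^ 2) atTop (𝓝 a) := by
  have hlead : Tendsto (fun N : ℕ => a * (N : ℝ) ^ 2 / (N : ℝ) ^ 2) atTop (𝓝 a) := by
    refine tendsto_const_nhds.congr' ?_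
    filter_upwards [eventually_ne_atTop 0] with N hN
    field_simp
  refine tendsto_div_sq_of_abs_sub_le (C := |b| + |c|) (.of_forall fun N => ?_) hlead
  have hN : (0 : ℝ) ≤ N := N.cast_nonneg
  calc |a * (N : ℝ) ^ 2 + b * N + c - a * (N : ℝ) ^ 2| = |b * N + c| := by ring_nf
    _ ≤ |b| * N + |c| := (abs_add_le _ _).trans_eq (by rw [abs_mul, abs_of_nonneg hN])
    _ ≤ (|b| + |c|) * (N + 1) := by nlinarith [abs_nonneg b, abs_nonneg c]

theorem tendsto_sum_div_sq_of_abs_sub_le {f g : ℕ → ℝ} {s : ℕ → Finset ℕ}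
    (hs : ∀ N, s N ⊆ Finset.Ioc 0 N) {C l : ℝ} (hfg : ∀ d, 0 < d → |f d - g d| ≤ C)
    (hg : Tendsto (fun N : ℕ => (∑ d ∈ s N, g d) / (N : ℝ) ^ 2) atTop (𝓝 l)) :
    Tendsto (fun N : ℕ => (∑ d ∈ s N, f d) / (N : ℝ) ^ 2) atTop (𝓝 l) := by
  have hC : 0 ≤ C := (abs_nonneg _).trans (hfg 1 one_pos)
  refine tendsto_div_sq_of_abs_sub_le (C := C) (.of_forall fun N => ?_) hg
  calc |∑ d ∈ s N, f d - ∑ d ∈ s N, g d| ≤ ∑ d ∈ s N, |f d - g d| := by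
        rw [← Finset.sum_sub_distrib]
        exact Finset.abs_sum_le_sum_abs _ _
    _ ≤ ∑ d ∈ Finset.Ioc 0 N, |f d - g d| :=
        Finset.sum_le_sum_of_subset_of_nonneg (hs N) fun _ _ _ => abs_nonneg _
    _ ≤ ∑ _d ∈ Finset.Ioc 0 N, C := Finset.sum_le_sum fun d hd => hfg d (Finset.mem_Ioc.mp hd).1
    _ = C * N := by simp [mul_comm]
    _ ≤ C * (N + 1) := by gcongr; linarith

theorem abs_log_abs_one_sub_le {u : ℝ} (hu : |u| ≤ 1 / 2) : |(Real.log |1 - u|)| ≤ 2 * |u| := by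
  have hu' := abs_le.mp hu
  have hpos : 0 < 1 - u := by linarith
  have hlower : -(2 * |u|) ≤ 1 - (1 - u)⁻¹ := by
    rw [show 1 - (1 - u)⁻¹ = -u / (1 - u) by field_simp; ring, le_div_iff₀ hpos]
    nlinarith [le_abs_self u, neg_abs_le u, abs_nonneg u]
  rw [abs_of_pos hpos, abs_le]
  constructor
  · linarith [Real.one_sub_inv_le_log_of_pos hpos]
  · linarith [Real.log_le_sub_one_of_pos hpos, neg_abs_le u, abs_nonneg u]

theorem two_le_abs_cast {m : ℤ} (hm : 2 ≤ |m|) : (2 : ℝ) ≤ |(m : ℝ)| := by exact_mod_cast hm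

theorem ne_zero_of_two_le_abs {p : ℝ} (hp : 2 ≤ |p|) : p ≠ 0 :=
  abs_pos.mp (two_pos.trans_le hp)

theorem abs_inv_pow_le {p : ℝ} (hp : 2 ≤ |p|) (e : ℕ) : |p⁻¹ ^ e| ≤ (1 / 2) ^ e := by
  rw [abs_pow, abs_inv, one_div]
  gcongr

theorem pow_sub_one_ne_zero {R : Type*} [CommRing R] [LinearOrder R] [IsStrictOrderedRing R]
    {m : R} (hm : 2 ≤ |m|) {e : ℕ} (he : e ≠ 0) : m ^ e - 1 ≠ 0 := by
  intro h
  have hone : |m| ^ e = 1 := by rw [← abs_pow, sub_eq_zero.mp h, abs_one]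
  linarith [le_self_pow₀ (show 1 ≤ |m| by linarith) he]

theorem abs_log_pow_sub_one_sub_le {p : ℝ} (hp : 2 ≤ |p|) {e : ℕ} (he : e ≠ 0) :
    |Real.log |p ^ e - 1| - e * (Real.log |p|)| ≤ 2 * (1 / 2) ^ e := by
  have hp0 := ne_zero_of_two_le_abs hp
  have hu : |p⁻¹ ^ e| ≤ 1 / 2 :=
    (abs_inv_pow_le hp e).trans (pow_le_of_le_one (by norm_num) (by norm_num) he)
  have hne : 1 - p⁻¹ ^ e ≠ 0 := by linarith [(abs_le.mp hu).2]
  have hfactor : p ^ e - 1 = p ^ e * (1 - p⁻¹ ^ e) := by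
    rw [mul_sub, ← mul_pow, mul_inv_cancel₀ hp0, one_pow, mul_one]
  rw [hfactor, abs_mul, Real.log_mul (by positivity) (abs_ne_zero.mpr hne), abs_pow, Real.log_pow,
    add_sub_cancel_left]
  linarith [abs_log_abs_one_sub_le hu, abs_inv_pow_le hp e]

theorem abs_log_prod_pow_sub_one_sub_le {m : ℤ} (hm : 2 ≤ |m|) (s : Finset ℕ) {f : ℕ → ℕ}
    (hf : ∀ i ∈ s, f i ≠ 0) :
    |Real.log |((∏ i ∈ s, (m ^ f i - 1) : ℤ) : ℝ)|
      - ((∑ i ∈ s, f i : ℕ) : ℝ) * (Real.log |(m : ℝ)|)| ≤ s.card := by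
  rw [Int.cast_prod, Finset.abs_prod, Real.log_prod fun i hi => by
      rw [abs_ne_zero, Int.cast_ne_zero]
      exact pow_sub_one_ne_zero hm (hf i hi),
    Nat.cast_sum, Finset.sum_mul, ← Finset.sum_sub_distrib]
  refine (Finset.abs_sum_le_sum_abs _ _).trans ?_
  refine (Finset.sum_le_card_nsmul _ _ 1 fun i hi => ?_).trans (by simp)
  have hhalf : (1 / 2 : ℝ) ^ f i ≤ 1 / 2 := pow_le_of_le_one (by norm_num) (by norm_num) (hf i hi)
  push_cast
  linarith [abs_log_pow_sub_one_sub_le (two_le_abs_cast hm) (hf i hi)]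

theorem prod_eval_cyclotomic {R : Type*} [CommRing R] {a : ℕ} (ha : 0 < a) (x : R) :
    ∏ d ∈ a.divisors, (Polynomial.cyclotomic d R).eval x = x ^ a - 1 := by
  simp [← Polynomial.eval_prod, Polynomial.prod_cyclotomic_eq_X_pow_sub_one ha]

theorem eval_cyclotomic_ne_zero {m : ℤ} (hm : 2 ≤ |m|) {d : ℕ} (hd : 0 < d) :
    (Polynomial.cyclotomic d ℤ).eval m ≠ 0 := by
  have hprod := prod_eval_cyclotomic hd m ▸ pow_sub_one_ne_zero hm hd.ne'
  exact Finset.prod_ne_zero_iff.mp hprod d (Nat.mem_divisors_self d hd.ne')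

theorem sum_divisors_half_pow_le (d : ℕ) : ∑ e ∈ d.divisors, (1 / 2 : ℝ) ^ e ≤ 1 := by
  calc ∑ e ∈ d.divisors, (1 / 2 : ℝ) ^ e ≤ ∑ e ∈ Finset.Ioc 0 d, (1 / 2 : ℝ) ^ e :=
        Finset.sum_le_sum_of_subset_of_nonneg
          (fun e he => Finset.mem_Ioc.mpr ⟨Nat.pos_of_mem_divisors he, Nat.divisor_le he⟩)
          fun _ _ _ => by positivity
    _ = 1 - (1 / 2) ^ d := by
        induction d with
        | zero => simp
        | succ d ih => rw [Finset.sum_Ioc_succ_top d.zero_le, ih]; ring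
    _ ≤ 1 := sub_le_self _ (by positivity)

/-! ### Values of cyclotomic polynomials -/

theorem sum_log_eval_cyclotomic {m : ℤ} (hm : 2 ≤ |m|) {a : ℕ} (ha : 0 < a) :
    ∑ d ∈ a.divisors, Real.log |(((Polynomial.cyclotomic d ℤ).eval m : ℤ) : ℝ)|
      = Real.log |(m : ℝ) ^ a - 1| := by
  rw [← Real.log_prod fun d hd => by
      rw [abs_ne_zero, Int.cast_ne_zero]
      exact eval_cyclotomic_ne_zero hm (Nat.pos_of_mem_divisors hd),
    ← Finset.abs_prod, ← Int.cast_prod, prod_eval_cyclotomic ha]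
  push_cast
  rfl

-- Möbius inversion turns `∏_{d ∣ a} Φ_d(m) = m ^ a - 1` into a bound for each factor.
theorem abs_log_eval_cyclotomic_sub_le {m : ℤ} (hm : 2 ≤ |m|) {d : ℕ} (hd : 0 < d) :
    |Real.log |(((Polynomial.cyclotomic d ℤ).eval m : ℤ) : ℝ)|
      - d.totient * (Real.log |(m : ℝ)|)| ≤ 2 := by
  have hinv := ArithmeticFunction.sum_eq_iff_sum_mul_moebius_eq.mp
    (fun a ha => sum_log_eval_cyclotomic hm ha) d hd
  rw [← hinv, natCast_totient_eq_sum_moebius hd, Finset.sum_mul, ← Finset.sum_sub_distrib]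
  calc _ ≤ ∑ x ∈ d.divisorsAntidiagonal, 2 * (1 / 2 : ℝ) ^ x.2 := by
        refine (Finset.abs_sum_le_sum_abs _ _).trans (Finset.sum_le_sum fun x hx => ?_)
        have hx2 : x.2 ≠ 0 :=
          (Nat.pos_of_mem_divisors (Nat.snd_mem_divisors_of_mem_antidiagonal hx)).ne'
        rw [mul_assoc, ← mul_sub, abs_mul]
        exact (mul_le_of_le_one_left (abs_nonneg _) (abs_moebius_cast_le_one x.1)).trans
          (abs_log_pow_sub_one_sub_le (two_le_abs_cast hm) hx2)
    _ = 2 * ∑ e ∈ d.divisors, (1 / 2 : ℝ) ^ e := by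
        rw [Nat.sum_divisorsAntidiagonal' (f := fun _ e => 2 * (1 / 2 : ℝ) ^ e), Finset.mul_sum]
    _ ≤ 2 := by linarith [sum_divisors_half_pow_le d]

theorem tendsto_log_prod_eval_cyclotomic {m : ℤ} (hm : 2 ≤ |m|) {s : ℕ → Finset ℕ}
    (hs : ∀ N, s N ⊆ Finset.Ioc 0 N) {l : ℝ}
    (hl : Tendsto (fun N : ℕ => (∑ d ∈ s N, (d.totient : ℝ)) / (N : ℝ) ^ 2) atTop (𝓝 l)) :
    Tendsto (fun N : ℕ => Real.log
      |((∏ d ∈ s N, (Polynomial.cyclotomic d ℤ).eval m : ℤ) : ℝ)| / (N : ℝ) ^ 2) atTop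
      (𝓝 (l * Real.log |(m : ℝ)|)) := by
  have hmain : Tendsto (fun N : ℕ => (∑ d ∈ s N, d.totient * Real.log |(m : ℝ)|) / (N : ℝ) ^ 2)
      atTop (𝓝 (l * Real.log |(m : ℝ)|)) := by
    refine (hl.mul_const _).congr fun N => ?_
    rw [← Finset.sum_mul, div_mul_eq_mul_div]
  refine (tendsto_sum_div_sq_of_abs_sub_le hs
    (fun d hd => abs_log_eval_cyclotomic_sub_le hm hd) hmain).congr fun N => ?_
  rw [Int.cast_prod, Finset.abs_prod, Real.log_prod fun d hd => ?_]
  rw [abs_ne_zero, Int.cast_ne_zero]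
  exact eval_cyclotomic_ne_zero hm (Finset.mem_Ioc.mp (hs N hd)).1

/-! ### Products of cyclotomic values -/

/-- The value `Φ_d(m)` of the `d`-th cyclotomic polynomial. -/
noncomputable def cyclotomicVal (m : ℤ) (d : ℕ) : ℤ := (Polynomial.cyclotomic d ℤ).eval m

/-- The product of the `Φ_d(m)` with `1 ≤ d ≤ 2 n`, a common multiple of the `m ^ a - 1` with
`1 ≤ a ≤ 2 n`. -/
noncomputable def cyclotomicProd (m : ℤ) (n : ℕ) : ℤ :=
  ∏ d ∈ Finset.Ioc 0 (2 * n), cyclotomicVal m d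

/-- The product of the `Φ_d(m)` with `1 ≤ d ≤ 2 n` odd, a common multiple of the `m ^ a - 1` with
`1 ≤ a ≤ 2 n` odd. -/
noncomputable def oddCyclotomicProd (m : ℤ) (n : ℕ) : ℤ :=
  ∏ d ∈ (Finset.Ioc 0 (2 * n)).filter Odd, cyclotomicVal m d

/-- The product of the `m ^ a - 1` with `2 ≤ a ≤ 2 n` even: the `q`-factorial of `n` in base
`m ^ 2`. -/
def evenPowProd (m : ℤ) (n : ℕ) : ℤ := ∏ i ∈ Finset.range n, (m ^ (2 * i + 2) - 1)

/-- The part of `m ^ a - 1` made of the `Φ_d(m)` with `d ≤ n` odd. -/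
noncomputable def oddSmallPart (m : ℤ) (n a : ℕ) : ℤ :=
  ∏ d ∈ ((Finset.Ioc 0 n).filter Odd).filter (· ∣ a), cyclotomicVal m d

/-- The part of `evenPowProd m n` made of the `Φ_d(m)` with `d` odd. -/
noncomputable def oddPartProd (m : ℤ) (n : ℕ) : ℤ :=
  ∏ d ∈ (Finset.Ioc 0 n).filter Odd, cyclotomicVal m d ^ (n / d)

theorem cyclotomicProd_ne_zero {m : ℤ} (hm : 2 ≤ |m|) (n : ℕ) : cyclotomicProd m n ≠ 0 :=
  Finset.prod_ne_zero_iff.mpr fun _ hd => eval_cyclotomic_ne_zero hm (Finset.mem_Ioc.mp hd).1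

theorem oddCyclotomicProd_dvd_cyclotomicProd (m : ℤ) (n : ℕ) :
    oddCyclotomicProd m n ∣ cyclotomicProd m n :=
  Finset.prod_dvd_prod_of_subset _ _ _ (Finset.filter_subset _ _)

theorem oddCyclotomicProd_ne_zero {m : ℤ} (hm : 2 ≤ |m|) (n : ℕ) : oddCyclotomicProd m n ≠ 0 :=
  ne_zero_of_dvd_ne_zero (cyclotomicProd_ne_zero hm n) (oddCyclotomicProd_dvd_cyclotomicProd m n)

theorem evenPowProd_ne_zero {m : ℤ} (hm : 2 ≤ |m|) (n : ℕ) : evenPowProd m n ≠ 0 :=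
  Finset.prod_ne_zero_iff.mpr fun i _ => pow_sub_one_ne_zero hm (2 * i + 1).succ_ne_zero

theorem oddSmallPart_ne_zero {m : ℤ} (hm : 2 ≤ |m|) (n a : ℕ) : oddSmallPart m n a ≠ 0 := by
  refine Finset.prod_ne_zero_iff.mpr fun d hd => eval_cyclotomic_ne_zero hm ?_
  exact (Finset.mem_Ioc.mp (Finset.mem_filter.mp (Finset.mem_filter.mp hd).1).1).1

theorem oddPartProd_ne_zero {m : ℤ} (hm : 2 ≤ |m|) (n : ℕ) : oddPartProd m n ≠ 0 := by
  refine Finset.prod_ne_zero_iff.mpr fun d hd => pow_ne_zero _ (eval_cyclotomic_ne_zero hm ?_)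
  exact (Finset.mem_Ioc.mp (Finset.mem_filter.mp hd).1).1

theorem pow_sub_one_dvd_cyclotomicProd (m : ℤ) {a n : ℕ} (ha : 0 < a) (han : a ≤ 2 * n) :
    m ^ a - 1 ∣ cyclotomicProd m n := by
  rw [← prod_eval_cyclotomic ha]
  refine Finset.prod_dvd_prod_of_subset _ _ _ fun d hd => Finset.mem_Ioc.mpr ?_
  exact ⟨Nat.pos_of_mem_divisors hd, (Nat.divisor_le hd).trans han⟩

theorem pow_sub_one_dvd_oddCyclotomicProd (m : ℤ) {a n : ℕ} (ha : Odd a) (han : a ≤ 2 * n) :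
    m ^ a - 1 ∣ oddCyclotomicProd m n := by
  rw [← prod_eval_cyclotomic ha.pos]
  refine Finset.prod_dvd_prod_of_subset _ _ _ fun d hd => Finset.mem_filter.mpr ?_
  exact ⟨Finset.mem_Ioc.mpr ⟨Nat.pos_of_mem_divisors hd, (Nat.divisor_le hd).trans han⟩,
    ha.of_dvd_nat (Nat.dvd_of_mem_divisors hd)⟩

theorem prod_pow_sub_one_mul_dvd {R : Type*} [CommRing R] (x : R) (a b : ℕ) :
    (∏ i ∈ Finset.range a, (x ^ (i + 1) - 1)) * ∏ i ∈ Finset.range b, (x ^ (i + 1) - 1) ∣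
      ∏ i ∈ Finset.range (a + b), (x ^ (i + 1) - 1) := by
  induction h : a + b generalizing a b with
  | zero =>
    obtain ⟨rfl, rfl⟩ : a = 0 ∧ b = 0 := by omega
    simp
  | succ c ih =>
    rcases a with _ | a
    · obtain rfl : b = c + 1 := by omega
      simp
    rcases b with _ | b
    · obtain rfl : a = c := by omega
      simp
    obtain rfl : c = a + b + 1 := by omega
    have hpascal : x ^ (a + b + 1 + 1) - 1
        = (x ^ (a + 1) - 1) + (x ^ (b + 1) - 1) * x ^ (a + 1) := by ring
    rw [Finset.prod_range_succ _ (a + b + 1), hpascal, mul_add]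
    apply dvd_add
    · rw [Finset.prod_range_succ _ a, mul_right_comm]
      exact mul_dvd_mul_right (ih a (b + 1) (by ring)) _
    · rw [Finset.prod_range_succ _ b, ← mul_assoc, ← mul_assoc]
      exact (mul_dvd_mul_right (ih (a + 1) b (by ring)) _).mul_right _

theorem evenPowProd_mul_dvd (m : ℤ) {j n : ℕ} (hj : j ≤ n) :
    evenPowProd m j * evenPowProd m (n - j) ∣ evenPowProd m n := by
  have h := prod_pow_sub_one_mul_dvd (m ^ 2) j (n - j)
  simp only [Nat.add_sub_cancel' hj, ← pow_mul, mul_add_one] at h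
  exact h

theorem oddSmallPart_dvd_pow_sub_one (m : ℤ) (n : ℕ) {a : ℕ} (ha : 0 < a) :
    oddSmallPart m n a ∣ m ^ a - 1 := by
  rw [← prod_eval_cyclotomic ha]
  refine Finset.prod_dvd_prod_of_subset _ _ _ fun d hd => ?_
  exact Nat.mem_divisors.mpr ⟨(Finset.mem_filter.mp hd).2, ha.ne'⟩

theorem oddSmallPart_dvd_cyclotomicProd (m : ℤ) (n a : ℕ) :
    oddSmallPart m n a ∣ cyclotomicProd m n := by
  refine Finset.prod_dvd_prod_of_subset _ _ _ fun d hd => ?_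
  have hd' := Finset.mem_Ioc.mp (Finset.mem_filter.mp (Finset.mem_filter.mp hd).1).1
  exact Finset.mem_Ioc.mpr ⟨hd'.1, by omega⟩

theorem prod_oddSmallPart (m : ℤ) (n : ℕ) (s : Finset ℕ) (f : ℕ → ℕ) :
    ∏ i ∈ s, oddSmallPart m n (f i)
      = ∏ d ∈ (Finset.Ioc 0 n).filter Odd,
          cyclotomicVal m d ^ (s.filter fun i => d ∣ f i).card := by
  simp only [oddSmallPart, Finset.prod_filter (p := fun d => d ∣ _)]
  rw [Finset.prod_comm]
  refine Finset.prod_congr rfl fun d _ => ?_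
  rw [← Finset.prod_filter, Finset.prod_const]

theorem div_le_card_filter_dvd {d : ℕ} (hd : Odd d) (L c : ℕ) :
    L / d ≤ ((Finset.range L).filter fun i => d ∣ 2 * i + c).card := by
  obtain ⟨v, hv⟩ : ∃ v, d ∣ 2 * v + c := by
    obtain ⟨k, rfl⟩ := hd
    exact ⟨k * c, c, by ring⟩
  rw [← Finset.card_range (L / d)]
  refine Finset.card_le_card_of_injOn (fun k => v % d + d * k) (fun k hk => ?_)
    fun k _ k' _ h => Nat.eq_of_mul_eq_mul_left hd.pos (Nat.add_left_cancel h)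
  simp only [Finset.coe_filter, Finset.mem_range, Set.mem_ofPred_eq]
  constructor
  · calc v % d + d * k < d + d * k := Nat.add_lt_add_right (Nat.mod_lt v hd.pos) _
      _ = d * (k + 1) := by ring
      _ ≤ d * (L / d) := Nat.mul_le_mul_left _ (Finset.mem_range.mp hk)
      _ ≤ L := Nat.mul_div_le L d
  · have hmod : v % d + d * k ≡ v [MOD d] := by simp [Nat.ModEq]
    exact (((hmod.mul_left 2).add_right c).dvd_iff dvd_rfl).mpr hv

theorem oddPartProd_pow_dvd (m : ℤ) (n r c : ℕ) :
    oddPartProd m n ^ r ∣ ∏ i ∈ Finset.range (r * n), oddSmallPart m n (2 * i + c) := by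
  rw [prod_oddSmallPart, oddPartProd, ← Finset.prod_pow]
  refine Finset.prod_dvd_prod_of_dvd _ _ fun d hd => ?_
  rw [← pow_mul, mul_comm]
  exact pow_dvd_pow _ ((Nat.mul_div_le_mul_div_assoc _ _ _).trans
    (div_le_card_filter_dvd (Finset.mem_filter.mp hd).2 (r * n) c))

theorem divisors_ordCompl_two {j n : ℕ} (hj : 0 < j) (hjn : j ≤ n) :
    (ordCompl[2] j).divisors = ((Finset.Ioc 0 n).filter Odd).filter (· ∣ j) := by
  have hodd : Odd (ordCompl[2] j) :=
    Nat.coprime_two_left.mp (Nat.coprime_ordCompl Nat.prime_two hj.ne')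
  ext d
  simp only [Nat.mem_divisors, Finset.mem_filter, Finset.mem_Ioc]
  constructor
  · rintro ⟨hd, -⟩
    have hdj : d ∣ j := hd.trans (Nat.ordCompl_dvd j 2)
    exact ⟨⟨⟨Nat.pos_of_dvd_of_pos hdj hj, (Nat.le_of_dvd hj hdj).trans hjn⟩,
      hodd.of_dvd_nat hd⟩, hdj⟩
  · rintro ⟨⟨-, hd⟩, hdj⟩
    have hcoprime : d.Coprime (ordProj[2] j) := (Nat.coprime_two_right.mpr hd).pow_right _
    rw [← Nat.ordProj_mul_ordCompl_eq_self j 2] at hdj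
    exact ⟨hcoprime.dvd_of_dvd_mul_left hdj, hodd.pos.ne'⟩

theorem oddPartProd_eq_prod_ordCompl (m : ℤ) (n : ℕ) :
    oddPartProd m n = ∏ j ∈ Finset.Ioc 0 n, (m ^ (ordCompl[2] j) - 1) := by
  have hpart : ∀ j ∈ Finset.Ioc 0 n, m ^ (ordCompl[2] j) - 1 = oddSmallPart m n j := fun j hj => by
    obtain ⟨hj0, hjn⟩ := Finset.mem_Ioc.mp hj
    rw [← prod_eval_cyclotomic (Nat.ordCompl_pos 2 hj0.ne'), divisors_ordCompl_two hj0 hjn]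
    rfl
  rw [Finset.prod_congr rfl hpart, prod_oddSmallPart m n _ fun j => j, oddPartProd]
  simp_rw [Nat.Ioc_filter_dvd_card_eq_div]

theorem ordCompl_two_two_mul (j : ℕ) : ordCompl[2] (2 * j) = ordCompl[2] j := by
  rw [Nat.ordCompl_mul 2 j 2]
  simp [Nat.prime_two.factorization_self]

theorem ordCompl_two_of_odd {j : ℕ} (hj : Odd j) : ordCompl[2] j = j := by
  rw [Nat.factorization_eq_zero_of_not_dvd hj.not_two_dvd_nat, pow_zero, Nat.div_one]

theorem sum_ordCompl_two_two_mul (k : ℕ) :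
    ∑ j ∈ Finset.Ioc 0 (2 * k), ordCompl[2] j = ∑ j ∈ Finset.Ioc 0 k, ordCompl[2] j + k ^ 2 := by
  induction k with
  | zero => simp
  | succ k ih =>
    rw [show 2 * (k + 1) = 2 * k + 1 + 1 by ring, Finset.sum_Ioc_succ_top (Nat.zero_le _),
      Finset.sum_Ioc_succ_top (Nat.zero_le _), ih, Finset.sum_Ioc_succ_top (Nat.zero_le _),
      ordCompl_two_of_odd ⟨k, rfl⟩, show 2 * k + 1 + 1 = 2 * (k + 1) by ring, ordCompl_two_two_mul]
    ring

theorem sum_ordCompl_two_bounds (n : ℕ) :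
    n ^ 2 ≤ 3 * ∑ j ∈ Finset.Ioc 0 n, ordCompl[2] j ∧
      3 * ∑ j ∈ Finset.Ioc 0 n, ordCompl[2] j ≤ n ^ 2 + 3 * n := by
  induction n using Nat.strong_induction_on with
  | _ n ih =>
    obtain ⟨k, rfl | rfl⟩ := n.even_or_odd'
    · rcases k.eq_zero_or_pos with rfl | hk
      · simp
      · have := ih k (by omega)
        rw [sum_ordCompl_two_two_mul]
        constructor <;> nlinarith
    · have := ih k (by omega)
      rw [Finset.sum_Ioc_succ_top (Nat.zero_le _), sum_ordCompl_two_two_mul,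
        ordCompl_two_of_odd ⟨k, rfl⟩]
      constructor <;> nlinarith

theorem sum_range_two_mul_add_two (n : ℕ) : ∑ i ∈ Finset.range n, (2 * i + 2) = n ^ 2 + n := by
  induction n with
  | zero => simp
  | succ n ih => rw [Finset.sum_range_succ, ih]; ring

theorem tendsto_log_evenPowProd {m : ℤ} (hm : 2 ≤ |m|) :
    Tendsto (fun N : ℕ => Real.log |((evenPowProd m (2 * N) : ℤ) : ℝ)| / (N : ℝ) ^ 2) atTop
      (𝓝 (4 * Real.log |(m : ℝ)|)) := by
  refine tendsto_div_sq_of_abs_sub_le (C := 2) (.of_forall fun N => ?_)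
    (tendsto_quadratic_div_sq (4 * Real.log |(m : ℝ)|) (2 * Real.log |(m : ℝ)|) 0)
  have h := abs_log_prod_pow_sub_one_sub_le hm (Finset.range (2 * N)) (f := fun i => 2 * i + 2)
    fun i _ => (2 * i + 1).succ_ne_zero
  rw [sum_range_two_mul_add_two, Finset.card_range, ← evenPowProd] at h
  push_cast at h
  rw [show 4 * Real.log |(m : ℝ)| * (N : ℝ) ^ 2 + 2 * Real.log |(m : ℝ)| * N + 0
    = ((2 * (N : ℝ)) ^ 2 + 2 * N) * Real.log |(m : ℝ)| by ring]
  linarith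

theorem tendsto_log_oddPartProd {m : ℤ} (hm : 2 ≤ |m|) :
    Tendsto (fun N : ℕ => Real.log |((oddPartProd m (2 * N) : ℤ) : ℝ)| / (N : ℝ) ^ 2) atTop
      (𝓝 (4 / 3 * Real.log |(m : ℝ)|)) := by
  set ℓ := Real.log |(m : ℝ)|
  have hℓ : 0 ≤ ℓ := Real.log_nonneg (by linarith [two_le_abs_cast hm])
  refine tendsto_div_sq_of_abs_sub_le (C := 2 + 2 * ℓ) (.of_forall fun N => ?_)
    (tendsto_quadratic_div_sq (4 / 3 * ℓ) 0 0)
  have hlog := abs_log_prod_pow_sub_one_sub_le hm (Finset.Ioc 0 (2 * N))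
    (f := fun j => ordCompl[2] j) fun j hj => (Nat.ordCompl_pos 2 (Finset.mem_Ioc.mp hj).1.ne').ne'
  rw [← oddPartProd_eq_prod_ordCompl, Nat.card_Ioc, Nat.sub_zero] at hlog
  obtain ⟨hlower, hupper⟩ := sum_ordCompl_two_bounds (2 * N)
  generalize (∑ j ∈ Finset.Ioc 0 (2 * N), ordCompl[2] j) = S at *
  have hlower' : ((2 * N : ℕ) : ℝ) ^ 2 ≤ 3 * S := by exact_mod_cast hlower
  have hupper' : 3 * (S : ℝ) ≤ ((2 * N : ℕ) : ℝ) ^ 2 + 3 * (2 * N : ℕ) := by exact_mod_cast hupper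
  push_cast at hlog hlower' hupper'
  have hSℓ : 4 / 3 * (N : ℝ) ^ 2 * ℓ ≤ S * ℓ := by gcongr; linarith
  have hSℓ' : S * ℓ ≤ (4 / 3 * (N : ℝ) ^ 2 + 2 * N) * ℓ := by gcongr; linarith
  rw [abs_le] at hlog ⊢
  constructor <;> nlinarith

theorem tendsto_comp_four_mul_div_sq {f : ℕ → ℝ} {l : ℝ}
    (hf : Tendsto (fun N : ℕ => f N / (N : ℝ) ^ 2) atTop (𝓝 l)) :
    Tendsto (fun N : ℕ => f (2 * (2 * N)) / (N : ℝ) ^ 2) atTop (𝓝 (16 * l)) := by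
  have hatTop : Tendsto (fun N : ℕ => 2 * (2 * N)) atTop atTop :=
    tendsto_atTop_mono (fun N => by simp only [id]; omega) tendsto_id
  refine ((hf.comp hatTop).const_mul 16).congr fun N => ?_
  simp only [Function.comp_apply, Nat.cast_mul, Nat.cast_ofNat]
  rw [show (2 * (2 * (N : ℝ))) ^ 2 = 16 * (N : ℝ) ^ 2 by ring, ← mul_div_assoc,
    mul_div_mul_left _ _ (by norm_num)]

theorem tendsto_log_cyclotomicProd {m : ℤ} (hm : 2 ≤ |m|) :
    Tendsto (fun N : ℕ => Real.log |((cyclotomicProd m (2 * N) : ℤ) : ℝ)| / (N : ℝ) ^ 2) atTop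
      (𝓝 (48 / Real.pi ^ 2 * Real.log |(m : ℝ)|)) :=
  (tendsto_comp_four_mul_div_sq (tendsto_log_prod_eval_cyclotomic hm (fun _ => subset_rfl)
    tendsto_sum_totient)).trans_eq (by congr 1; ring)

theorem tendsto_log_oddCyclotomicProd {m : ℤ} (hm : 2 ≤ |m|) :
    Tendsto (fun N : ℕ => Real.log |((oddCyclotomicProd m (2 * N) : ℤ) : ℝ)| / (N : ℝ) ^ 2) atTop
      (𝓝 (32 / Real.pi ^ 2 * Real.log |(m : ℝ)|)) :=
  (tendsto_comp_four_mul_div_sq (tendsto_log_prod_eval_cyclotomic hm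
    (fun _ => Finset.filter_subset _ _) tendsto_sum_totient_odd)).trans_eq (by congr 1; ring)

/-! ### Partial fractions -/

section PartialFractions

open Polynomial

variable {K : Type*} [Field K]

theorem coe_comp_eq_aeval (P Q : K[X]) :
    ((P.comp Q : K[X]) : PowerSeries K) = aeval (Q : PowerSeries K) P := by
  rw [comp_eq_aeval]
  exact (aeval_algHom_apply (coeToPowerSeries.algHom K) Q P).symm

-- `1 - a⁻¹ X` is the local parameter at the pole `a`, and `t ↦ a (1 - t)` its inverse substitution.
theorem X_sub_C_pow_dvd_sub_trunc_comp {a : K} (ha : a ≠ 0) {A : ℕ} {P Q : K[X]}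
    {g : PowerSeries K}
    (hg : aeval (PowerSeries.C a * (1 - PowerSeries.X)) P
      = g * aeval (PowerSeries.C a * (1 - PowerSeries.X)) Q) :
    (X - C a) ^ A ∣ P - (PowerSeries.trunc A g).comp (1 - C a⁻¹ * X) * Q := by
  have hsubst : ((C a * (1 - X) : K[X]) : PowerSeries K)
      = PowerSeries.C a * (1 - PowerSeries.X) := by simp
  rw [← hsubst, ← coe_comp_eq_aeval, ← coe_comp_eq_aeval] at hg
  have hlocal :
      X ^ A ∣ P.comp (C a * (1 - X)) - PowerSeries.trunc A g * Q.comp (C a * (1 - X)) := by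
    rw [X_pow_dvd_iff]
    intro d hd
    rw [← coeff_coe, coe_sub, coe_mul, hg, ← sub_mul, PowerSeries.coeff_mul]
    refine Finset.sum_eq_zero fun y hy => ?_
    have hy' : y.1 < A := by
      have := Finset.HasAntidiagonal.mem_antidiagonal.mp hy; omega
    rw [map_sub, coeff_coe, PowerSeries.coeff_trunc, if_pos hy', sub_self, zero_mul]
  have hinv : (C a * (1 - X) : K[X]).comp (1 - C a⁻¹ * X) = X := by
    simp only [mul_comp, C_comp, sub_comp, one_comp, X_comp, sub_sub_cancel]
    rw [← mul_assoc, ← C_mul, mul_inv_cancel₀ ha, C_1, one_mul]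
  have hparam : X - C a = C (-a) * (1 - C a⁻¹ * X) := by
    rw [mul_sub, ← mul_assoc, ← C_mul, neg_mul, mul_inv_cancel₀ ha]
    simp [neg_add_eq_sub]
  obtain ⟨W, hW⟩ := hlocal
  have hW' : P - (PowerSeries.trunc A g).comp (1 - C a⁻¹ * X) * Q
      = (1 - C a⁻¹ * X) ^ A * W.comp (1 - C a⁻¹ * X) := by
    rw [← X_pow_comp, ← mul_comp, ← hW, sub_comp, mul_comp, comp_assoc, comp_assoc, hinv, comp_X,
      comp_X]
  have hunit : IsUnit (C (-a) ^ A : K[X]) := (isUnit_C.mpr (neg_ne_zero.mpr ha).isUnit).pow A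
  rw [hW', hparam, mul_pow, hunit.mul_left_dvd]
  exact dvd_mul_right _ _

variable {ι : Type*} [DecidableEq ι] {s : Finset ι} {a : ι → K} {A : ℕ} {P : K[X]}

theorem natDegree_prod_erase_pow_le {j : ι} (hj : j ∈ s) :
    (∏ i ∈ s.erase j, (C (a i) - X) ^ A).natDegree ≤ A * (s.card - 1) := by
  have hfactor (i : ι) : ((C (a i) - X) ^ A).natDegree ≤ A :=
    natDegree_pow_le.trans (mul_le_of_le_one_right' ((natDegree_sub_le _ _).trans (by simp)))
  refine (natDegree_prod_le _ _).trans
    ((Finset.sum_le_card_nsmul _ _ A fun i _ => hfactor i).trans ?_)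
  rw [Finset.card_erase_of_mem hj, smul_eq_mul, mul_comm]

-- The difference of the two sides is divisible by a polynomial of degree `A * s.card`.
theorem eq_sum_mul_prod_erase_of_dvd_sub (ha : Set.InjOn a s) (hP : P.natDegree < A * s.card)
    {R : ι → K[X]} (hR : ∀ j ∈ s, (R j).natDegree < A)
    (hdvd : ∀ j ∈ s, (X - C (a j)) ^ A ∣ P - R j * ∏ i ∈ s.erase j, (C (a i) - X) ^ A) :
    P = ∑ j ∈ s, R j * ∏ i ∈ s.erase j, (C (a i) - X) ^ A := by
  set F := P - ∑ j ∈ s, R j * ∏ i ∈ s.erase j, (C (a i) - X) ^ A with hF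
  have hF_dvd : ∀ j ∈ s, (X - C (a j)) ^ A ∣ F := by
    intro j hj
    rw [hF, ← Finset.add_sum_erase s _ hj, ← sub_sub]
    refine dvd_sub (hdvd j hj) (Finset.dvd_sum fun i hi => dvd_mul_of_dvd_right ?_ _)
    have hji : j ∈ s.erase i := Finset.mem_erase.mpr ⟨(Finset.ne_of_mem_erase hi).symm, hj⟩
    exact (pow_dvd_pow_of_dvd ⟨-1, by ring⟩ A).trans (Finset.dvd_prod_of_mem _ hji)
  have hprod_dvd : ∏ j ∈ s, (X - C (a j)) ^ A ∣ F := by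
    refine Finset.prod_dvd_of_coprime (fun i hi j hj hij => IsCoprime.pow ?_) hF_dvd
    refine isCoprime_X_sub_C_of_isUnit_sub (isUnit_iff_ne_zero.mpr (sub_ne_zero.mpr fun h => ?_))
    exact hij (ha hi hj h)
  have hprod_deg : (∏ j ∈ s, (X - C (a j)) ^ A).natDegree = A * s.card := by
    rw [natDegree_prod_of_monic _ _ fun j _ => (monic_X_sub_C _).pow A]
    simp [mul_comm]
  have hterm_deg : ∀ j ∈ s,
      (R j * ∏ i ∈ s.erase j, (C (a i) - X) ^ A).natDegree ≤ A * s.card - 1 := by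
    intro j hj
    have hcard : A * s.card = A * (s.card - 1) + A := by
      rw [← Nat.mul_succ, Nat.succ_eq_add_one, Nat.sub_add_cancel (Finset.card_pos.mpr ⟨j, hj⟩)]
    have := natDegree_prod_erase_pow_le (a := a) (A := A) hj
    have := hR j hj
    refine natDegree_mul_le.trans ?_
    omega
  have hF_deg : F.natDegree < A * s.card := by
    have : F.natDegree ≤ A * s.card - 1 := (natDegree_sub_le _ _).trans
      (max_le (by omega) (natDegree_sum_le_of_forall_le _ _ hterm_deg))
    omega
  exact sub_eq_zero.mp (eq_zero_of_dvd_of_natDegree_lt hprod_dvd (hprod_deg ▸ hF_deg))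

theorem eval_trunc_comp_div_pow {b x : K} (hb : b ≠ 0) (hx : x ≠ b) (g : PowerSeries K) :
    (C (b ^ A) * (PowerSeries.trunc A g).comp (1 - C b⁻¹ * X)).eval x / (b - x) ^ A
      = ∑ k ∈ Finset.range A, PowerSeries.coeff k g * (1 / (1 - x / b)) ^ (A - k) := by
  have hfac : b - x = b * (1 - x / b) := by field_simp
  have hparam : 1 - x / b ≠ 0 := right_ne_zero_of_mul (hfac ▸ sub_ne_zero.mpr hx.symm)
  rw [hfac, mul_pow, eval_mul, eval_C, mul_div_mul_left _ _ (pow_ne_zero _ hb), eval_comp,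
    eval, PowerSeries.eval₂_trunc_eq_sum_range, Finset.sum_div]
  refine Finset.sum_congr rfl fun k hk => ?_
  have hA : (1 - x / b) ^ A = (1 - x / b) ^ k * (1 - x / b) ^ (A - k) := by
    rw [← pow_add, Nat.add_sub_cancel' (Finset.mem_range.mp hk).le]
  simp only [eval_sub, eval_one, eval_mul, eval_C, eval_X, inv_mul_eq_div, RingHom.id_apply]
  rw [hA, one_div, inv_pow, mul_comm (PowerSeries.coeff k g) (_ ^ k),
    mul_div_mul_left _ _ (pow_ne_zero _ hparam), div_eq_mul_inv]

theorem partial_fractions (ha : Set.InjOn a s) (ha0 : ∀ j ∈ s, a j ≠ 0)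
    (hP : P.natDegree < A * s.card) (g : ι → PowerSeries K)
    (hg : ∀ j ∈ s, aeval (PowerSeries.C (a j) * (1 - PowerSeries.X)) P
      = g j * (PowerSeries.C (a j ^ A) * ∏ i ∈ s.erase j,
          (PowerSeries.C (a i) - PowerSeries.C (a j) * (1 - PowerSeries.X)) ^ A))
    {x : K} (hx : ∀ j ∈ s, x ≠ a j) :
    P.eval x / ∏ j ∈ s, (a j - x) ^ A
      = ∑ j ∈ s, ∑ k ∈ Finset.range A,
          PowerSeries.coeff k (g j) * (1 / (1 - x / a j)) ^ (A - k) := by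
  have hA : 0 < A := pos_of_mul_pos_left (hP.pos) (Nat.zero_le _)
  let R (j : ι) : K[X] := C (a j ^ A) * (PowerSeries.trunc A (g j)).comp (1 - C (a j)⁻¹ * X)
  have hR (j : ι) : (R j).natDegree < A := by
    have hlin : (1 - C (a j)⁻¹ * X : K[X]).natDegree ≤ 1 :=
      (natDegree_sub_le _ _).trans (by simpa using natDegree_C_mul_le (a j)⁻¹ X)
    calc (R j).natDegree
        ≤ (PowerSeries.trunc A (g j)).natDegree * (1 - C (a j)⁻¹ * X : K[X]).natDegree :=
          (natDegree_C_mul_le _ _).trans natDegree_comp_le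
      _ ≤ (PowerSeries.trunc A (g j)).natDegree := mul_le_of_le_one_right' hlin
      _ < A := by
        obtain ⟨A', rfl⟩ := Nat.exists_eq_succ_of_ne_zero hA.ne'
        exact PowerSeries.natDegree_trunc_lt (g j) A'
  have hdvd : ∀ j ∈ s, (X - C (a j)) ^ A ∣ P - R j * ∏ i ∈ s.erase j, (C (a i) - X) ^ A := by
    intro j hj
    have := X_sub_C_pow_dvd_sub_trunc_comp (ha0 j hj) (A := A) (P := P) (g := g j)
      (Q := C (a j ^ A) * ∏ i ∈ s.erase j, (C (a i) - X) ^ A)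
      (by simpa [PowerSeries.algebraMap_eq] using hg j hj)
    convert this using 2
    ring
  rw [eq_sum_mul_prod_erase_of_dvd_sub ha hP (fun j _ => hR j) hdvd, eval_finsetSum, Finset.sum_div]
  refine Finset.sum_congr rfl fun j hj => ?_
  rw [← eval_trunc_comp_div_pow (ha0 j hj) (hx j hj), ← Finset.mul_prod_erase s _ hj, eval_mul]
  simp only [eval_prod, eval_pow, eval_sub, eval_C, eval_X]
  refine mul_div_mul_right _ _ (Finset.prod_ne_zero_iff.mpr fun i hi => pow_ne_zero _ ?_)
  exact sub_ne_zero.mpr (hx i (Finset.mem_of_mem_erase hi)).symm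

end PartialFractions

/-! ### The rational function -/

/-- The order `A = 2 (r + b) + 1` of the poles of `formFun`. -/
def poleOrder (r b : ℕ) : ℕ := 2 * (r + b) + 1

/-- The order of vanishing of `formFun` at the origin. -/
def zeroOrder (r b N : ℕ) : ℕ := (2 * b + 1) * N + r + b

theorem two_mul_zeroOrder (r b N : ℕ) :
    2 * zeroOrder r b N + 2 * (r * (2 * N)) + 1 = poleOrder r b * (2 * N + 1) := by
  simp only [zeroOrder, poleOrder]
  ring

open Polynomial in
/-- The numerator of the rational function `formFun`. The power of `p` in front is the one that
makes the expansions at the poles integral when `p` is an integer. -/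
noncomputable def formNum (p : ℝ) (r b N : ℕ) : ℝ[X] :=
  C (p ^ (poleOrder r b * N ^ 2 + 2 * N)) * X ^ zeroOrder r b N * (C (p ^ (2 * N)) - X) *
    (∏ i ∈ Finset.range (r * (2 * N)), (1 - C (p ^ (2 * i + 1)) * X)) *
    ∏ i ∈ Finset.range (r * (2 * N)), (C (p ^ (4 * N + 2 * i + 1)) - X)

/-- The well-poised rational function whose values at the odd powers of `1 / p` are summed to give
the linear forms; its poles are the `p ^ (2 j)` with `j ≤ 2 N`. -/
noncomputable def formFun (p : ℝ) (r b N : ℕ) (x : ℝ) : ℝ :=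
  (formNum p r b N).eval x / ∏ j ∈ Finset.range (2 * N + 1), (p ^ (2 * j) - x) ^ poleOrder r b

/-- The exponent of `p` in the expansion of `formFun` at the pole `p ^ (2 j)`. -/
def localExp (r b N j : ℕ) : ℕ := poleOrder r b * ((N : ℤ) - j).natAbs ^ 2 + (2 * N - j)

theorem localExp_add (r b N j : ℕ) (hj : j ≤ 2 * N) :
    localExp r b N j + poleOrder r b * (2 * j + (j * (j - 1) + 2 * j * (2 * N - j)))
      = poleOrder r b * N ^ 2 + 2 * N + 2 * j * zeroOrder r b N + 2 * j * (r * (2 * N)) := by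
  have hzero := two_mul_zeroOrder r b N
  have hpred : (j : ℤ) * (j - 1 : ℕ) = j ^ 2 - j := by
    rcases j with _ | j
    · simp
    · push_cast [Nat.add_sub_cancel]; ring
  unfold localExp
  zify [hj] at hzero ⊢
  rw [sq_abs, mul_add (poleOrder r b : ℤ), mul_add (poleOrder r b : ℤ), hpred]
  linear_combination (-(j : ℤ)) * hzero

/-- The product of `formFun` and `t ^ A`, with `t = 1 - x / p ^ (2 j)` the local parameter at the
pole `p ^ (2 j)`, as a power series in `t`. -/
noncomputable def localSeries (p : ℝ) (r b N j : ℕ) : PowerSeries ℝ :=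
  PowerSeries.C (p ^ localExp r b N j) * (1 - PowerSeries.X) ^ zeroOrder r b N *
    (PowerSeries.C (p ^ (2 * N)) - PowerSeries.C (p ^ (2 * j)) * (1 - PowerSeries.X)) *
    (∏ i ∈ Finset.range (r * (2 * N)),
      (1 - PowerSeries.C (p ^ (2 * i + (2 * j + 1))) * (1 - PowerSeries.X))) *
    (∏ i ∈ Finset.range (r * (2 * N)),
      (PowerSeries.C (p ^ (2 * i + (2 * (2 * N - j) + 1))) - (1 - PowerSeries.X))) *
    ((∏ i ∈ Finset.range j, (1 - PowerSeries.C (p ^ (2 * i + 2)) * (1 - PowerSeries.X))⁻¹) *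
      ∏ i ∈ Finset.range (2 * N - j),
        (PowerSeries.C (p ^ (2 * i + 2)) - (1 - PowerSeries.X))⁻¹) ^ poleOrder r b

theorem prod_range_erase {M : Type*} [CommMonoid M] (f : ℕ → M) (j k : ℕ) :
    ∏ i ∈ (Finset.range (j + k + 1)).erase j, f i
      = (∏ i ∈ Finset.range j, f i) * ∏ i ∈ Finset.range k, f (j + 1 + i) := by
  have hset : (Finset.range (j + k + 1)).erase j
      = Finset.range j ∪ Finset.Ico (j + 1) (j + k + 1) := by
    ext i
    simp only [Finset.mem_erase, Finset.mem_range, Finset.mem_union, Finset.mem_Ico]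
    omega
  have hdisj : Disjoint (Finset.range j) (Finset.Ico (j + 1) (j + k + 1)) := by
    simp only [Finset.disjoint_left, Finset.mem_range, Finset.mem_Ico]
    omega
  rw [hset, Finset.prod_union hdisj, Finset.prod_Ico_eq_prod_range]
  congr! 3
  omega

section Rescaling

variable {S : Type*} [CommRing S] (c y : S)

theorem prod_pow_add_sub_pow_mul (e j n : ℕ) :
    ∏ i ∈ Finset.range n, (c ^ (2 * j + (2 * i + e)) - c ^ (2 * j) * y)
      = c ^ (2 * j * n) * ∏ i ∈ Finset.range n, (c ^ (2 * i + e) - y) := by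
  rw [pow_mul c (2 * j) n]
  nth_rw 2 [← Finset.card_range n]
  rw [Finset.pow_card_mul_prod]
  exact Finset.prod_congr rfl fun i _ => by rw [pow_add, mul_sub]

theorem prod_erase_pow_sub {n j : ℕ} (hj : j ≤ n) :
    ∏ i ∈ (Finset.range (n + 1)).erase j, (c ^ (2 * i) - c ^ (2 * j) * y)
      = c ^ (j * (j - 1) + 2 * j * (n - j)) * ((∏ i ∈ Finset.range j, (1 - c ^ (2 * i + 2) * y)) *
          ∏ i ∈ Finset.range (n - j), (c ^ (2 * i + 2) - y)) := by
  obtain ⟨k, rfl⟩ := Nat.exists_eq_add_of_le hj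
  have hlow : ∏ i ∈ Finset.range j, (c ^ (2 * i) - c ^ (2 * j) * y)
      = c ^ (j * (j - 1)) * ∏ i ∈ Finset.range j, (1 - c ^ (2 * i + 2) * y) := by
    rw [← Finset.prod_range_reflect (fun i => 1 - c ^ (2 * i + 2) * y),
      ← Finset.sum_range_id_mul_two, Finset.sum_mul, ← Finset.prod_pow_eq_pow_sum,
      ← Finset.prod_mul_distrib]
    refine Finset.prod_congr rfl fun i hi => ?_
    have := Finset.mem_range.mp hi
    rw [mul_sub, ← mul_assoc, ← pow_add, mul_one, mul_comm i 2,
      show 2 * i + (2 * (j - 1 - i) + 2) = 2 * j by omega]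
  have hhigh : ∏ i ∈ Finset.range k, (c ^ (2 * (j + 1 + i)) - c ^ (2 * j) * y)
      = c ^ (2 * j * k) * ∏ i ∈ Finset.range k, (c ^ (2 * i + 2) - y) := by
    rw [← prod_pow_add_sub_pow_mul]
    exact Finset.prod_congr rfl fun i _ => by ring
  rw [prod_range_erase, hlow, hhigh, Nat.add_sub_cancel_left, pow_add]
  ring

-- The substitution `x = c ^ (2 j) y` in `formNum`, over any commutative ring.
theorem formNum_rescale (r b N : ℕ) {j : ℕ} (hj : j ≤ 2 * N) :
    c ^ (poleOrder r b * N ^ 2 + 2 * N) * (c ^ (2 * j) * y) ^ zeroOrder r b N *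
        (c ^ (2 * N) - c ^ (2 * j) * y) *
        (∏ i ∈ Finset.range (r * (2 * N)), (1 - c ^ (2 * i + 1) * (c ^ (2 * j) * y))) *
        ∏ i ∈ Finset.range (r * (2 * N)), (c ^ (4 * N + 2 * i + 1) - c ^ (2 * j) * y)
      = c ^ localExp r b N j * y ^ zeroOrder r b N * (c ^ (2 * N) - c ^ (2 * j) * y) *
        (∏ i ∈ Finset.range (r * (2 * N)), (1 - c ^ (2 * i + (2 * j + 1)) * y)) *
        (∏ i ∈ Finset.range (r * (2 * N)), (c ^ (2 * i + (2 * (2 * N - j) + 1)) - y)) *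
        (c ^ (2 * j) * c ^ (j * (j - 1) + 2 * j * (2 * N - j))) ^ poleOrder r b := by
  have hpow : c ^ localExp r b N j *
        (c ^ (2 * j) * c ^ (j * (j - 1) + 2 * j * (2 * N - j))) ^ poleOrder r b
      = c ^ (poleOrder r b * N ^ 2 + 2 * N) * (c ^ (2 * j)) ^ zeroOrder r b N *
        c ^ (2 * j * (r * (2 * N))) := by
    rw [← pow_add, ← pow_mul, ← pow_mul, ← pow_add, ← pow_add, ← pow_add, ← localExp_add r b N j hj,
      mul_comm (poleOrder r b)]
  have hfirst : ∏ i ∈ Finset.range (r * (2 * N)), (1 - c ^ (2 * i + 1) * (c ^ (2 * j) * y))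
      = ∏ i ∈ Finset.range (r * (2 * N)), (1 - c ^ (2 * i + (2 * j + 1)) * y) :=
    Finset.prod_congr rfl fun i _ => by ring
  have hsecond : ∏ i ∈ Finset.range (r * (2 * N)), (c ^ (4 * N + 2 * i + 1) - c ^ (2 * j) * y)
      = c ^ (2 * j * (r * (2 * N))) *
        ∏ i ∈ Finset.range (r * (2 * N)), (c ^ (2 * i + (2 * (2 * N - j) + 1)) - y) := by
    rw [← prod_pow_add_sub_pow_mul]
    refine Finset.prod_congr rfl fun i _ => ?_
    rw [show 4 * N + 2 * i + 1 = 2 * j + (2 * i + (2 * (2 * N - j) + 1)) by omega]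
  rw [hfirst, hsecond, mul_pow (c ^ (2 * j)) y]
  linear_combination (-(y ^ zeroOrder r b N * (c ^ (2 * N) - c ^ (2 * j) * y) *
    (∏ i ∈ Finset.range (r * (2 * N)), (1 - c ^ (2 * i + (2 * j + 1)) * y)) *
    ∏ i ∈ Finset.range (r * (2 * N)), (c ^ (2 * i + (2 * (2 * N - j) + 1)) - y))) * hpow

end Rescaling

theorem prod_inv_mul_prod_eq_one {p : ℝ} (hp : 2 ≤ |p|) (j k : ℕ) :
    ((∏ i ∈ Finset.range j, (1 - PowerSeries.C (p ^ (2 * i + 2)) * (1 - PowerSeries.X))⁻¹) *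
        ∏ i ∈ Finset.range k, (PowerSeries.C (p ^ (2 * i + 2)) - (1 - PowerSeries.X))⁻¹) *
      ((∏ i ∈ Finset.range j, (1 - PowerSeries.C (p ^ (2 * i + 2)) * (1 - PowerSeries.X))) *
        ∏ i ∈ Finset.range k, (PowerSeries.C (p ^ (2 * i + 2)) - (1 - PowerSeries.X))) = 1 := by
  have hne (i : ℕ) : p ^ (2 * i + 2) - 1 ≠ 0 := pow_sub_one_ne_zero hp (by omega)
  rw [mul_mul_mul_comm, ← Finset.prod_mul_distrib, ← Finset.prod_mul_distrib]
  refine (congrArg₂ HMul.hMul (Finset.prod_eq_one fun i _ => PowerSeries.inv_mul_cancel _ ?_)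
    (Finset.prod_eq_one fun i _ => PowerSeries.inv_mul_cancel _ ?_)).trans (mul_one 1)
  · simpa using sub_ne_zero.mpr (sub_ne_zero.mp (hne i)).symm
  · simpa using hne i

theorem aeval_formNum {p : ℝ} (hp : 2 ≤ |p|) (r b N j : ℕ) (hj : j ≤ 2 * N) :
    Polynomial.aeval (PowerSeries.C (p ^ (2 * j)) * (1 - PowerSeries.X)) (formNum p r b N)
      = localSeries p r b N j * (PowerSeries.C ((p ^ (2 * j)) ^ poleOrder r b) *
          ∏ i ∈ (Finset.range (2 * N + 1)).erase j, (PowerSeries.C (p ^ (2 * i))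
            - PowerSeries.C (p ^ (2 * j)) * (1 - PowerSeries.X)) ^ poleOrder r b) := by
  have hinv := congrArg (· ^ poleOrder r b) (prod_inv_mul_prod_eq_one hp j (2 * N - j))
  have hrescale := formNum_rescale (PowerSeries.C p) (1 - PowerSeries.X) r b N hj
  simp only [formNum, localSeries, map_mul, map_sub, map_prod, map_pow, map_one,
    Polynomial.aeval_X, Polynomial.aeval_C, PowerSeries.algebraMap_eq, one_pow, mul_pow] at *
  rw [hrescale, Finset.prod_pow, prod_erase_pow_sub (PowerSeries.C p) _ hj]
  refine (mul_one _).symm.trans ((congrArg (HMul.hMul _) hinv.symm).trans ?_)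
  ring

theorem natDegree_formNum_lt (p : ℝ) {r : ℕ} (hr : 1 ≤ r) (b N : ℕ) :
    (formNum p r b N).natDegree < poleOrder r b * (2 * N + 1) := by
  have hprod (f : ℕ → Polynomial ℝ) (hf : ∀ i, (f i).natDegree ≤ 1) :
      (∏ i ∈ Finset.range (r * (2 * N)), f i).natDegree ≤ r * (2 * N) :=
    (Polynomial.natDegree_prod_le _ _).trans
      ((Finset.sum_le_card_nsmul _ _ 1 fun i _ => hf i).trans (by simp))
  have hlinear (u : ℝ) : (Polynomial.C u - Polynomial.X).natDegree ≤ 1 :=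
    (Polynomial.natDegree_sub_le _ _).trans (by simp)
  have hlinear' (u : ℝ) : (1 - Polynomial.C u * Polynomial.X).natDegree ≤ 1 :=
    (Polynomial.natDegree_sub_le _ _).trans (max_le (by simp)
      ((Polynomial.natDegree_C_mul_le u _).trans Polynomial.natDegree_X_le))
  have hdeg : (formNum p r b N).natDegree
      ≤ 0 + zeroOrder r b N + 1 + r * (2 * N) + r * (2 * N) :=
    Polynomial.natDegree_mul_le_of_le (Polynomial.natDegree_mul_le_of_le
      (Polynomial.natDegree_mul_le_of_le (Polynomial.natDegree_mul_le_of_le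
        (Polynomial.natDegree_C _).le (Polynomial.natDegree_X_pow_le _)) (hlinear _))
      (hprod _ fun i => hlinear' _)) (hprod _ fun i => hlinear _)
  have := two_mul_zeroOrder r b N
  have : 1 ≤ zeroOrder r b N := by unfold zeroOrder; omega
  omega

theorem pow_injective_of_two_le_abs {p : ℝ} (hp : 2 ≤ |p|) :
    Function.Injective fun k : ℕ => p ^ k := by
  intro k l hkl
  have habs : |p| ^ k = |p| ^ l := by rw [← abs_pow, ← abs_pow]; exact congrArg _ hkl
  exact pow_right_injective₀ (by linarith) (by linarith) habs

theorem formFun_eq_sum {p : ℝ} (hp : 2 ≤ |p|) {r : ℕ} (hr : 1 ≤ r) (b N : ℕ) {x : ℝ}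
    (hx : ∀ j ∈ Finset.range (2 * N + 1), x ≠ p ^ (2 * j)) :
    formFun p r b N x = ∑ j ∈ Finset.range (2 * N + 1), ∑ k ∈ Finset.range (poleOrder r b),
      PowerSeries.coeff k (localSeries p r b N j) *
        (1 / (1 - x / p ^ (2 * j))) ^ (poleOrder r b - k) := by
  refine partial_fractions (fun i _ j _ hij => ?_)
    (fun j _ => pow_ne_zero _ (ne_zero_of_two_le_abs hp)) ?_ (localSeries p r b N)
    (fun j hj => aeval_formNum hp r b N j ?_) hx
  · have := pow_injective_of_two_le_abs hp hij
    omega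
  · simpa using natDegree_formNum_lt p hr b N
  · have := Finset.mem_range.mp hj
    omega

theorem formFun_zero (p : ℝ) {r : ℕ} (hr : 1 ≤ r) (b N : ℕ) : formFun p r b N 0 = 0 := by
  have : zeroOrder r b N ≠ 0 := by unfold zeroOrder; omega
  simp [formFun, formNum, this]

theorem sum_coeff_localSeries {p : ℝ} (hp : 2 ≤ |p|) {r : ℕ} (hr : 1 ≤ r) (b N : ℕ) :
    ∑ j ∈ Finset.range (2 * N + 1), ∑ k ∈ Finset.range (poleOrder r b),
      PowerSeries.coeff k (localSeries p r b N j) = 0 := by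
  have hzero := formFun_eq_sum hp hr b N (x := 0)
    (fun j _ => (pow_ne_zero _ (ne_zero_of_two_le_abs hp)).symm)
  simpa [formFun_zero p hr] using hzero.symm

theorem eval_formNum (p : ℝ) (r b N : ℕ) (x : ℝ) :
    (formNum p r b N).eval x
      = p ^ (poleOrder r b * N ^ 2 + 2 * N) * x ^ zeroOrder r b N * (p ^ (2 * N) - x) *
        (∏ i ∈ Finset.range (r * (2 * N)), (1 - p ^ (2 * i + 1) * x)) *
        ∏ i ∈ Finset.range (r * (2 * N)), (p ^ (4 * N + 2 * i + 1) - x) := by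
  simp [formNum, Polynomial.eval_prod]

section Reflection

variable (p : ℝ) {x : ℝ}

theorem eval_formNum_reflect (r b N : ℕ) (hx : x ≠ 0) :
    (formNum p r b N).eval (p ^ (4 * N) / x)
      = (-(p ^ (2 * N) / x)) ^ (poleOrder r b * (2 * N + 1)) * (formNum p r b N).eval x := by
  set n := r * (2 * N) with hn
  set z := p ^ (2 * N) with hz
  have hz2 : p ^ (4 * N) = z ^ 2 := by rw [hz]; ring
  have hmiddle : z - z ^ 2 / x = -(z / x) * (z - x) := by field_simp; ring
  have hfirst : ∏ i ∈ Finset.range n, (1 - p ^ (2 * i + 1) * (z ^ 2 / x))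
      = (-1 / x) ^ n * ∏ i ∈ Finset.range n, (p ^ (4 * N + 2 * i + 1) - x) := by
    nth_rw 2 [← Finset.card_range n]
    rw [Finset.pow_card_mul_prod]
    refine Finset.prod_congr rfl fun i _ => ?_
    rw [add_assoc, pow_add _ (4 * N), hz2]
    field_simp
    ring
  have hsecond : ∏ i ∈ Finset.range n, (p ^ (4 * N + 2 * i + 1) - z ^ 2 / x)
      = (-z ^ 2 / x) ^ n * ∏ i ∈ Finset.range n, (1 - p ^ (2 * i + 1) * x) := by
    nth_rw 2 [← Finset.card_range n]
    rw [Finset.pow_card_mul_prod]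
    refine Finset.prod_congr rfl fun i _ => ?_
    rw [add_assoc, pow_add _ (4 * N), hz2]
    field_simp
    ring
  have hfactor : (-(z / x)) ^ (poleOrder r b * (2 * N + 1)) * x ^ zeroOrder r b N
      = (z ^ 2 / x) ^ zeroOrder r b N * -(z / x) * ((-1 / x) ^ n * (-z ^ 2 / x) ^ n) := by
    rw [← two_mul_zeroOrder, pow_succ, pow_add, pow_mul, pow_mul, ← mul_pow, neg_sq,
      show -1 / x * (-z ^ 2 / x) = (z / x) ^ 2 by ring,
      show z ^ 2 / x = (z / x) ^ 2 * x by field_simp, mul_pow]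
    ring
  rw [eval_formNum, eval_formNum, ← hn, ← hz, hz2, hmiddle, hfirst, hsecond]
  linear_combination (-(p ^ (poleOrder r b * N ^ 2 + 2 * N) * (z - x) *
    (∏ i ∈ Finset.range n, (1 - p ^ (2 * i + 1) * x)) *
    ∏ i ∈ Finset.range n, (p ^ (4 * N + 2 * i + 1) - x))) * hfactor

theorem prod_pow_sub_reflect (N : ℕ) (hx : x ≠ 0) :
    ∏ j ∈ Finset.range (2 * N + 1), (p ^ (2 * j) - p ^ (4 * N) / x)
      = (-(p ^ (2 * N) / x)) ^ (2 * N + 1) *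
        ∏ j ∈ Finset.range (2 * N + 1), (p ^ (2 * j) - x) := by
  have hpow : (p ^ (2 * N)) ^ (2 * N + 1) = ∏ j ∈ Finset.range (2 * N + 1), p ^ (2 * j) := by
    rw [Finset.prod_pow_eq_pow_sum, ← pow_mul, ← Finset.mul_sum, mul_comm 2 (Finset.sum _ _),
      Finset.sum_range_id_mul_two, Nat.add_sub_cancel, mul_comm]
  have hsign : (-(p ^ (2 * N) / x)) ^ (2 * N + 1)
      = (∏ j ∈ Finset.range (2 * N + 1), p ^ (2 * j)) *
        (-1 / x) ^ (Finset.range (2 * N + 1)).card := by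
    rw [← hpow, Finset.card_range, ← mul_pow]
    ring
  rw [hsign, Finset.prod_mul_pow_card, ← Finset.prod_range_reflect (fun j => p ^ (2 * j) - x),
    ← Finset.prod_mul_distrib]
  refine Finset.prod_congr rfl fun j hj => ?_
  have := Finset.mem_range.mp hj
  rw [show 4 * N = 2 * j + 2 * (2 * N + 1 - 1 - j) by omega, pow_add]
  field_simp
  ring

theorem formFun_reflect (hp : p ≠ 0) (r b N : ℕ) (hx : x ≠ 0) :
    formFun p r b N (p ^ (4 * N) / x) = formFun p r b N x := by
  have hne : (-(p ^ (2 * N) / x)) ^ (poleOrder r b * (2 * N + 1)) ≠ 0 :=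
    pow_ne_zero _ (neg_ne_zero.mpr (div_ne_zero (pow_ne_zero _ hp) hx))
  rw [formFun, formFun, Finset.prod_pow, Finset.prod_pow, prod_pow_sub_reflect p N hx,
    eval_formNum_reflect p r b N hx, mul_pow, ← pow_mul, mul_comm (2 * N + 1),
    mul_div_mul_left _ _ hne]

end Reflection

/-! ### Integrality of the local expansions -/

theorem inv_linear_series {K : Type*} [Field K] {α : K} (hα : α ≠ 0) (β : K) :
    (PowerSeries.C α + PowerSeries.C β * PowerSeries.X)⁻¹
      = PowerSeries.mk fun k => α⁻¹ * (-(β / α)) ^ k := by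
  rw [eq_comm, PowerSeries.eq_inv_iff_mul_eq_one (by simpa using hα)]
  ext k
  rw [mul_add, map_add, mul_comm _ (PowerSeries.C α), PowerSeries.coeff_C_mul, mul_left_comm,
    PowerSeries.coeff_C_mul]
  rcases k with _ | k
  · simp [hα]
  · rw [PowerSeries.coeff_succ_mul_X, PowerSeries.coeff_mk, PowerSeries.coeff_mk,
      PowerSeries.coeff_one, if_neg (by omega), pow_succ]
    field_simp
    ring

theorem one_sub_C_mul_one_sub_X {R : Type*} [CommRing R] (u : R) :
    (1 : PowerSeries R) - PowerSeries.C u * (1 - PowerSeries.X)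
      = PowerSeries.C (1 - u) + PowerSeries.C u * PowerSeries.X := by
  rw [map_sub, map_one]
  ring

theorem C_sub_one_sub_X {R : Type*} [CommRing R] (u : R) :
    PowerSeries.C u - (1 - PowerSeries.X)
      = PowerSeries.C (u - 1) + PowerSeries.C 1 * PowerSeries.X := by
  rw [map_sub, map_one]
  ring

/-- The ring of real power series that become integral when the variable is multiplied by `D`. -/
noncomputable def integralSeries (D : ℤ) : Subring (PowerSeries ℝ) :=
  ((PowerSeries.map (Int.castRingHom ℝ)).range).comap (PowerSeries.rescale (D : ℝ))

section IntegralSeries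

variable {D : ℤ}

theorem mem_integralSeries {g : PowerSeries ℝ} :
    g ∈ integralSeries D ↔ ∀ k, ∃ z : ℤ, (z : ℝ) = (D : ℝ) ^ k * PowerSeries.coeff k g := by
  unfold integralSeries
  rw [Subring.mem_comap, RingHom.mem_range]
  constructor
  · rintro ⟨h, hh⟩ k
    refine ⟨PowerSeries.coeff k h, ?_⟩
    simpa using congrArg (PowerSeries.coeff k) hh
  · intro h
    choose z hz using h
    refine ⟨PowerSeries.mk z, ?_⟩
    ext k
    simpa using hz k

theorem C_mem_integralSeries (D z : ℤ) : PowerSeries.C (z : ℝ) ∈ integralSeries D := by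
  rw [mem_integralSeries]
  intro k
  rw [PowerSeries.coeff_C]
  split_ifs with h
  · exact ⟨z, by simp [h]⟩
  · exact ⟨0, by simp⟩

theorem linear_mem_integralSeries {w α : ℤ} (β : ℤ) (hα : w ∣ α) (hD : w ∣ D) :
    PowerSeries.C ((α : ℝ) / w) + PowerSeries.C ((β : ℝ) / w) * PowerSeries.X
      ∈ integralSeries D := by
  rw [← Int.cast_div_charZero hα]
  refine Subring.add_mem _ (C_mem_integralSeries D _) ?_
  rw [mem_integralSeries]
  rintro (_ | _ | k)
  · exact ⟨0, by simp⟩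
  · refine ⟨D * β / w, ?_⟩
    rw [Int.cast_div_charZero (hD.mul_right β)]
    simp [mul_div_assoc]
  · refine ⟨0, ?_⟩
    rw [PowerSeries.coeff_C_mul, PowerSeries.coeff_X, if_neg (by omega)]
    simp

theorem one_sub_X_mem_integralSeries (D : ℤ) : 1 - PowerSeries.X ∈ integralSeries D := by
  simpa [sub_eq_add_neg] using linear_mem_integralSeries (-1) (one_dvd 1) (one_dvd D)

theorem C_mul_inv_linear_mem_integralSeries {α : ℤ} (β : ℤ) (hα : α ≠ 0) (hD : α ∣ D) :
    PowerSeries.C (α : ℝ) * (PowerSeries.C (α : ℝ) + PowerSeries.C (β : ℝ) * PowerSeries.X)⁻¹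
      ∈ integralSeries D := by
  have hα' : (α : ℝ) ≠ 0 := Int.cast_ne_zero.mpr hα
  obtain ⟨v, rfl⟩ := hD
  rw [mem_integralSeries]
  refine fun k => ⟨(-(v * β)) ^ k, ?_⟩
  rw [inv_linear_series hα', PowerSeries.coeff_C_mul, PowerSeries.coeff_mk,
    mul_inv_cancel_left₀ hα', ← mul_pow]
  push_cast
  congr 1
  field_simp

end IntegralSeries

section LocalSeries

variable {m : ℤ}

theorem C_mul_one_sub_inv_mem_integralSeries (hm : 2 ≤ |m|) {n a : ℕ} (ha : 0 < a)
    (han : a ≤ 2 * n) :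
    PowerSeries.C ((m : ℝ) ^ a - 1) * (1 - PowerSeries.C ((m : ℝ) ^ a) * (1 - PowerSeries.X))⁻¹
      ∈ integralSeries (cyclotomicProd m n) := by
  have hmem := C_mul_inv_linear_mem_integralSeries (m ^ a)
    (neg_ne_zero.mpr (pow_sub_one_ne_zero hm ha.ne'))
    (neg_dvd.mpr (pow_sub_one_dvd_cyclotomicProd m ha han))
  rw [one_sub_C_mul_one_sub_X]
  push_cast at hmem
  simpa only [neg_sub, ← neg_mul, ← map_neg] using Subring.neg_mem _ hmem

theorem C_mul_sub_one_inv_mem_integralSeries (hm : 2 ≤ |m|) {n a : ℕ} (ha : 0 < a)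
    (han : a ≤ 2 * n) :
    PowerSeries.C ((m : ℝ) ^ a - 1) * (PowerSeries.C ((m : ℝ) ^ a) - (1 - PowerSeries.X))⁻¹
      ∈ integralSeries (cyclotomicProd m n) := by
  rw [C_sub_one_sub_X]
  simpa using C_mul_inv_linear_mem_integralSeries 1 (pow_sub_one_ne_zero hm ha.ne')
    (pow_sub_one_dvd_cyclotomicProd m ha han)

theorem C_mul_prod_inv_mem_integralSeries (hm : 2 ≤ |m|) {n j : ℕ} (hj : j ≤ n) :
    PowerSeries.C (evenPowProd m n : ℝ) *
      ((∏ i ∈ Finset.range j, (1 - PowerSeries.C ((m : ℝ) ^ (2 * i + 2)) * (1 - PowerSeries.X))⁻¹) *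
        ∏ i ∈ Finset.range (n - j),
          (PowerSeries.C ((m : ℝ) ^ (2 * i + 2)) - (1 - PowerSeries.X))⁻¹)
      ∈ integralSeries (cyclotomicProd m n) := by
  have hlow : PowerSeries.C (evenPowProd m j : ℝ) * ∏ i ∈ Finset.range j,
      (1 - PowerSeries.C ((m : ℝ) ^ (2 * i + 2)) * (1 - PowerSeries.X))⁻¹
      ∈ integralSeries (cyclotomicProd m n) := by
    rw [evenPowProd, Int.cast_prod, map_prod, ← Finset.prod_mul_distrib]
    refine Subring.prod_mem _ fun i hi => ?_
    have := Finset.mem_range.mp hi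
    simpa using C_mul_one_sub_inv_mem_integralSeries hm (a := 2 * i + 2) (by omega) (by omega)
  have hhigh : PowerSeries.C (evenPowProd m (n - j) : ℝ) * ∏ i ∈ Finset.range (n - j),
      (PowerSeries.C ((m : ℝ) ^ (2 * i + 2)) - (1 - PowerSeries.X))⁻¹
      ∈ integralSeries (cyclotomicProd m n) := by
    rw [evenPowProd, Int.cast_prod, map_prod, ← Finset.prod_mul_distrib]
    refine Subring.prod_mem _ fun i hi => ?_
    have := Finset.mem_range.mp hi
    simpa using C_mul_sub_one_inv_mem_integralSeries hm (a := 2 * i + 2) (by omega) (by omega)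
  obtain ⟨Q, hQ⟩ := evenPowProd_mul_dvd m hj
  convert Subring.mul_mem _ (C_mem_integralSeries _ Q) (Subring.mul_mem _ hlow hhigh) using 1
  rw [hQ, Int.cast_mul, Int.cast_mul]
  simp only [map_mul]
  ring

theorem C_inv_mul_prod_mem_integralSeries (hm : 2 ≤ |m|) (n r c : ℕ) {α : ℕ → ℤ} (β : ℕ → ℤ)
    (hα : ∀ i, oddSmallPart m n (2 * i + c) ∣ α i) :
    PowerSeries.C ((oddPartProd m n : ℝ) ^ r)⁻¹ * ∏ i ∈ Finset.range (r * n),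
      (PowerSeries.C (α i : ℝ) + PowerSeries.C (β i : ℝ) * PowerSeries.X)
      ∈ integralSeries (cyclotomicProd m n) := by
  let w (i : ℕ) : ℤ := oddSmallPart m n (2 * i + c)
  have hw (i : ℕ) : (w i : ℝ) ≠ 0 := Int.cast_ne_zero.mpr (oddSmallPart_ne_zero hm n _)
  have hfactor : ∏ i ∈ Finset.range (r * n),
      (PowerSeries.C (α i : ℝ) + PowerSeries.C (β i : ℝ) * PowerSeries.X)
      = PowerSeries.C ((∏ i ∈ Finset.range (r * n), w i : ℤ) : ℝ) * ∏ i ∈ Finset.range (r * n),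
        (PowerSeries.C ((α i : ℝ) / w i) + PowerSeries.C ((β i : ℝ) / w i) * PowerSeries.X) := by
    rw [Int.cast_prod, map_prod, ← Finset.prod_mul_distrib]
    refine Finset.prod_congr rfl fun i _ => ?_
    rw [mul_add, ← mul_assoc, ← map_mul, ← map_mul, mul_div_cancel₀ _ (hw i),
      mul_div_cancel₀ _ (hw i)]
  rw [hfactor, ← mul_assoc, ← map_mul, inv_mul_eq_div, ← Int.cast_pow,
    ← Int.cast_div_charZero (oddPartProd_pow_dvd m n r c)]
  exact Subring.mul_mem _ (C_mem_integralSeries _ _) (Subring.prod_mem _ fun i _ =>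
    linear_mem_integralSeries (β i) (hα i) (oddSmallPart_dvd_cyclotomicProd m n _))

theorem C_mul_localSeries_mem_integralSeries (hm : 2 ≤ |m|) (r b N j : ℕ) (hj : j ≤ 2 * N) :
    PowerSeries.C ((evenPowProd m (2 * N) : ℝ) ^ poleOrder r b /
        (oddPartProd m (2 * N) : ℝ) ^ (2 * r)) * localSeries m r b N j
      ∈ integralSeries (cyclotomicProd m (2 * N)) := by
  set D := cyclotomicProd m (2 * N)
  set V : ℝ := ((oddPartProd m (2 * N) : ℤ) : ℝ)
  have hpow (k : ℕ) : PowerSeries.C ((m : ℝ) ^ k) ∈ integralSeries D := by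
    simpa using C_mem_integralSeries D (m ^ k)
  have hone := one_sub_X_mem_integralSeries D
  have hhead : PowerSeries.C ((m : ℝ) ^ localExp r b N j) * (1 - PowerSeries.X) ^ zeroOrder r b N *
      (PowerSeries.C ((m : ℝ) ^ (2 * N))
        - PowerSeries.C ((m : ℝ) ^ (2 * j)) * (1 - PowerSeries.X)) ∈ integralSeries D :=
    Subring.mul_mem _ (Subring.mul_mem _ (hpow _) (Subring.pow_mem _ hone _))
      (Subring.sub_mem _ (hpow _) (Subring.mul_mem _ (hpow _) hone))
  have hfirst : PowerSeries.C (V ^ r)⁻¹ * ∏ i ∈ Finset.range (r * (2 * N)),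
      (1 - PowerSeries.C ((m : ℝ) ^ (2 * i + (2 * j + 1))) * (1 - PowerSeries.X))
      ∈ integralSeries D := by
    have := C_inv_mul_prod_mem_integralSeries hm (2 * N) r (2 * j + 1)
      (fun i => m ^ (2 * i + (2 * j + 1)))
      (fun i => dvd_neg.mpr (oddSmallPart_dvd_pow_sub_one m (2 * N) (by omega)))
    push_cast at this
    simpa only [one_sub_C_mul_one_sub_X, neg_sub] using this
  have hsecond : PowerSeries.C (V ^ r)⁻¹ * ∏ i ∈ Finset.range (r * (2 * N)),
      (PowerSeries.C ((m : ℝ) ^ (2 * i + (2 * (2 * N - j) + 1))) - (1 - PowerSeries.X))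
      ∈ integralSeries D := by
    have := C_inv_mul_prod_mem_integralSeries hm (2 * N) r (2 * (2 * N - j) + 1) (fun _ => 1)
      (fun i => oddSmallPart_dvd_pow_sub_one m (2 * N) (by omega))
    push_cast at this
    simpa only [C_sub_one_sub_X] using this
  convert Subring.mul_mem _ (Subring.mul_mem _ (Subring.mul_mem _ hhead hfirst) hsecond)
    (Subring.pow_mem _ (C_mul_prod_inv_mem_integralSeries hm hj) (poleOrder r b)) using 1
  rw [localSeries, div_eq_mul_inv, two_mul r, pow_add, mul_inv]
  simp only [map_mul, map_pow]
  ring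

end LocalSeries

/-! ### Size of the local expansions -/

/-- The sum of the absolute values of the first `A` coefficients of a power series, which is
submultiplicative. -/
noncomputable def seriesNorm (A : ℕ) (g : PowerSeries ℝ) : ℝ :=
  ∑ k ∈ Finset.range A, |PowerSeries.coeff k g|

section SeriesNorm

variable (A : ℕ)

theorem seriesNorm_nonneg (g : PowerSeries ℝ) : 0 ≤ seriesNorm A g :=
  Finset.sum_nonneg fun _ _ => abs_nonneg _

theorem abs_coeff_le_seriesNorm {A k : ℕ} (hk : k < A) (g : PowerSeries ℝ) :
    |PowerSeries.coeff k g| ≤ seriesNorm A g :=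
  Finset.single_le_sum (f := fun k => |PowerSeries.coeff k g|) (fun _ _ => abs_nonneg _)
    (Finset.mem_range.mpr hk)

theorem seriesNorm_mul_le (f g : PowerSeries ℝ) :
    seriesNorm A (f * g) ≤ seriesNorm A f * seriesNorm A g := by
  unfold seriesNorm
  rw [Finset.sum_mul_sum, ← Finset.sum_product']
  calc
    _ ≤ ∑ k ∈ Finset.range A, ∑ p ∈ Finset.range A ×ˢ Finset.range A with p.1 + p.2 = k,
        |PowerSeries.coeff p.1 f| * |PowerSeries.coeff p.2 g| := by
      refine Finset.sum_le_sum fun k hk => ?_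
      rw [PowerSeries.coeff_mul]
      refine (Finset.abs_sum_le_sum_abs _ _).trans ?_
      simp only [abs_mul]
      refine Finset.sum_le_sum_of_subset_of_nonneg (fun p hp => ?_) fun _ _ _ => by positivity
      have := Finset.HasAntidiagonal.mem_antidiagonal.mp hp
      have := Finset.mem_range.mp hk
      simp only [Finset.mem_filter, Finset.mem_product, Finset.mem_range]
      omega
    _ ≤ _ := Finset.sum_fiberwise_le_sum_of_sum_fiber_nonneg
        fun _ _ => Finset.sum_nonneg fun _ _ => by positivity

theorem seriesNorm_mul_le_mul {f g : PowerSeries ℝ} {u v : ℝ} (hf : seriesNorm A f ≤ u)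
    (hg : seriesNorm A g ≤ v) : seriesNorm A (f * g) ≤ u * v :=
  (seriesNorm_mul_le A f g).trans
    (mul_le_mul hf hg (seriesNorm_nonneg A g) ((seriesNorm_nonneg A f).trans hf))

theorem seriesNorm_C_le (u : ℝ) : seriesNorm A (PowerSeries.C u) ≤ |u| := by
  unfold seriesNorm
  rcases A with _ | A
  · simp
  · rw [Finset.sum_range_succ']
    simp [PowerSeries.coeff_C]

theorem seriesNorm_linear_le (u v : ℝ) :
    seriesNorm A (PowerSeries.C u + PowerSeries.C v * PowerSeries.X) ≤ |u| + |v| := by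
  unfold seriesNorm
  rcases A with _ | _ | A
  · simp only [Finset.range_zero, Finset.sum_empty]
    positivity
  · simp
  · have htail : ∀ k ∈ Finset.range A, |PowerSeries.coeff (k + 1 + 1)
        (PowerSeries.C u + PowerSeries.C v * PowerSeries.X)| = 0 := fun k _ => by simp
    rw [Finset.sum_range_succ', Finset.sum_range_succ', Finset.sum_eq_zero htail]
    simp [PowerSeries.coeff_C, add_comm]

theorem seriesNorm_inv_linear_le {u v : ℝ} (hu : u ≠ 0) (hv : |v| ≤ 2 * |u|) :
    seriesNorm A (PowerSeries.C u + PowerSeries.C v * PowerSeries.X)⁻¹ ≤ 2 ^ A * |u|⁻¹ := by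
  have hratio : |v / u| ≤ 2 := by rwa [abs_div, div_le_iff₀ (abs_pos.mpr hu)]
  unfold seriesNorm
  rw [inv_linear_series hu]
  calc
    _ ≤ ∑ k ∈ Finset.range A, 2 ^ k * |u|⁻¹ := by
      refine Finset.sum_le_sum fun k _ => ?_
      rw [PowerSeries.coeff_mk, abs_mul, abs_inv, abs_pow, abs_neg, mul_comm]
      gcongr
    _ ≤ 2 ^ A * |u|⁻¹ := by
      rw [← Finset.sum_mul, geom_sum_eq (by norm_num)]
      gcongr
      linarith

theorem seriesNorm_prod_le {ι : Type*} (s : Finset ι) (f : ι → PowerSeries ℝ) :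
    seriesNorm A (∏ i ∈ s, f i) ≤ ∏ i ∈ s, seriesNorm A (f i) := by
  classical
  induction s using Finset.induction_on with
  | empty => simpa using seriesNorm_C_le A 1
  | insert i s hi ih =>
    rw [Finset.prod_insert hi, Finset.prod_insert hi]
    exact seriesNorm_mul_le_mul A le_rfl ih

theorem seriesNorm_pow_le {f : PowerSeries ℝ} {u : ℝ} (hf : seriesNorm A f ≤ u) (k : ℕ) :
    seriesNorm A (f ^ k) ≤ u ^ k := by
  have hprod := seriesNorm_prod_le A (Finset.range k) fun _ => f
  simp only [Finset.prod_const, Finset.card_range] at hprod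
  exact hprod.trans (pow_le_pow_left₀ (seriesNorm_nonneg A f) hf k)

theorem seriesNorm_prod_le_pow_mul_pow {n : ℕ} {f : ℕ → PowerSeries ℝ} {c x : ℝ} {e : ℕ → ℕ}
    (hf : ∀ i, seriesNorm A (f i) ≤ c * x ^ e i) :
    seriesNorm A (∏ i ∈ Finset.range n, f i) ≤ c ^ n * x ^ ∑ i ∈ Finset.range n, e i := by
  refine (seriesNorm_prod_le A _ f).trans ((Finset.prod_le_prod
    (fun _ _ => seriesNorm_nonneg A _) fun i _ => hf i).trans_eq ?_)
  rw [Finset.prod_mul_distrib, Finset.prod_pow_eq_pow_sum, Finset.prod_const, Finset.card_range]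

theorem seriesNorm_one_sub_C_mul_le {u : ℝ} (hu : 1 ≤ |u|) :
    seriesNorm A (1 - PowerSeries.C u * (1 - PowerSeries.X)) ≤ 3 * |u| := by
  rw [one_sub_C_mul_one_sub_X]
  have := seriesNorm_linear_le A (1 - u) u
  have := abs_sub 1 u
  rw [abs_one] at this
  linarith

theorem seriesNorm_C_sub_le {u : ℝ} (hu : 1 ≤ |u|) :
    seriesNorm A (PowerSeries.C u - (1 - PowerSeries.X)) ≤ 3 * |u| := by
  rw [C_sub_one_sub_X]
  have hlinear := seriesNorm_linear_le A (u - 1) 1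
  have := abs_sub u 1
  rw [abs_one] at hlinear this
  linarith

theorem half_abs_le_abs_sub_one {u : ℝ} (hu : 2 ≤ |u|) : |u| / 2 ≤ |u - 1| := by
  have := abs_sub_abs_le_abs_sub u 1
  rw [abs_one] at this
  linarith

theorem inv_abs_sub_one_le {u : ℝ} (hu : 2 ≤ |u|) : |u - 1|⁻¹ ≤ 2 * |u|⁻¹ := by
  rw [← div_eq_mul_inv, ← inv_div]
  exact inv_anti₀ (by linarith) (half_abs_le_abs_sub_one hu)

theorem seriesNorm_one_sub_C_mul_inv_le {u : ℝ} (hu : 2 ≤ |u|) :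
    seriesNorm A (1 - PowerSeries.C u * (1 - PowerSeries.X))⁻¹ ≤ 2 ^ (A + 1) * |u|⁻¹ := by
  have hhalf := half_abs_le_abs_sub_one hu
  have hne : u - 1 ≠ 0 := abs_pos.mp (by linarith)
  rw [one_sub_C_mul_one_sub_X]
  refine (seriesNorm_inv_linear_le A (sub_ne_zero.mpr (sub_ne_zero.mp hne).symm) ?_).trans ?_
  · rw [abs_sub_comm]
    linarith
  · rw [abs_sub_comm, pow_succ, mul_assoc]
    gcongr
    exact inv_abs_sub_one_le hu

theorem seriesNorm_C_sub_inv_le {u : ℝ} (hu : 2 ≤ |u|) :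
    seriesNorm A (PowerSeries.C u - (1 - PowerSeries.X))⁻¹ ≤ 2 ^ (A + 1) * |u|⁻¹ := by
  have hhalf := half_abs_le_abs_sub_one hu
  rw [C_sub_one_sub_X]
  refine (seriesNorm_inv_linear_le A (abs_pos.mp (by linarith)) ?_).trans ?_
  · rw [abs_one]
    linarith
  · rw [pow_succ, mul_assoc]
    gcongr
    exact inv_abs_sub_one_le hu

end SeriesNorm

theorem sum_range_two_mul_add_odd (n c : ℕ) :
    ∑ i ∈ Finset.range n, (2 * i + (2 * c + 1)) = n ^ 2 + 2 * c * n := by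
  induction n with
  | zero => simp
  | succ n ih => rw [Finset.sum_range_succ, ih]; ring

section LocalSeriesNorm

variable {p : ℝ} (A : ℕ)

theorem seriesNorm_prod_one_sub_le (hp : 1 ≤ |p|) (n j : ℕ) :
    seriesNorm A (∏ i ∈ Finset.range n,
      (1 - PowerSeries.C (p ^ (2 * i + (2 * j + 1))) * (1 - PowerSeries.X)))
      ≤ 3 ^ n * |p| ^ (n ^ 2 + 2 * j * n) := by
  rw [← sum_range_two_mul_add_odd]
  refine seriesNorm_prod_le_pow_mul_pow A fun i => ?_
  rw [← abs_pow]
  exact seriesNorm_one_sub_C_mul_le A (by rw [abs_pow]; exact one_le_pow₀ hp)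

theorem seriesNorm_prod_C_sub_le (hp : 1 ≤ |p|) (n j : ℕ) :
    seriesNorm A (∏ i ∈ Finset.range n,
      (PowerSeries.C (p ^ (2 * i + (2 * j + 1))) - (1 - PowerSeries.X)))
      ≤ 3 ^ n * |p| ^ (n ^ 2 + 2 * j * n) := by
  rw [← sum_range_two_mul_add_odd]
  refine seriesNorm_prod_le_pow_mul_pow A fun i => ?_
  rw [← abs_pow]
  exact seriesNorm_C_sub_le A (by rw [abs_pow]; exact one_le_pow₀ hp)

theorem two_le_abs_pow (hp : 2 ≤ |p|) {a : ℕ} (ha : a ≠ 0) : 2 ≤ |p ^ a| := by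
  rw [abs_pow]
  exact hp.trans (le_self_pow₀ (by linarith) ha)

theorem seriesNorm_prod_one_sub_inv_le (hp : 2 ≤ |p|) (n : ℕ) :
    seriesNorm A (∏ i ∈ Finset.range n,
      (1 - PowerSeries.C (p ^ (2 * i + 2)) * (1 - PowerSeries.X))⁻¹)
      ≤ (2 ^ (A + 1)) ^ n * |p|⁻¹ ^ (n ^ 2 + n) := by
  rw [← sum_range_two_mul_add_two]
  refine seriesNorm_prod_le_pow_mul_pow A fun i => ?_
  rw [inv_pow, ← abs_pow]
  exact seriesNorm_one_sub_C_mul_inv_le A (two_le_abs_pow hp (by omega))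

theorem seriesNorm_prod_C_sub_inv_le (hp : 2 ≤ |p|) (n : ℕ) :
    seriesNorm A (∏ i ∈ Finset.range n,
      (PowerSeries.C (p ^ (2 * i + 2)) - (1 - PowerSeries.X))⁻¹)
      ≤ (2 ^ (A + 1)) ^ n * |p|⁻¹ ^ (n ^ 2 + n) := by
  rw [← sum_range_two_mul_add_two]
  refine seriesNorm_prod_le_pow_mul_pow A fun i => ?_
  rw [inv_pow, ← abs_pow]
  exact seriesNorm_C_sub_inv_le A (two_le_abs_pow hp (by omega))

theorem seriesNorm_C_sub_C_mul_le (hp : 1 ≤ |p|) {i j n : ℕ} (hi : i ≤ n) (hj : j ≤ n) :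
    seriesNorm A (PowerSeries.C (p ^ i) - PowerSeries.C (p ^ j) * (1 - PowerSeries.X))
      ≤ 3 * |p| ^ n := by
  have hlinear : PowerSeries.C (p ^ i) - PowerSeries.C (p ^ j) * (1 - PowerSeries.X)
      = PowerSeries.C (p ^ i - p ^ j) + PowerSeries.C (p ^ j) * PowerSeries.X := by
    rw [map_sub]
    ring
  have hpi : |p| ^ i ≤ |p| ^ n := pow_le_pow_right₀ hp hi
  have hpj : |p| ^ j ≤ |p| ^ n := pow_le_pow_right₀ hp hj
  have hsub := abs_sub (p ^ i) (p ^ j)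
  have hnorm := seriesNorm_linear_le A (p ^ i - p ^ j) (p ^ j)
  rw [hlinear]
  simp only [abs_pow] at hsub hnorm
  linarith

theorem localExp_le (r b N j : ℕ) (hj : j ≤ 2 * N) :
    localExp r b N j + 2 * poleOrder r b * N ^ 2
      ≤ 2 * N + poleOrder r b * ((j ^ 2 + j) + ((2 * N - j) ^ 2 + (2 * N - j))) := by
  obtain ⟨k, hk⟩ := Nat.exists_eq_add_of_le hj
  rw [localExp, show 2 * N - j = k by omega]
  have hsq : ((N : ℤ) - j).natAbs ^ 2 + 2 * N ^ 2 ≤ j ^ 2 + j + (k ^ 2 + k) := by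
    zify at hk ⊢
    rw [sq_abs, show (k : ℤ) = 2 * N - j by linarith]
    nlinarith [sq_nonneg ((N : ℤ) - j)]
  calc
    _ = poleOrder r b * (((N : ℤ) - j).natAbs ^ 2 + 2 * N ^ 2) + k := by ring
    _ ≤ poleOrder r b * (j ^ 2 + j + (k ^ 2 + k)) + 2 * N := by
      gcongr
      omega
    _ = _ := by ring

theorem seriesNorm_localSeries_le (hp : 2 ≤ |p|) (r b N j : ℕ) (hj : j ≤ 2 * N) :
    seriesNorm A (localSeries p r b N j)
      ≤ |p| ^ localExp r b N j * 2 ^ zeroOrder r b N * (3 * |p| ^ (4 * N)) *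
        (3 ^ (r * (2 * N)) * |p| ^ ((r * (2 * N)) ^ 2 + 2 * j * (r * (2 * N)))) *
        (3 ^ (r * (2 * N)) * |p| ^ ((r * (2 * N)) ^ 2 + 2 * (2 * N - j) * (r * (2 * N)))) *
        ((2 ^ (A + 1)) ^ j * |p|⁻¹ ^ (j ^ 2 + j) *
          ((2 ^ (A + 1)) ^ (2 * N - j) * |p|⁻¹ ^ ((2 * N - j) ^ 2 + (2 * N - j)))) ^
            poleOrder r b := by
  have hp1 : 1 ≤ |p| := by linarith
  have hhead : seriesNorm A (PowerSeries.C (p ^ localExp r b N j)) ≤ |p| ^ localExp r b N j :=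
    (seriesNorm_C_le A _).trans_eq (abs_pow _ _)
  have hone : seriesNorm A (1 - PowerSeries.X) ≤ 2 := by
    have := seriesNorm_linear_le A 1 (-1)
    norm_num [← sub_eq_add_neg] at this
    exact this
  exact seriesNorm_mul_le_mul A (seriesNorm_mul_le_mul A (seriesNorm_mul_le_mul A
    (seriesNorm_mul_le_mul A (seriesNorm_mul_le_mul A hhead (seriesNorm_pow_le A hone _))
      (seriesNorm_C_sub_C_mul_le A hp1 (by omega) (by omega)))
      (seriesNorm_prod_one_sub_le A hp1 _ j)) (seriesNorm_prod_C_sub_le A hp1 _ (2 * N - j)))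
    (seriesNorm_pow_le A (seriesNorm_mul_le_mul A (seriesNorm_prod_one_sub_inv_le A hp j)
      (seriesNorm_prod_C_sub_inv_le A hp (2 * N - j))) _)

theorem seriesNorm_localSeries_mul_le (hp : 2 ≤ |p|) (r b N j : ℕ) (hj : j ≤ 2 * N) :
    seriesNorm A (localSeries p r b N j) * |p| ^ (2 * poleOrder r b * N ^ 2)
      ≤ 2 ^ zeroOrder r b N * 3 ^ (1 + 2 * (r * (2 * N))) *
        (2 ^ (A + 1)) ^ (2 * N * poleOrder r b) * |p| ^ (6 * N) *
        |p| ^ ((8 * r ^ 2 + 8 * r) * N ^ 2) := by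
  obtain ⟨k, hk⟩ := Nat.exists_eq_add_of_le hj
  have hbound := seriesNorm_localSeries_le A hp r b N j hj
  have hexp := localExp_le r b N j hj
  rw [show 2 * N - j = k by omega] at hbound hexp
  have hc : (0 : ℝ) < 2 ^ (A + 1) := by positivity
  generalize (2 : ℝ) ^ (A + 1) = c at *
  have hpole : |p| ^ localExp r b N j * |p| ^ (2 * poleOrder r b * N ^ 2) *
      |p|⁻¹ ^ (poleOrder r b * ((j ^ 2 + j) + (k ^ 2 + k))) * |p| ^ (4 * N) ≤ |p| ^ (6 * N) := by
    rw [inv_pow, mul_right_comm, ← pow_add, ← pow_add, ← div_eq_mul_inv,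
      div_le_iff₀ (by positivity), ← pow_add]
    exact pow_le_pow_right₀ (by linarith) (by linarith)
  have hnum : |p| ^ ((r * (2 * N)) ^ 2 + 2 * j * (r * (2 * N))) *
      |p| ^ ((r * (2 * N)) ^ 2 + 2 * k * (r * (2 * N))) = |p| ^ ((8 * r ^ 2 + 8 * r) * N ^ 2) := by
    rw [← pow_add]
    congr 1
    linear_combination (2 * (r * (2 * N))) * hk.symm
  have hden : c ^ j * c ^ k = c ^ (2 * N) := by rw [← pow_add, hk]
  calc
    _ ≤ _ := mul_le_mul_of_nonneg_right hbound (by positivity)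
    _ = 2 ^ zeroOrder r b N * 3 ^ (1 + 2 * (r * (2 * N))) * c ^ (2 * N * poleOrder r b) *
        (|p| ^ localExp r b N j * |p| ^ (2 * poleOrder r b * N ^ 2) *
          |p|⁻¹ ^ (poleOrder r b * ((j ^ 2 + j) + (k ^ 2 + k))) * |p| ^ (4 * N)) *
        |p| ^ ((8 * r ^ 2 + 8 * r) * N ^ 2) := by
      rw [← hnum, pow_mul c, ← hden, mul_comm (poleOrder r b) (_ + _), pow_mul |p|⁻¹]
      ring
    _ ≤ _ := by gcongr

theorem exists_seriesNorm_localSeries_le (hp : 2 ≤ |p|) (r b : ℕ) :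
    ∃ K : ℝ, 0 < K ∧ ∀ N j, j ≤ 2 * N →
      seriesNorm A (localSeries p r b N j) * |p| ^ (2 * poleOrder r b * N ^ 2)
        ≤ K ^ (N + 1) * |p| ^ ((8 * r ^ 2 + 8 * r) * N ^ 2) := by
  refine ⟨2 ^ (3 * b + r + 1) * 3 ^ (4 * r + 1) * (2 ^ (A + 1)) ^ (2 * poleOrder r b) * |p| ^ 6,
    by positivity, fun N j hj => (seriesNorm_localSeries_mul_le A hp r b N j hj).trans ?_⟩
  rw [mul_pow, mul_pow, mul_pow, ← pow_mul 2 (3 * b + r + 1), ← pow_mul 3, ← pow_mul (2 ^ (A + 1)),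
    ← pow_mul |p|]
  have htwo : zeroOrder r b N ≤ (3 * b + r + 1) * (N + 1) := by
    unfold zeroOrder
    nlinarith [Nat.zero_le (b * N), Nat.zero_le (r * N)]
  have hthree : 1 + 2 * (r * (2 * N)) ≤ (4 * r + 1) * (N + 1) := by
    nlinarith [Nat.zero_le (r * N)]
  have hconst : 2 * N * poleOrder r b ≤ 2 * poleOrder r b * (N + 1) := by nlinarith
  gcongr
  · exact one_le_two
  · norm_num
  · exact one_le_pow₀ one_le_two
  · linarith
  · omega

end LocalSeriesNorm

/-! ### The linear forms -/

/-- The sum `1 / (1 - q ^ a)` of the geometric series with ratio `q ^ a`, where `q = 1 / p`. -/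
noncomputable def geoVal (p : ℝ) (a : ℕ) : ℝ := 1 / (1 - p⁻¹ ^ a)

section GeoVal

variable {p : ℝ}

theorem half_le_one_sub_inv_pow (hp : 2 ≤ |p|) {a : ℕ} (ha : a ≠ 0) : 1 / 2 ≤ 1 - p⁻¹ ^ a := by
  have := (le_abs_self _).trans (abs_inv_pow_le hp a)
  have : (1 / 2 : ℝ) ^ a ≤ 1 / 2 := pow_le_of_le_one (by norm_num) (by norm_num) ha
  linarith

theorem one_sub_geoVal (hp : 2 ≤ |p|) {a : ℕ} (ha : a ≠ 0) :
    1 - geoVal p a = 1 / (1 - p ^ a) := by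
  have hpow : p ^ a ≠ 0 := pow_ne_zero _ (ne_zero_of_two_le_abs hp)
  have hsub : p ^ a - 1 ≠ 0 := pow_sub_one_ne_zero hp ha
  have hsub' : 1 - p ^ a ≠ 0 := sub_ne_zero.mpr (sub_ne_zero.mp hsub).symm
  rw [geoVal, inv_pow, ← one_div, one_sub_div hpow]
  field_simp
  ring

theorem abs_geoVal_le_two (hp : 2 ≤ |p|) {a : ℕ} (ha : a ≠ 0) : |geoVal p a| ≤ 2 := by
  have := half_le_one_sub_inv_pow hp ha
  rw [geoVal, abs_of_nonneg (one_div_nonneg.mpr (by linarith)), div_le_iff₀ (by linarith)]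
  linarith

theorem abs_one_sub_geoVal_le (hp : 2 ≤ |p|) {a : ℕ} (ha : a ≠ 0) :
    |1 - geoVal p a| ≤ 2 * (1 / 2) ^ a := by
  have hne : 1 - p⁻¹ ^ a ≠ 0 := by linarith [half_le_one_sub_inv_pow hp ha]
  have heq : 1 - geoVal p a = -(geoVal p a * p⁻¹ ^ a) := by
    rw [geoVal]
    generalize p⁻¹ ^ a = u at hne
    field_simp
    ring
  rw [heq, abs_neg, abs_mul]
  exact mul_le_mul (abs_geoVal_le_two hp ha) (abs_inv_pow_le hp a) (abs_nonneg _) zero_le_two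

theorem abs_one_sub_geoVal_le_one (hp : 2 ≤ |p|) {a : ℕ} (ha : a ≠ 0) :
    |1 - geoVal p a| ≤ 1 := by
  have : (1 / 2 : ℝ) ^ a ≤ 1 / 2 := pow_le_of_le_one (by norm_num) (by norm_num) ha
  linarith [abs_one_sub_geoVal_le hp ha]

theorem abs_geoVal_pow_sub_one_le (hp : 2 ≤ |p|) {a : ℕ} (ha : a ≠ 0) (s : ℕ) :
    |geoVal p a ^ s - 1| ≤ s * 2 ^ s * 2 * (1 / 2) ^ a := by
  have hsum : |∑ i ∈ Finset.range s, geoVal p a ^ i| ≤ s * 2 ^ s := by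
    refine (Finset.abs_sum_le_sum_abs _ _).trans ((Finset.sum_le_card_nsmul _ _ (2 ^ s)
      fun i hi => ?_).trans_eq (by simp))
    rw [abs_pow]
    calc
      |geoVal p a| ^ i ≤ 2 ^ i := pow_le_pow_left₀ (abs_nonneg _) (abs_geoVal_le_two hp ha) _
      _ ≤ 2 ^ s := pow_le_pow_right₀ one_le_two (Finset.mem_range.mp hi).le
  rw [← geom_sum_mul, abs_mul, abs_sub_comm _ 1, mul_assoc]
  exact mul_le_mul hsum (abs_one_sub_geoVal_le hp ha) (abs_nonneg _) (by positivity)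

theorem summable_alternating_of_abs_le {f : ℕ → ℝ} {C : ℝ}
    (hf : ∀ h, |f h| ≤ C * (1 / 2) ^ (2 * h + 1)) : Summable fun h => (-1 : ℝ) ^ h * f h := by
  have hC : 0 ≤ C := nonneg_of_mul_nonneg_left ((abs_nonneg _).trans (hf 0)) (by norm_num)
  refine Summable.of_norm_bounded (summable_geometric_two.mul_left C) fun h => ?_
  rw [norm_mul, norm_pow, norm_neg, norm_one, one_pow, one_mul, Real.norm_eq_abs]
  refine (hf h).trans (mul_le_mul_of_nonneg_left ?_ hC)
  exact pow_le_pow_of_le_one (by norm_num) (by norm_num) (by omega)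

theorem summable_geoVal_pow_sub_one (hp : 2 ≤ |p|) (s : ℕ) :
    Summable fun h : ℕ => (-1 : ℝ) ^ h * (geoVal p (2 * h + 1) ^ s - 1) :=
  summable_alternating_of_abs_le fun _ => abs_geoVal_pow_sub_one_le hp (by omega) s

theorem summable_one_sub_geoVal_pow (hp : 2 ≤ |p|) {s : ℕ} (hs : s ≠ 0) :
    Summable fun h : ℕ => (-1 : ℝ) ^ h * (1 - geoVal p (2 * h + 1)) ^ s := by
  refine summable_alternating_of_abs_le (C := 2) fun h => ?_
  rw [abs_pow]
  exact (pow_le_of_le_one (abs_nonneg _) (abs_one_sub_geoVal_le_one hp (by omega)) hs).trans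
    (abs_one_sub_geoVal_le hp (by omega))

end GeoVal

theorem hasSum_alternating_shift {f : ℕ → ℝ} (hf : Summable fun h => (-1 : ℝ) ^ h * f h) (j : ℕ) :
    HasSum (fun h => (-1 : ℝ) ^ h * f (h + j))
      ((-1) ^ j * (∑' h, (-1 : ℝ) ^ h * f h - ∑ h ∈ Finset.range j, (-1 : ℝ) ^ h * f h)) := by
  have hshift := ((hasSum_nat_add_iff' j).mpr hf.hasSum).mul_left ((-1 : ℝ) ^ j)
  refine hshift.congr_fun fun h => ?_
  rw [← mul_assoc, ← pow_add, add_left_comm, pow_add _ h, ← two_mul, pow_mul]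
  simp

/-- The numbers in which the linear forms are first expressed; they lie in the span of `1` and the
`β_q(s)` with `s` even, where `q = 1 / p`. -/
noncomputable def formPeriod (p : ℝ) (s : ℕ) : ℝ :=
  ∑' h : ℕ, (-1 : ℝ) ^ h * (geoVal p (2 * h + 1) ^ s + (1 - geoVal p (2 * h + 1)) ^ s - 1)

/-- The finite sums that occur in the constant terms of the linear forms. -/
noncomputable def formTail (p : ℝ) (N j s : ℕ) : ℝ :=
  ∑ h ∈ Finset.range j, (-1 : ℝ) ^ h * (geoVal p (2 * h + 1) ^ s - 1)
    + ∑ h ∈ Finset.range (2 * N - j), (-1 : ℝ) ^ h * (1 - geoVal p (2 * h + 1)) ^ s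

/-- The value of the linear form before clearing denominators. -/
noncomputable def formSum (p : ℝ) (r b N : ℕ) : ℝ :=
  ∑' h : ℕ, (-1 : ℝ) ^ h * formFun p r b N (p⁻¹ ^ (2 * h + 1))

section FormSum

variable {p : ℝ}

theorem inv_pow_ne_pow (hp : 2 ≤ |p|) {a : ℕ} (ha : a ≠ 0) (k : ℕ) : p⁻¹ ^ a ≠ p ^ k := by
  intro h
  refine pow_sub_one_ne_zero hp (e := a + k) (by omega) ?_
  rw [pow_add, ← h, inv_pow, mul_inv_cancel₀ (pow_ne_zero _ (ne_zero_of_two_le_abs hp)), sub_self]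

theorem formFun_inv_pow (hp : 2 ≤ |p|) {r : ℕ} (hr : 1 ≤ r) (b N h : ℕ) :
    formFun p r b N (p⁻¹ ^ (2 * h + 1))
      = ∑ j ∈ Finset.range (2 * N + 1), ∑ k ∈ Finset.range (poleOrder r b),
        PowerSeries.coeff k (localSeries p r b N j) *
          geoVal p (2 * (h + j) + 1) ^ (poleOrder r b - k) := by
  rw [formFun_eq_sum hp hr b N fun j _ => inv_pow_ne_pow hp (by omega) _]
  refine Finset.sum_congr rfl fun j _ => Finset.sum_congr rfl fun k _ => ?_
  rw [geoVal, div_eq_mul_inv (p⁻¹ ^ _), ← inv_pow, ← pow_add,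
    show 2 * h + 1 + 2 * j = 2 * (h + j) + 1 by ring]

theorem formFun_inv_pow_reflect (hp : 2 ≤ |p|) {r : ℕ} (hr : 1 ≤ r) (b N h : ℕ) :
    formFun p r b N (p⁻¹ ^ (2 * h + 1))
      = ∑ j ∈ Finset.range (2 * N + 1), ∑ k ∈ Finset.range (poleOrder r b),
        PowerSeries.coeff k (localSeries p r b N j) *
          (1 - geoVal p (2 * (h + (2 * N - j)) + 1)) ^ (poleOrder r b - k) := by
  have hp0 := ne_zero_of_two_le_abs hp
  have hreflect : p ^ (4 * N) / p⁻¹ ^ (2 * h + 1) = p ^ (4 * N + (2 * h + 1)) := by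
    rw [inv_pow, div_inv_eq_mul, ← pow_add]
  have hne : ∀ j ∈ Finset.range (2 * N + 1), p ^ (4 * N + (2 * h + 1)) ≠ p ^ (2 * j) := by
    intro j hj heq
    have := pow_injective_of_two_le_abs hp heq
    have := Finset.mem_range.mp hj
    omega
  rw [← formFun_reflect p hp0 r b N (pow_ne_zero _ (inv_ne_zero hp0)), hreflect,
    formFun_eq_sum hp hr b N hne]
  refine Finset.sum_congr rfl fun j hj => Finset.sum_congr rfl fun k _ => ?_
  have := Finset.mem_range.mp hj
  rw [one_sub_geoVal hp (by omega),
    show 4 * N + (2 * h + 1) = 2 * (h + (2 * N - j)) + 1 + 2 * j by omega, pow_add,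
    mul_div_cancel_right₀ _ (pow_ne_zero _ hp0)]

theorem two_mul_formFun (hp : 2 ≤ |p|) {r : ℕ} (hr : 1 ≤ r) (b N h : ℕ) :
    2 * formFun p r b N (p⁻¹ ^ (2 * h + 1))
      = ∑ j ∈ Finset.range (2 * N + 1), ∑ k ∈ Finset.range (poleOrder r b),
        PowerSeries.coeff k (localSeries p r b N j) *
          ((geoVal p (2 * (h + j) + 1) ^ (poleOrder r b - k) - 1)
            + (1 - geoVal p (2 * (h + (2 * N - j)) + 1)) ^ (poleOrder r b - k)) := by
  simp only [mul_add (PowerSeries.coeff _ _), mul_sub, mul_one, Finset.sum_add_distrib,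
    Finset.sum_sub_distrib]
  rw [← formFun_inv_pow hp hr, ← formFun_inv_pow_reflect hp hr, sum_coeff_localSeries hp hr]
  ring

theorem formPeriod_eq_add (hp : 2 ≤ |p|) {s : ℕ} (hs : s ≠ 0) :
    formPeriod p s = ∑' h : ℕ, (-1 : ℝ) ^ h * (geoVal p (2 * h + 1) ^ s - 1)
      + ∑' h : ℕ, (-1 : ℝ) ^ h * (1 - geoVal p (2 * h + 1)) ^ s := by
  rw [← (summable_geoVal_pow_sub_one hp s).tsum_add (summable_one_sub_geoVal_pow hp hs), formPeriod]
  exact tsum_congr fun h => by ring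

theorem hasSum_formPeriod_sub_formTail (hp : 2 ≤ |p|) {N j s : ℕ} (hj : j ≤ 2 * N) (hs : s ≠ 0) :
    HasSum (fun h : ℕ => (-1 : ℝ) ^ h * ((geoVal p (2 * (h + j) + 1) ^ s - 1)
        + (1 - geoVal p (2 * (h + (2 * N - j)) + 1)) ^ s))
      ((-1) ^ j * (formPeriod p s - formTail p N j s)) := by
  have hsign : (-1 : ℝ) ^ (2 * N - j) = (-1) ^ j :=
    neg_one_pow_congr (by simp [Nat.even_sub hj])
  have hadd := (hasSum_alternating_shift (summable_geoVal_pow_sub_one hp s) j).add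
    (hasSum_alternating_shift (summable_one_sub_geoVal_pow hp hs) (2 * N - j))
  simp only [hsign, ← mul_add] at hadd
  convert hadd using 2
  rw [formPeriod_eq_add hp hs, formTail]
  ring

theorem two_mul_formSum (hp : 2 ≤ |p|) {r : ℕ} (hr : 1 ≤ r) (b N : ℕ) :
    2 * formSum p r b N = ∑ j ∈ Finset.range (2 * N + 1), ∑ k ∈ Finset.range (poleOrder r b),
      PowerSeries.coeff k (localSeries p r b N j) * ((-1) ^ j *
        (formPeriod p (poleOrder r b - k) - formTail p N j (poleOrder r b - k))) := by
  rw [formSum, ← tsum_mul_left]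
  simp only [mul_left_comm (2 : ℝ), two_mul_formFun hp hr, Finset.mul_sum]
  refine (hasSum_sum fun j hj => hasSum_sum fun k hk => ?_).tsum_eq
  have := Finset.mem_range.mp hj
  have := Finset.mem_range.mp hk
  simp only [mul_left_comm _ (PowerSeries.coeff k _)]
  exact (hasSum_formPeriod_sub_formTail hp (by omega) (by omega)).mul_left _

end FormSum

/-! ### The `q`-beta values -/

/-- The real counterpart of `qBeta q (i + 1)`. -/
noncomputable def realBeta (q : ℝ) (i : ℕ) : ℝ :=
  ∑' k : ℕ, (k : ℝ) ^ i * (q ^ k / (1 + q ^ (2 * k)))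

theorem qBeta_ofReal (q : ℝ) {i : ℕ} (hi : i ≠ 0) :
    qBeta (q : ℂ) (i + 1) = (realBeta q i : ℂ) := by
  rw [qBeta, realBeta, Complex.ofReal_tsum]
  have hpnat := PNat.coe_injective.tsum_eq
    (f := fun k : ℕ => (((k : ℝ) ^ i * (q ^ k / (1 + q ^ (2 * k))) : ℝ) : ℂ)) (by
      intro k hk
      have hk0 : k ≠ 0 := by
        rintro rfl
        simp [hi] at hk
      exact ⟨⟨k, Nat.pos_of_ne_zero hk0⟩, rfl⟩)
  rw [← hpnat]
  simp

/-- The power series `∑ k ^ i x ^ k`, a polylogarithm of order `-i`. -/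
noncomputable def powSum (i : ℕ) (x : ℝ) : ℝ := ∑' k : ℕ, (k : ℝ) ^ i * x ^ k

section LambertSeries

variable {q : ℝ}

theorem summable_powSum (i : ℕ) (hq : |q| < 1) : Summable fun k : ℕ => (k : ℝ) ^ i * q ^ k :=
  summable_pow_mul_geometric_of_norm_lt_one i hq

theorem summable_lambert (hq : |q| < 1) {i : ℕ} (hi : i ≠ 0) :
    Summable fun x : ℕ × ℕ => (-1 : ℝ) ^ x.1 * ((x.2 : ℝ) ^ i * (q ^ (2 * x.1 + 1)) ^ x.2) := by
  have hdom := (summable_geometric_of_lt_one (abs_nonneg q) hq).mul_of_nonneg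
    (summable_powSum i (q := |q|) (by rwa [abs_abs])) (fun _ => by positivity)
    (fun _ => by positivity)
  refine Summable.of_norm_bounded hdom fun ⟨h, k⟩ => ?_
  rcases Nat.eq_zero_or_pos k with rfl | hk
  · simp [hi]
  have hpow : |q| ^ ((2 * h + 1) * k) ≤ |q| ^ (h + k) :=
    pow_le_pow_of_le_one (abs_nonneg q) hq.le (by nlinarith)
  calc
    ‖(-1 : ℝ) ^ h * ((k : ℝ) ^ i * (q ^ (2 * h + 1)) ^ k)‖
      = (k : ℝ) ^ i * |q| ^ ((2 * h + 1) * k) := by simp [pow_mul]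
    _ ≤ (k : ℝ) ^ i * |q| ^ (h + k) := by gcongr
    _ = |q| ^ h * ((k : ℝ) ^ i * |q| ^ k) := by rw [pow_add]; ring

theorem tsum_alternating_odd_pow (hq : |q| < 1) {k : ℕ} (hk : k ≠ 0) :
    ∑' h : ℕ, (-1 : ℝ) ^ h * (q ^ (2 * h + 1)) ^ k = q ^ k / (1 + q ^ (2 * k)) := by
  have hterm (h : ℕ) : (-1 : ℝ) ^ h * (q ^ (2 * h + 1)) ^ k = q ^ k * (-(q ^ (2 * k))) ^ h := by
    rw [neg_pow (q ^ (2 * k)), ← pow_mul, ← pow_mul]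
    ring
  have hratio : ‖-(q ^ (2 * k))‖ < 1 := by
    rw [norm_neg, norm_pow]
    exact pow_lt_one₀ (abs_nonneg q) hq (by omega)
  simp_rw [hterm]
  rw [tsum_mul_left, tsum_geometric_of_norm_lt_one hratio, sub_neg_eq_add, div_eq_mul_inv]

theorem realBeta_eq_tsum_powSum (hq : |q| < 1) {i : ℕ} (hi : i ≠ 0) :
    realBeta q i = ∑' h : ℕ, (-1 : ℝ) ^ h * powSum i (q ^ (2 * h + 1)) := by
  have hcomm := (summable_lambert hq hi).tsum_comm (f := fun h k : ℕ =>
    (-1 : ℝ) ^ h * ((k : ℝ) ^ i * (q ^ (2 * h + 1)) ^ k))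
  simp_rw [realBeta, powSum, ← tsum_mul_left]
  rw [← hcomm]
  refine tsum_congr fun k => ?_
  rcases eq_or_ne k 0 with rfl | hk
  · simp [hi]
  · rw [← tsum_alternating_odd_pow hq hk, ← tsum_mul_left]
    exact tsum_congr fun h => by ring

theorem summable_alternating_powSum (hq : |q| < 1) {i : ℕ} (hi : i ≠ 0) :
    Summable fun h : ℕ => (-1 : ℝ) ^ h * powSum i (q ^ (2 * h + 1)) :=
  (summable_lambert hq hi).prod.congr fun h => by rw [powSum, ← tsum_mul_left]

end LambertSeries

/-- The polynomial `(X + 1) (X + 2) ⋯ (X + s)`. -/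
noncomputable def risingPoly (s : ℕ) : Polynomial ℚ :=
  (ascPochhammer ℚ s).comp (Polynomial.X + 1)

theorem natDegree_risingPoly_lt (s : ℕ) : (risingPoly s).natDegree < s + 1 := by
  refine Nat.lt_succ_of_le (Polynomial.natDegree_comp_le.trans_eq ?_)
  rw [ascPochhammer_natDegree, ← Polynomial.C_1, Polynomial.natDegree_X_add_C, mul_one]

theorem eval_natCast_risingPoly (s k : ℕ) :
    (risingPoly s).eval (k : ℚ) = s.factorial * (k + s).choose s := by
  rw [risingPoly, Polynomial.eval_comp, Polynomial.eval_add, Polynomial.eval_X,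
    Polynomial.eval_one, ← Nat.cast_add_one, ascPochhammer_nat_eq_natCast_ascFactorial,
    Nat.ascFactorial_eq_factorial_mul_choose, Nat.cast_mul]

theorem eval_neg_natCast_risingPoly (s k : ℕ) :
    (risingPoly s).eval (-((k + 1 : ℕ) : ℚ)) = (-1) ^ s * (s.factorial * k.choose s) := by
  rw [risingPoly, Polynomial.eval_comp, Polynomial.eval_add, Polynomial.eval_X,
    Polynomial.eval_one, Nat.cast_add_one, neg_add, neg_add_cancel_right,
    ascPochhammer_eval_neg_eq_descPochhammer, descPochhammer_eval_eq_descFactorial,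
    Nat.descFactorial_eq_factorial_mul_choose, Nat.cast_mul]

/-- The coefficients of twice the odd part of `risingPoly s`. -/
noncomputable def oddCoeff (s i : ℕ) : ℚ := (risingPoly s).coeff i * (1 - (-1) ^ i)

theorem oddCoeff_of_even {s i : ℕ} (hi : Even i) : oddCoeff s i = 0 := by
  simp [oddCoeff, hi.neg_one_pow]

theorem sum_oddCoeff_mul_pow (s : ℕ) (x : ℚ) :
    ∑ i ∈ Finset.range (s + 1), oddCoeff s i * x ^ i
      = (risingPoly s).eval x - (risingPoly s).eval (-x) := by
  rw [Polynomial.eval_eq_sum_range' (natDegree_risingPoly_lt s),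
    Polynomial.eval_eq_sum_range' (natDegree_risingPoly_lt s), ← Finset.sum_sub_distrib]
  refine Finset.sum_congr rfl fun i _ => ?_
  rw [oddCoeff, neg_pow x]
  ring

theorem sum_oddCoeff_mul_natCast_pow (s k : ℕ) :
    ∑ i ∈ Finset.range (s + 1), (oddCoeff s i : ℝ) * ((k + 1 : ℕ) : ℝ) ^ i
      = s.factorial * ((k + 1 + s).choose s + (-1) ^ (s + 1) * k.choose s) := by
  have hrat := sum_oddCoeff_mul_pow s ((k + 1 : ℕ) : ℚ)
  rw [eval_natCast_risingPoly, eval_neg_natCast_risingPoly] at hrat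
  have hreal := congrArg (fun t : ℚ => (t : ℝ)) hrat
  push_cast at hreal ⊢
  rw [hreal]
  ring

theorem hasSum_choose_mul_pow_succ {x : ℝ} (hx : |x| < 1) (s : ℕ) :
    HasSum (fun k : ℕ => (k.choose s : ℝ) * x ^ (k + 1)) ((x / (1 - x)) ^ (s + 1)) := by
  have hshift := (hasSum_choose_mul_geometric_of_norm_lt_one (r := x) s hx).mul_right (x ^ (s + 1))
  rw [← hasSum_nat_add_iff' s, Finset.sum_eq_zero, sub_zero, div_pow, div_eq_mul_one_div, mul_comm]
  · exact hshift.congr_fun fun k => by ring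
  · intro k hk
    rw [Nat.choose_eq_zero_of_lt (Finset.mem_range.mp hk), Nat.cast_zero, zero_mul]

theorem hasSum_sum_oddCoeff_mul_pow {x : ℝ} (hx : |x| < 1) (s : ℕ) :
    HasSum (fun k : ℕ => (∑ i ∈ Finset.range (s + 1), (oddCoeff s i : ℝ) * (k : ℝ) ^ i) * x ^ k)
      (s.factorial * ((1 / (1 - x)) ^ (s + 1) + (1 - 1 / (1 - x)) ^ (s + 1) - 1)) := by
  have hzero : ∑ i ∈ Finset.range (s + 1), (oddCoeff s i : ℝ) * ((0 : ℕ) : ℝ) ^ i = 0 := by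
    rw [Nat.cast_zero, Finset.sum_range_succ', Finset.sum_eq_zero fun i _ => by simp,
      oddCoeff_of_even Even.zero]
    simp
  have hneg : 1 - 1 / (1 - x) = -(x / (1 - x)) := by
    have : 1 - x ≠ 0 := by linarith [(abs_lt.mp hx).2]
    field_simp
    ring
  have hpos : HasSum (fun k : ℕ => ((k + 1 + s).choose s : ℝ) * x ^ (k + 1))
      ((1 / (1 - x)) ^ (s + 1) - 1) := by
    have hgeom := hasSum_choose_mul_geometric_of_norm_lt_one (r := x) s hx
    rw [← hasSum_nat_add_iff' 1] at hgeom
    simpa [div_pow] using hgeom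
  rw [← hasSum_nat_add_iff' 1, Finset.sum_range_one, hzero, zero_mul, sub_zero, hneg, neg_pow]
  have hsum := (hpos.add ((hasSum_choose_mul_pow_succ hx s).mul_left ((-1) ^ (s + 1)))).mul_left
    (s.factorial : ℝ)
  rw [add_sub_right_comm]
  refine hsum.congr_fun fun k => ?_
  rw [sum_oddCoeff_mul_natCast_pow]
  ring

theorem factorial_mul_one_div_pow_add {x : ℝ} (hx : |x| < 1) (s : ℕ) :
    s.factorial * ((1 / (1 - x)) ^ (s + 1) + (1 - 1 / (1 - x)) ^ (s + 1) - 1)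
      = ∑ i ∈ Finset.range (s + 1), (oddCoeff s i : ℝ) * powSum i x := by
  have hsum : HasSum (fun k : ℕ => ∑ i ∈ Finset.range (s + 1),
      (oddCoeff s i : ℝ) * ((k : ℝ) ^ i * x ^ k))
      (∑ i ∈ Finset.range (s + 1), (oddCoeff s i : ℝ) * powSum i x) :=
    hasSum_sum fun i _ => (summable_powSum i hx).hasSum.mul_left _
  refine (hasSum_sum_oddCoeff_mul_pow hx s).unique (hsum.congr_fun fun k => ?_)
  simp only [Finset.sum_mul, mul_assoc]

theorem abs_inv_lt_one {p : ℝ} (hp : 2 ≤ |p|) : |p⁻¹| < 1 := by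
  rw [abs_inv]
  exact inv_lt_one_of_one_lt₀ (by linarith)

theorem factorial_mul_formPeriod {p : ℝ} (hp : 2 ≤ |p|) (s : ℕ) :
    s.factorial * formPeriod p (s + 1)
      = ∑ i ∈ Finset.range (s + 1), (oddCoeff s i : ℝ) * realBeta p⁻¹ i := by
  have hq := abs_inv_lt_one hp
  have hsummable (i : ℕ) : Summable fun h : ℕ =>
      (oddCoeff s i : ℝ) * ((-1 : ℝ) ^ h * powSum i (p⁻¹ ^ (2 * h + 1))) := by
    rcases eq_or_ne i 0 with rfl | hi
    · simp [oddCoeff_of_even]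
    · exact (summable_alternating_powSum hq hi).mul_left _
  calc
    s.factorial * formPeriod p (s + 1)
      = ∑' h : ℕ, ∑ i ∈ Finset.range (s + 1),
          (oddCoeff s i : ℝ) * ((-1 : ℝ) ^ h * powSum i (p⁻¹ ^ (2 * h + 1))) := by
        rw [formPeriod, ← tsum_mul_left]
        refine tsum_congr fun h => ?_
        have hx : |p⁻¹ ^ (2 * h + 1)| < 1 := by
          rw [abs_pow]
          exact pow_lt_one₀ (abs_nonneg _) hq (by omega)
        simp only [geoVal, mul_left_comm _ ((-1 : ℝ) ^ h), ← Finset.mul_sum]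
        rw [factorial_mul_one_div_pow_add hx]
    _ = ∑ i ∈ Finset.range (s + 1), (oddCoeff s i : ℝ) * realBeta p⁻¹ i := by
        rw [Summable.tsum_finsetSum fun i _ => hsummable i]
        refine Finset.sum_congr rfl fun i _ => ?_
        rw [tsum_mul_left]
        rcases eq_or_ne i 0 with rfl | hi
        · simp [oddCoeff_of_even]
        · rw [realBeta_eq_tsum_powSum hq hi]

/-- The real counterpart of `qBetaSpace`. -/
noncomputable def realBetaSpace (q : ℝ) (A : ℕ) : Submodule ℚ ℝ :=
  Submodule.span ℚ (insert 1 ((fun s => realBeta q (s - 1)) '' {s | Even s ∧ 2 ≤ s ∧ s ≤ A - 1}))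

theorem formPeriod_mem_realBetaSpace {p : ℝ} (hp : 2 ≤ |p|) {A s : ℕ} (hA : Odd A) (hs : s ≠ 0)
    (hsA : s ≤ A) : formPeriod p s ∈ realBetaSpace p⁻¹ A := by
  obtain ⟨s, rfl⟩ := Nat.exists_eq_add_one_of_ne_zero hs
  have hfact : (s.factorial : ℝ) ≠ 0 := Nat.cast_ne_zero.mpr s.factorial_ne_zero
  have hcomb : formPeriod p (s + 1) = (s.factorial : ℚ)⁻¹ • ∑ i ∈ Finset.range (s + 1),
      oddCoeff s i • realBeta p⁻¹ i := by
    simp only [Rat.smul_def, Rat.cast_inv, Rat.cast_natCast]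
    rw [← factorial_mul_formPeriod hp s, inv_mul_cancel_left₀ hfact]
  rw [hcomb]
  refine Submodule.smul_mem _ _ (Submodule.sum_mem _ fun i hi => ?_)
  have := Finset.mem_range.mp hi
  rcases Nat.even_or_odd i with heven | hodd
  · rw [oddCoeff_of_even heven, zero_smul]
    exact Submodule.zero_mem _
  · have := hodd.pos
    have hiA : i + 1 ≤ A - 1 := by
      obtain ⟨k, rfl⟩ := hA
      obtain ⟨l, rfl⟩ := hodd
      omega
    exact Submodule.smul_mem _ _ (Submodule.subset_span
      (Set.mem_insert_of_mem _ ⟨i + 1, ⟨hodd.add_one, by omega, hiA⟩, rfl⟩))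

theorem qBetaSpace_eq_map (q : ℝ) (A : ℕ) :
    qBetaSpace (q : ℂ) A
      = (realBetaSpace q A).map (Complex.ofRealAm.toLinearMap.restrictScalars ℚ) := by
  have himage : qBeta (q : ℂ) '' {s | Even s ∧ 2 ≤ s ∧ s ≤ A - 1}
      = (fun s => (realBeta q (s - 1) : ℂ)) '' {s | Even s ∧ 2 ≤ s ∧ s ≤ A - 1} := by
    refine Set.image_congr fun s ⟨_, hs, _⟩ => ?_
    rw [← qBeta_ofReal q (by omega), Nat.sub_add_cancel (by omega)]
  rw [qBetaSpace, realBetaSpace, Submodule.map_span, Set.image_insert_eq, Set.image_image, himage]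
  simp

theorem finrank_qBetaSpace (q : ℝ) (A : ℕ) :
    Module.finrank ℚ (qBetaSpace (q : ℂ) A) = Module.finrank ℚ (realBetaSpace q A) := by
  rw [qBetaSpace_eq_map]
  exact (Submodule.equivMapOfInjective _ Complex.ofReal_injective _).finrank_eq.symm

theorem finiteDimensional_realBetaSpace (q : ℝ) (A : ℕ) :
    FiniteDimensional ℚ (realBetaSpace q A) := by
  refine FiniteDimensional.span_of_finite ℚ (Set.Finite.insert _ (Set.Finite.image _ ?_))
  exact (Set.finite_Iic (A - 1)).subset fun s hs => hs.2.2

/-- The factor that makes the coefficients of the linear forms integral. -/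
noncomputable def multiplier (m : ℤ) (r b N : ℕ) : ℝ :=
  (evenPowProd m (2 * N) : ℝ) ^ poleOrder r b / (oddPartProd m (2 * N) : ℝ) ^ (2 * r) *
    ((cyclotomicProd m (2 * N) : ℝ) ^ (poleOrder r b - 1) * (oddCyclotomicProd m (2 * N) : ℝ))

/-- The coefficients of the linear forms: `none` is for the constant term, and `some k` for the
coefficient of `formPeriod m (poleOrder r b - k)`. -/
noncomputable def formCoeff (m : ℤ) (r b N : ℕ) : Option (Fin (poleOrder r b)) → ℝ
  | none => -(multiplier m r b N * ∑ j ∈ Finset.range (2 * N + 1),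
      ∑ k ∈ Finset.range (poleOrder r b), PowerSeries.coeff k (localSeries m r b N j) *
        ((-1) ^ j * formTail m N j (poleOrder r b - k)))
  | some k => multiplier m r b N * ∑ j ∈ Finset.range (2 * N + 1),
      PowerSeries.coeff (k : ℕ) (localSeries m r b N j) * (-1) ^ j

/-- The numbers at which the linear forms are evaluated, indexed as in `formCoeff`. -/
noncomputable def formPoint (p : ℝ) (r b : ℕ) : Option (Fin (poleOrder r b)) → ℝ
  | none => 1
  | some k => formPeriod p (poleOrder r b - k)

section Forms

variable {m : ℤ}

theorem multiplier_ne_zero (hm : 2 ≤ |m|) (r b N : ℕ) : multiplier m r b N ≠ 0 := by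
  have := evenPowProd_ne_zero hm (2 * N)
  have := oddPartProd_ne_zero hm (2 * N)
  have := cyclotomicProd_ne_zero hm (2 * N)
  have := oddCyclotomicProd_ne_zero hm (2 * N)
  unfold multiplier
  positivity

theorem tendsto_log_multiplier (hm : 2 ≤ |m|) (r b : ℕ) :
    Tendsto (fun N : ℕ => Real.log |multiplier m r b N| / (N : ℝ) ^ 2) atTop
      (𝓝 ((4 * poleOrder r b - 8 * r / 3 + 48 / Real.pi ^ 2 * poleOrder r b - 16 / Real.pi ^ 2)
        * Real.log |(m : ℝ)|)) := by
  have hlim := (((tendsto_log_evenPowProd hm).const_mul (poleOrder r b : ℝ)).sub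
    ((tendsto_log_oddPartProd hm).const_mul (2 * r : ℝ))).add
    (((tendsto_log_cyclotomicProd hm).const_mul ((poleOrder r b : ℝ) - 1)).add
      (tendsto_log_oddCyclotomicProd hm))
  refine (hlim.congr fun N => ?_).trans_eq (by congr 1; ring)
  have := evenPowProd_ne_zero hm (2 * N)
  have := oddPartProd_ne_zero hm (2 * N)
  have := cyclotomicProd_ne_zero hm (2 * N)
  have := oddCyclotomicProd_ne_zero hm (2 * N)
  rw [multiplier, abs_mul, abs_div, abs_mul, abs_pow, abs_pow, abs_pow,
    Real.log_mul (by positivity) (by positivity), Real.log_div (by positivity) (by positivity),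
    Real.log_mul (by positivity) (by positivity), Real.log_pow, Real.log_pow, Real.log_pow,
    Nat.cast_sub (by simp [poleOrder])]
  push_cast
  ring

/-! ### Integrality of the coefficients -/

theorem mul_one_sub_geoVal_mem_bot (hm : 2 ≤ |m|) {a : ℕ} (ha : a ≠ 0) {D : ℤ}
    (hD : m ^ a - 1 ∣ D) : (D : ℝ) * (1 - geoVal m a) ∈ (⊥ : Subring ℝ) := by
  obtain ⟨z, rfl⟩ := hD
  have hne : (m : ℝ) ^ a - 1 ≠ 0 := pow_sub_one_ne_zero (two_le_abs_cast hm) ha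
  have hval : ((((m ^ a - 1) * z : ℤ)) : ℝ) * (1 - geoVal m a) = ((-z : ℤ) : ℝ) := by
    rw [one_sub_geoVal (two_le_abs_cast hm) ha, ← neg_sub ((m : ℝ) ^ a) 1]
    push_cast
    field_simp
  rw [hval]
  exact intCast_mem _ _

theorem mul_geoVal_mem_bot (hm : 2 ≤ |m|) {a : ℕ} (ha : a ≠ 0) {D : ℤ} (hD : m ^ a - 1 ∣ D) :
    (D : ℝ) * geoVal m a ∈ (⊥ : Subring ℝ) := by
  have hsub := sub_mem (intCast_mem (⊥ : Subring ℝ) D) (mul_one_sub_geoVal_mem_bot hm ha hD)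
  rwa [← mul_one_sub, sub_sub_cancel] at hsub

theorem pow_pred_mul_mul_pow_mem {R : Type*} [CommRing R] (S : Subring R) {D E x : R} {s : ℕ}
    (hs : s ≠ 0) (hD : D * x ∈ S) (hE : E * x ∈ S) : D ^ (s - 1) * E * x ^ s ∈ S := by
  obtain ⟨t, rfl⟩ := Nat.exists_eq_add_one_of_ne_zero hs
  have hmul := mul_mem (pow_mem hD t) hE
  rwa [mul_pow, mul_mul_mul_comm, ← pow_succ] at hmul

theorem neg_one_pow_mem {R : Type*} [Ring R] (S : Subring R) (n : ℕ) : (-1 : R) ^ n ∈ S :=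
  pow_mem (neg_mem (one_mem S)) n

theorem cyclotomicProd_pow_mul_mem_bot (m : ℤ) (n s : ℕ) :
    (cyclotomicProd m n : ℝ) ^ s * (oddCyclotomicProd m n : ℝ) ∈ (⊥ : Subring ℝ) :=
  mul_mem (pow_mem (intCast_mem _ _) _) (intCast_mem _ _)

theorem cyclotomicProd_pow_mul_formTail_mem_bot (hm : 2 ≤ |m|) {N j s : ℕ} (hj : j ≤ 2 * N)
    (hs : s ≠ 0) :
    (cyclotomicProd m (2 * N) : ℝ) ^ (s - 1) * (oddCyclotomicProd m (2 * N) : ℝ) *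
      formTail m N j s ∈ (⊥ : Subring ℝ) := by
  have hdvd {h : ℕ} (hh : h < 2 * N) : m ^ (2 * h + 1) - 1 ∣ cyclotomicProd m (2 * N) :=
    pow_sub_one_dvd_cyclotomicProd m (by omega) (by omega)
  have hdvd' {h : ℕ} (hh : h < 2 * N) : m ^ (2 * h + 1) - 1 ∣ oddCyclotomicProd m (2 * N) :=
    pow_sub_one_dvd_oddCyclotomicProd m (odd_two_mul_add_one h) (by omega)
  rw [formTail, mul_add, Finset.mul_sum, Finset.mul_sum]
  refine add_mem (sum_mem fun h hh => ?_) (sum_mem fun h hh => ?_) <;>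
    rw [mul_left_comm] <;>
    refine mul_mem (neg_one_pow_mem _ h) ?_
  · have hh' : h < 2 * N := (Finset.mem_range.mp hh).trans_le hj
    rw [mul_sub, mul_one]
    exact sub_mem (pow_pred_mul_mul_pow_mem _ hs (mul_geoVal_mem_bot hm (by omega) (hdvd hh'))
      (mul_geoVal_mem_bot hm (by omega) (hdvd' hh'))) (cyclotomicProd_pow_mul_mem_bot _ _ _)
  · have hh' : h < 2 * N := (Finset.mem_range.mp hh).trans_le (Nat.sub_le _ _)
    exact pow_pred_mul_mul_pow_mem _ hs (mul_one_sub_geoVal_mem_bot hm (by omega) (hdvd hh'))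
      (mul_one_sub_geoVal_mem_bot hm (by omega) (hdvd' hh'))

theorem exists_multiplier_mul_coeff_eq (hm : 2 ≤ |m|) {r b N j k : ℕ} (hj : j ≤ 2 * N)
    (hk : k < poleOrder r b) :
    ∃ z : ℤ, multiplier m r b N * PowerSeries.coeff k (localSeries m r b N j)
      = z * ((cyclotomicProd m (2 * N) : ℝ) ^ (poleOrder r b - k - 1) *
          (oddCyclotomicProd m (2 * N) : ℝ)) := by
  obtain ⟨z, hz⟩ :=
    mem_integralSeries.mp (C_mul_localSeries_mem_integralSeries hm r b N j hj) k
  refine ⟨z, ?_⟩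
  rw [hz, PowerSeries.coeff_C_mul, multiplier,
    show poleOrder r b - 1 = k + (poleOrder r b - k - 1) by omega, pow_add]
  ring

theorem formCoeff_mem_bot (hm : 2 ≤ |m|) (r b N : ℕ) (i : Option (Fin (poleOrder r b))) :
    formCoeff m r b N i ∈ (⊥ : Subring ℝ) := by
  rcases i with _ | k
  · simp only [formCoeff, Finset.mul_sum]
    refine neg_mem (sum_mem fun j hj => sum_mem fun k hk => ?_)
    have hj' : j ≤ 2 * N := Nat.lt_succ_iff.mp (Finset.mem_range.mp hj)
    have hk' := Finset.mem_range.mp hk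
    obtain ⟨z, hz⟩ := exists_multiplier_mul_coeff_eq hm hj' hk'
    rw [← mul_assoc, hz, mul_left_comm, mul_assoc]
    exact mul_mem (neg_one_pow_mem _ j) (mul_mem (intCast_mem _ z)
      (cyclotomicProd_pow_mul_formTail_mem_bot hm hj' (by omega)))
  · simp only [formCoeff, Finset.mul_sum]
    refine sum_mem fun j hj => ?_
    have hj' : j ≤ 2 * N := Nat.lt_succ_iff.mp (Finset.mem_range.mp hj)
    obtain ⟨z, hz⟩ := exists_multiplier_mul_coeff_eq hm hj' k.2
    rw [← mul_assoc, hz]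
    exact mul_mem (mul_mem (intCast_mem _ z) (cyclotomicProd_pow_mul_mem_bot _ _ _))
      (neg_one_pow_mem _ j)

theorem sum_formCoeff_mul_formPoint (hm : 2 ≤ |m|) {r : ℕ} (hr : 1 ≤ r) (b N : ℕ) :
    ∑ i, formCoeff m r b N i * formPoint m r b i = multiplier m r b N * (2 * formSum m r b N) := by
  have hperiods := Fin.sum_univ_eq_sum_range (fun k => multiplier m r b N *
    (∑ j ∈ Finset.range (2 * N + 1), PowerSeries.coeff k (localSeries m r b N j) * (-1) ^ j) *
      formPeriod m (poleOrder r b - k)) (poleOrder r b)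
  rw [Fintype.sum_option, two_mul_formSum (two_le_abs_cast hm) hr]
  simp only [formCoeff, formPoint]
  rw [hperiods]
  simp only [mul_sub, Finset.sum_sub_distrib, mul_one, Finset.mul_sum, Finset.sum_mul]
  rw [Finset.sum_comm (s := Finset.range (poleOrder r b)), neg_add_eq_sub]
  simp only [mul_assoc]

/-! ### Size of the coefficients -/

theorem abs_formTail_le {p : ℝ} (hp : 2 ≤ |p|) {N j s : ℕ} (hj : j ≤ 2 * N) (hs : s ≠ 0) :
    |formTail p N j s| ≤ 2 * N * (s * 2 ^ s * 2) := by
  set B : ℝ := s * 2 ^ s * 2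
  have hB : 1 ≤ B := by
    have : (1 : ℝ) ≤ s := Nat.one_le_cast.mpr (Nat.one_le_iff_ne_zero.mpr hs)
    have : (1 : ℝ) ≤ 2 ^ s := one_le_pow₀ one_le_two
    nlinarith
  have hgeo : ∀ h ∈ Finset.range j, |(-1 : ℝ) ^ h * (geoVal p (2 * h + 1) ^ s - 1)| ≤ B := by
    intro h _
    rw [abs_mul, abs_neg_one_pow, one_mul]
    exact (abs_geoVal_pow_sub_one_le hp (by omega) s).trans
      (mul_le_of_le_one_right (by linarith) (pow_le_one₀ (by norm_num) (by norm_num)))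
  have hgeo' : ∀ h ∈ Finset.range (2 * N - j),
      |(-1 : ℝ) ^ h * (1 - geoVal p (2 * h + 1)) ^ s| ≤ B := by
    intro h _
    rw [abs_mul, abs_neg_one_pow, one_mul, abs_pow]
    exact (pow_le_one₀ (abs_nonneg _) (abs_one_sub_geoVal_le_one hp (by omega))).trans hB
  calc
    |formTail p N j s| ≤ j * B + (2 * N - j : ℕ) * B := by
      refine (abs_add_le _ _).trans (add_le_add ?_ ?_) <;>
        refine (Finset.abs_sum_le_sum_abs _ _).trans ?_
      · simpa using Finset.sum_le_card_nsmul _ _ _ hgeo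
      · simpa using Finset.sum_le_card_nsmul _ _ _ hgeo'
    _ = 2 * N * B := by
      rw [Nat.cast_sub hj]
      push_cast
      ring

theorem abs_sum_coeff_mul_formTail_le {p : ℝ} (hp : 2 ≤ |p|) (A : ℕ) {N j : ℕ} (hj : j ≤ 2 * N)
    (g : PowerSeries ℝ) :
    |∑ k ∈ Finset.range A, PowerSeries.coeff k g * ((-1) ^ j * formTail p N j (A - k))|
      ≤ seriesNorm A g * (2 * N * (A * 2 ^ A * 2)) := by
  refine (Finset.abs_sum_le_sum_abs _ _).trans ?_
  rw [seriesNorm, Finset.sum_mul]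
  refine Finset.sum_le_sum fun k hk => ?_
  have := Finset.mem_range.mp hk
  rw [abs_mul, abs_mul, abs_neg_one_pow, one_mul]
  refine mul_le_mul_of_nonneg_left ((abs_formTail_le hp hj (by omega)).trans ?_) (abs_nonneg _)
  gcongr
  · exact Nat.sub_le A k
  · exact one_le_two
  · exact Nat.sub_le A k

theorem abs_formCoeff_le (hm : 2 ≤ |m|) (r b N : ℕ) {B : ℝ}
    (hB : ∀ j ≤ 2 * N, seriesNorm (poleOrder r b) (localSeries m r b N j) ≤ B)
    (i : Option (Fin (poleOrder r b))) :
    |formCoeff m r b N i| ≤ |multiplier m r b N| *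
      ((2 * N + 1) * (B * (1 + 2 * N * (poleOrder r b * 2 ^ poleOrder r b * 2)))) := by
  have hB0 : 0 ≤ B := (seriesNorm_nonneg _ _).trans (hB 0 (Nat.zero_le _))
  have hsum (f : ℕ → ℝ) (hf : ∀ j ≤ 2 * N, |f j| ≤
      B * (1 + 2 * N * (poleOrder r b * 2 ^ poleOrder r b * 2))) :
      |multiplier m r b N * ∑ j ∈ Finset.range (2 * N + 1), f j| ≤ |multiplier m r b N| *
        ((2 * N + 1) * (B * (1 + 2 * N * (poleOrder r b * 2 ^ poleOrder r b * 2)))) := by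
    rw [abs_mul]
    refine mul_le_mul_of_nonneg_left ((Finset.abs_sum_le_sum_abs _ _).trans ?_) (abs_nonneg _)
    simpa using Finset.sum_le_card_nsmul (Finset.range (2 * N + 1)) _ _
      fun j hj => hf j (Nat.lt_succ_iff.mp (Finset.mem_range.mp hj))
  rcases i with _ | k
  · rw [formCoeff, abs_neg]
    refine hsum _ fun j hj => (abs_sum_coeff_mul_formTail_le (two_le_abs_cast hm) _ hj _).trans ?_
    have := hB j hj
    gcongr
    linarith
  · refine hsum _ fun j hj => ?_
    rw [abs_mul, abs_neg_one_pow, mul_one]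
    refine ((abs_coeff_le_seriesNorm k.2 _).trans (hB j hj)).trans
      (le_mul_of_one_le_right hB0 (le_add_of_nonneg_right (by positivity)))

theorem exists_abs_formCoeff_le (hm : 2 ≤ |m|) (r b : ℕ) :
    ∃ K : ℝ, 0 < K ∧ ∀ N i, |formCoeff m r b N i| * |(m : ℝ)| ^ (2 * poleOrder r b * N ^ 2)
      ≤ |multiplier m r b N| * (K ^ (N + 1) * |(m : ℝ)| ^ ((8 * r ^ 2 + 8 * r) * N ^ 2)) := by
  have hM : 0 < |(m : ℝ)| := by linarith [two_le_abs_cast hm]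
  obtain ⟨K, hK, hnorm⟩ :=
    exists_seriesNorm_localSeries_le (poleOrder r b) (two_le_abs_cast hm) r b
  set E : ℝ := poleOrder r b * 2 ^ poleOrder r b * 2
  have hE : 0 ≤ E := by positivity
  refine ⟨Real.exp (2 + 2 * E) * K, by positivity, fun N i => ?_⟩
  set P := |(m : ℝ)| ^ (2 * poleOrder r b * N ^ 2)
  set Q := |(m : ℝ)| ^ ((8 * r ^ 2 + 8 * r) * N ^ 2)
  have hP : 0 < P := by positivity
  have hlinear : (2 * N + 1) * (1 + 2 * N * E) ≤ Real.exp (2 + 2 * E) ^ (N + 1) := by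
    calc
      (2 * N + 1) * (1 + 2 * N * E) ≤ Real.exp (2 * N) * Real.exp (2 * N * E) := by
        gcongr
        · exact Real.add_one_le_exp _
        · linarith [Real.add_one_le_exp (2 * N * E)]
      _ = Real.exp (N * (2 + 2 * E)) := by rw [← Real.exp_add]; ring_nf
      _ ≤ Real.exp ((N + 1 : ℕ) * (2 + 2 * E)) := by gcongr; exact Nat.le_succ N
      _ = Real.exp (2 + 2 * E) ^ (N + 1) := Real.exp_nat_mul _ _
  have hcoeff := abs_formCoeff_le hm r b N (fun j hj => (le_div_iff₀ hP).mpr (hnorm N j hj)) i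
  calc
    |formCoeff m r b N i| * P
      ≤ |multiplier m r b N| * ((2 * N + 1) * (K ^ (N + 1) * Q / P * (1 + 2 * N * E))) * P := by
        gcongr
    _ = |multiplier m r b N| * ((2 * N + 1) * (1 + 2 * N * E) * (K ^ (N + 1) * Q)) := by
        field_simp
    _ ≤ |multiplier m r b N| * ((Real.exp (2 + 2 * E) * K) ^ (N + 1) * Q) := by
        rw [mul_pow, mul_assoc (Real.exp _ ^ _)]
        gcongr

theorem abs_pow_eq_exp {x : ℝ} (hx : x ≠ 0) (n : ℕ) : |x| ^ n = Real.exp (n * Real.log |x|) := by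
  rw [Real.exp_nat_mul, Real.exp_log (abs_pos.mpr hx)]

theorem eventually_abs_formCoeff_le (hm : 2 ≤ |m|) (r b : ℕ) {ε : ℝ} (hε : 0 < ε) :
    ∀ᶠ N : ℕ in atTop, ∀ i, |formCoeff m r b N i| ≤ Real.exp
      (((2 * poleOrder r b + 8 * r ^ 2 + 16 * r / 3 + 48 / Real.pi ^ 2 * poleOrder r b
        - 16 / Real.pi ^ 2) * (Real.log |(m : ℝ)|) + ε) * (N : ℝ) ^ 2) := by
  set A := poleOrder r b
  have hm0 : (m : ℝ) ≠ 0 := ne_zero_of_two_le_abs (two_le_abs_cast hm)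
  obtain ⟨K, hK, hcoeff⟩ := exists_abs_formCoeff_le hm r b
  have hlogmult := (tendsto_log_multiplier hm r b).eventually_lt_const
    (lt_add_of_pos_right _ (half_pos hε))
  have hlogK := (tendsto_quadratic_div_sq 0 (Real.log K) (Real.log K)).eventually_lt_const
    (half_pos hε)
  filter_upwards [hlogmult, hlogK, eventually_gt_atTop 0] with N hmult hKN hN i
  have hsq : (0 : ℝ) < (N : ℝ) ^ 2 := by positivity
  rw [div_lt_iff₀ hsq] at hmult hKN
  have hmult_exp := (Real.log_le_iff_le_exp (abs_pos.mpr (multiplier_ne_zero hm r b N))).mp hmult.le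
  have hK_exp : K ^ (N + 1) = Real.exp ((N + 1 : ℕ) * Real.log K) := by
    rw [Real.exp_nat_mul, Real.exp_log hK]
  have hN := hcoeff N i
  rw [abs_pow_eq_exp hm0, abs_pow_eq_exp hm0, hK_exp, ← le_div_iff₀ (Real.exp_pos _)] at hN
  refine hN.trans ((div_le_div_of_nonneg_right (mul_le_mul_of_nonneg_right hmult_exp
    (by positivity)) (Real.exp_pos _).le).trans ?_)
  rw [← Real.exp_add, ← Real.exp_add, ← Real.exp_sub]
  refine Real.exp_le_exp.mpr ?_
  push_cast
  linarith

end Forms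

/-! ### Size of the linear forms -/

section Values

theorem one_sub_sum_abs_le_prod_abs_one_sub {ι : Type*} (s : Finset ι) (u : ι → ℝ)
    (hu : ∀ i ∈ s, |u i| ≤ 1) : 1 - ∑ i ∈ s, |u i| ≤ ∏ i ∈ s, |1 - u i| := by
  induction s using Finset.cons_induction with
  | empty => simp
  | cons i s hi ih =>
    rw [Finset.sum_cons, Finset.prod_cons]
    have hrest := ih fun k hk => hu k (Finset.mem_cons_of_mem hk)
    have hui := hu i (Finset.mem_cons_self _ _)
    have hfactor : 1 - |u i| ≤ |1 - u i| := by simpa using abs_sub_abs_le_abs_sub 1 (u i)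
    have hsum : 0 ≤ ∑ k ∈ s, |u k| := Finset.sum_nonneg fun _ _ => abs_nonneg _
    calc 1 - (|u i| + ∑ k ∈ s, |u k|)
      _ ≤ (1 - |u i|) * (1 - ∑ k ∈ s, |u k|) := by nlinarith [mul_nonneg (abs_nonneg (u i)) hsum]
      _ ≤ (1 - |u i|) * ∏ k ∈ s, |1 - u k| := mul_le_mul_of_nonneg_left hrest (by linarith)
      _ ≤ |1 - u i| * ∏ k ∈ s, |1 - u k| :=
          mul_le_mul_of_nonneg_right hfactor (Finset.prod_nonneg fun _ _ => abs_nonneg _)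

theorem prod_abs_one_sub_le_exp {ι : Type*} (s : Finset ι) (u : ι → ℝ) :
    ∏ i ∈ s, |1 - u i| ≤ Real.exp (∑ i ∈ s, |u i|) := by
  rw [Real.exp_sum]
  refine Finset.prod_le_prod (fun _ _ => abs_nonneg _) fun i _ => ?_
  calc |1 - u i| ≤ |u i| + 1 := by simpa [add_comm] using abs_sub 1 (u i)
    _ ≤ Real.exp |u i| := Real.add_one_le_exp _

theorem prod_abs_one_sub_mem_Icc {n : ℕ} {u : ℕ → ℝ} (hu : ∀ i < n, |u i| ≤ 1 / 2 * (1 / 4) ^ i) :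
    ∏ i ∈ Finset.range n, |1 - u i| ∈ Set.Icc (1 / 3) 3 := by
  have hsum : ∑ i ∈ Finset.range n, |u i| ≤ 2 / 3 := by
    calc ∑ i ∈ Finset.range n, |u i|
      _ ≤ ∑ i ∈ Finset.range n, 1 / 2 * (1 / 4 : ℝ) ^ i :=
          Finset.sum_le_sum fun i hi => hu i (Finset.mem_range.mp hi)
      _ = 1 / 2 * ((1 - (1 / 4 : ℝ) ^ n) / (3 / 4)) := by
          rw [← Finset.mul_sum, geom_sum_eq (by norm_num)]
          ring
      _ ≤ 2 / 3 := by linarith [show (0 : ℝ) ≤ (1 / 4) ^ n by positivity]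
  have hu1 : ∀ i ∈ Finset.range n, |u i| ≤ 1 := fun i hi => by
    linarith [hu i (Finset.mem_range.mp hi),
      show (1 / 4 : ℝ) ^ i ≤ 1 from pow_le_one₀ (by norm_num) (by norm_num)]
  constructor
  · linarith [one_sub_sum_abs_le_prod_abs_one_sub (Finset.range n) u hu1]
  · calc ∏ i ∈ Finset.range n, |1 - u i| ≤ Real.exp (∑ i ∈ Finset.range n, |u i|) :=
          prod_abs_one_sub_le_exp _ _
      _ ≤ Real.exp 1 := Real.exp_le_exp.mpr (by linarith)
      _ ≤ 3 := by linarith [Real.exp_one_lt_d9]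

theorem abs_tsum_bounds_of_geometric {u : ℕ → ℝ} {B c x : ℝ} (hx : 0 ≤ x) (hx2 : x ≤ 1 / 2)
    (hxc : 4 * B * x ≤ c) (h0 : c ≤ |u 0|) (hu : ∀ g, |u g| ≤ B * x ^ g) :
    c / 2 ≤ |∑' g, u g| ∧ |∑' g, u g| ≤ 2 * B := by
  have hgeom := hasSum_geometric_of_lt_one hx (by linarith)
  have hB : 0 ≤ B := by simpa using (abs_nonneg _).trans (hu 0)
  have hinv : (1 - x)⁻¹ ≤ 2 := by
    rw [inv_le_comm₀ (by linarith) (by norm_num)]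
    linarith
  have htail : |∑' g, u (g + 1)| ≤ B * x * 2 := by
    have hgeom_tail : HasSum (fun g : ℕ => B * x ^ (g + 1)) (B * x * (1 - x)⁻¹) := by
      simpa only [pow_succ', mul_assoc] using hgeom.mul_left (B * x)
    exact (tsum_of_norm_bounded (f := fun g => u (g + 1)) hgeom_tail fun g => hu (g + 1)).trans
      (mul_le_mul_of_nonneg_left hinv (by positivity))
  have hsplit : ∑' g, u g = u 0 + ∑' g, u (g + 1) :=
    (Summable.of_norm_bounded (hgeom.mul_left B).summable hu).tsum_eq_zero_add
  constructor
  · rw [hsplit]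
    linarith [abs_sub_abs_le_abs_add (u 0) (∑' g, u (g + 1))]
  · rw [mul_comm]
    exact (tsum_of_norm_bounded (f := u) (hgeom.mul_left B) hu).trans
      (mul_le_mul_of_nonneg_left hinv hB)

variable {p : ℝ}

theorem abs_pow_sub_inv_pow (hp : p ≠ 0) (a l : ℕ) :
    |p ^ a - p⁻¹ ^ l| = |p| ^ a * |1 - p⁻¹ ^ (l + a)| := by
  rw [← abs_pow, ← abs_mul, mul_sub, mul_one, pow_add, mul_left_comm, ← mul_pow,
    mul_inv_cancel₀ hp, one_pow, mul_one]

theorem abs_inv_pow_le_half_mul_quarter_pow (hp : 2 ≤ |p|) {e k : ℕ} (hek : 2 * k + 1 ≤ e) :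
    |p⁻¹ ^ e| ≤ 1 / 2 * (1 / 4) ^ k := by
  calc |p⁻¹ ^ e| ≤ (1 / 2) ^ e := abs_inv_pow_le hp e
    _ ≤ (1 / 2) ^ (2 * k + 1) := pow_le_pow_of_le_one (by norm_num) (by norm_num) hek
    _ = 1 / 2 * (1 / 4) ^ k := by rw [pow_succ, pow_mul]; norm_num; ring

theorem formFun_inv_pow_eq_zero (hp : p ≠ 0) (r b N : ℕ) {h : ℕ} (hh : h < r * (2 * N)) :
    formFun p r b N (p⁻¹ ^ (2 * h + 1)) = 0 := by
  have hvanish : ∏ i ∈ Finset.range (r * (2 * N)),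
      (1 - p ^ (2 * i + 1) * p⁻¹ ^ (2 * h + 1)) = 0 :=
    Finset.prod_eq_zero (Finset.mem_range.mpr hh) (by
      rw [← mul_pow, mul_inv_cancel₀ hp, one_pow, sub_self])
  rw [formFun, eval_formNum, hvanish, mul_zero, zero_mul, zero_div]

/-- The size, up to bounded factors, of the first nonzero term of the series `formSum`, the one of
index `2 * r * N`. -/
noncomputable def formSize (p : ℝ) (r b N : ℕ) : ℝ :=
  |p| ^ (poleOrder r b * N ^ 2 + 4 * N + (4 * r ^ 2 + 8 * r) * N ^ 2) /
    |p| ^ (poleOrder r b * (2 * N * (2 * N + 1))) *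
    |p|⁻¹ ^ ((2 * (r * (2 * N)) + 1) * zeroOrder r b N)

theorem formSize_pos (hp : p ≠ 0) (r b N : ℕ) : 0 < formSize p r b N := by
  unfold formSize
  positivity

/-- The bounded part of `|formFun p r b N (p⁻¹ ^ l)|`, where `l = 2 * (g + 2 * r * N) + 1`: each
factor of `formFun` is a power of `p` times one of the differences below. -/
noncomputable def formCofactor (p : ℝ) (r b N g : ℕ) : ℝ :=
  let l := 2 * (g + r * (2 * N)) + 1
  |1 - p⁻¹ ^ (l + 2 * N)| *
    (∏ i ∈ Finset.range (r * (2 * N)), |1 - p⁻¹ ^ (2 * (i + 1 + g))|) *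
    (∏ i ∈ Finset.range (r * (2 * N)), |1 - p⁻¹ ^ (l + (2 * i + (2 * (2 * N) + 1)))|) /
    (∏ j ∈ Finset.range (2 * N + 1), |1 - p⁻¹ ^ (l + 2 * j)|) ^ poleOrder r b

theorem prod_abs_one_sub_pow_mul_inv_pow (hp : p ≠ 0) (n g : ℕ) :
    ∏ i ∈ Finset.range n, |1 - p ^ (2 * i + 1) * p⁻¹ ^ (2 * (g + n) + 1)|
      = ∏ i ∈ Finset.range n, |1 - p⁻¹ ^ (2 * (i + 1 + g))| := by
  rw [← Finset.prod_range_reflect fun i => |1 - p⁻¹ ^ (2 * (i + 1 + g))|]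
  refine Finset.prod_congr rfl fun i hi => ?_
  have : i < n := Finset.mem_range.mp hi
  have hexp : 2 * (g + n) + 1 = (2 * i + 1) + 2 * (n - 1 - i + 1 + g) := by omega
  rw [hexp, pow_add p⁻¹, ← mul_assoc, ← mul_pow, mul_inv_cancel₀ hp, one_pow, one_mul]

theorem prod_abs_pow_sub_inv_pow (hp : p ≠ 0) (s : Finset ℕ) (f : ℕ → ℕ) (l : ℕ) :
    ∏ i ∈ s, |p ^ f i - p⁻¹ ^ l| = |p| ^ (∑ i ∈ s, f i) * ∏ i ∈ s, |1 - p⁻¹ ^ (l + f i)| := by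
  rw [← Finset.prod_pow_eq_pow_sum, ← Finset.prod_mul_distrib]
  exact Finset.prod_congr rfl fun i _ => abs_pow_sub_inv_pow hp _ _

theorem abs_formFun_inv_pow (hp : p ≠ 0) (r b N g : ℕ) :
    |formFun p r b N (p⁻¹ ^ (2 * (g + r * (2 * N)) + 1))|
      = formSize p r b N * (|p|⁻¹ ^ (2 * zeroOrder r b N)) ^ g * formCofactor p r b N g := by
  have hupper : ∑ i ∈ Finset.range (r * (2 * N)), (2 * i + (2 * (2 * N) + 1))
      = (4 * r ^ 2 + 8 * r) * N ^ 2 := by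
    rw [sum_range_two_mul_add_odd]
    ring
  have hpoles : ∑ j ∈ Finset.range (2 * N + 1), 2 * j = 2 * N * (2 * N + 1) := by
    rw [← Finset.mul_sum, mul_comm 2 (Finset.sum _ _), Finset.sum_range_id_mul_two,
      Nat.add_sub_cancel, mul_comm]
  have hprod : ∏ i ∈ Finset.range (r * (2 * N)),
        |p ^ (4 * N + 2 * i + 1) - p⁻¹ ^ (2 * (g + r * (2 * N)) + 1)|
      = ∏ i ∈ Finset.range (r * (2 * N)),
        |p ^ (2 * i + (2 * (2 * N) + 1)) - p⁻¹ ^ (2 * (g + r * (2 * N)) + 1)| :=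
    Finset.prod_congr rfl fun i _ => by
      rw [show 4 * N + 2 * i + 1 = 2 * i + (2 * (2 * N) + 1) by ring]
  rw [formFun, eval_formNum, Finset.prod_pow, formSize, formCofactor]
  rw [abs_div, abs_mul, abs_mul, abs_mul, abs_mul, Finset.abs_prod, Finset.abs_prod,
    abs_pow (∏ j ∈ _, _), Finset.abs_prod, prod_abs_one_sub_pow_mul_inv_pow hp, hprod,
    prod_abs_pow_sub_inv_pow hp, prod_abs_pow_sub_inv_pow hp, hupper, hpoles,
    abs_pow_sub_inv_pow hp, abs_pow, abs_pow _ (zeroOrder r b N), abs_pow, abs_inv]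
  ring

theorem formCofactor_mem_Icc (hp : 2 ≤ |p|) (r b N g : ℕ) :
    formCofactor p r b N g ∈
      Set.Icc (1 / (18 * 3 ^ poleOrder r b)) (18 * 3 ^ poleOrder r b) := by
  have hmiddle : |p⁻¹ ^ (2 * (g + r * (2 * N)) + 1 + 2 * N)| ≤ 1 / 2 := by
    simpa using abs_inv_pow_le_half_mul_quarter_pow hp (k := 0) (by omega)
  have hle : ∀ e i : ℕ, 2 * i + 1 ≤ e → |p⁻¹ ^ e| ≤ 1 / 2 * (1 / 4) ^ i :=
    fun e i => abs_inv_pow_le_half_mul_quarter_pow hp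
  obtain ⟨hf1, hf1'⟩ : |1 - p⁻¹ ^ (2 * (g + r * (2 * N)) + 1 + 2 * N)| ∈ Set.Icc (1 / 2) 2 := by
    rw [abs_le] at hmiddle
    rw [abs_of_pos (by linarith)]
    constructor <;> linarith
  obtain ⟨hf2, hf2'⟩ := prod_abs_one_sub_mem_Icc (n := r * (2 * N))
    (u := fun i => p⁻¹ ^ (2 * (i + 1 + g))) fun i _ => hle _ i (by omega)
  obtain ⟨hf3, hf3'⟩ := prod_abs_one_sub_mem_Icc (n := r * (2 * N))
    (u := fun i => p⁻¹ ^ (2 * (g + r * (2 * N)) + 1 + (2 * i + (2 * (2 * N) + 1))))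
    fun i _ => hle _ i (by omega)
  obtain ⟨hf4, hf4'⟩ := prod_abs_one_sub_mem_Icc (n := 2 * N + 1)
    (u := fun j => p⁻¹ ^ (2 * (g + r * (2 * N)) + 1 + 2 * j)) fun i _ => hle _ i (by omega)
  simp only [formCofactor]
  constructor
  · calc 1 / (18 * 3 ^ poleOrder r b) = 1 / 2 * (1 / 3) * (1 / 3) / (3 : ℝ) ^ poleOrder r b := by
          field_simp; norm_num
      _ ≤ _ := by gcongr
  · calc _ ≤ 2 * 3 * 3 / (1 / 3 : ℝ) ^ poleOrder r b := by gcongr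
      _ = 18 * 3 ^ poleOrder r b := by rw [one_div_pow, div_div_eq_mul_div, div_one]; norm_num

theorem formSum_eq_tsum_add (hp : p ≠ 0) (r b N : ℕ) :
    formSum p r b N = ∑' g, (-1) ^ (g + r * (2 * N)) *
      formFun p r b N (p⁻¹ ^ (2 * (g + r * (2 * N)) + 1)) := by
  refine ((add_left_injective (r * (2 * N))).tsum_eq ?_).symm
  intro h hh
  by_contra! hrange
  refine hh ?_
  have : h < r * (2 * N) := by
    by_contra! hle
    exact hrange ⟨h - r * (2 * N), Nat.sub_add_cancel hle⟩
  simp only [formFun_inv_pow_eq_zero hp r b N this, mul_zero]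

theorem abs_inv_pow_two_mul_zeroOrder_le (hp : 2 ≤ |p|) (r b N : ℕ) :
    |p|⁻¹ ^ (2 * zeroOrder r b N) ≤ (1 / 2) ^ N := by
  have : N ≤ 2 * zeroOrder r b N := by unfold zeroOrder; nlinarith
  calc |p|⁻¹ ^ (2 * zeroOrder r b N) = |p⁻¹ ^ (2 * zeroOrder r b N)| := by rw [abs_pow, abs_inv]
    _ ≤ (1 / 2) ^ (2 * zeroOrder r b N) := abs_inv_pow_le hp _
    _ ≤ (1 / 2) ^ N := pow_le_pow_of_le_one (by norm_num) (by norm_num) this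

theorem eventually_formSum_bounds (hp : 2 ≤ |p|) (r b : ℕ) :
    ∀ᶠ N in atTop, formSize p r b N * (1 / (36 * 3 ^ poleOrder r b)) ≤ |formSum p r b N| ∧
      |formSum p r b N| ≤ formSize p r b N * (36 * 3 ^ poleOrder r b) := by
  have hp0 := ne_zero_of_two_le_abs hp
  set C : ℝ := 18 * 3 ^ poleOrder r b with hC
  have hC0 : 0 < C := by positivity
  have hC36 : 36 * 3 ^ poleOrder r b = 2 * C := by rw [hC]; ring
  have hlim : Tendsto (fun N : ℕ => 4 * C * (1 / 2 : ℝ) ^ N) atTop (𝓝 0) := by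
    simpa using (tendsto_pow_atTop_nhds_zero_of_lt_one (r := (1 / 2 : ℝ)) (by norm_num)
      (by norm_num)).const_mul (4 * C)
  filter_upwards [hlim.eventually_lt_const (by positivity : 0 < 1 / C), eventually_ge_atTop 1]
    with N hN hN1
  have hsize := formSize_pos hp0 r b N
  have hratio := abs_inv_pow_two_mul_zeroOrder_le hp r b N
  have habs (g : ℕ) : |(-1) ^ (g + r * (2 * N)) *
        formFun p r b N (p⁻¹ ^ (2 * (g + r * (2 * N)) + 1))|
      = formSize p r b N * (|p|⁻¹ ^ (2 * zeroOrder r b N)) ^ g * formCofactor p r b N g := by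
    rw [abs_mul, abs_neg_one_pow, one_mul, abs_formFun_inv_pow hp0]
  have hbounds := abs_tsum_bounds_of_geometric
    (u := fun g => (-1) ^ (g + r * (2 * N)) *
      formFun p r b N (p⁻¹ ^ (2 * (g + r * (2 * N)) + 1))) (B := formSize p r b N * C)
    (c := formSize p r b N * (1 / C)) (x := |p|⁻¹ ^ (2 * zeroOrder r b N)) (by positivity)
    (hratio.trans (pow_le_of_le_one (by norm_num) (by norm_num) (by omega)))
    (calc 4 * (formSize p r b N * C) * |p|⁻¹ ^ (2 * zeroOrder r b N)
      _ ≤ 4 * (formSize p r b N * C) * (1 / 2) ^ N := by gcongr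
      _ = formSize p r b N * (4 * C * (1 / 2) ^ N) := by ring
      _ ≤ formSize p r b N * (1 / C) := by gcongr)
    (by
      rw [habs, pow_zero, mul_one]
      exact mul_le_mul_of_nonneg_left (formCofactor_mem_Icc hp r b N 0).1 hsize.le)
    (fun g => by
      rw [habs, mul_right_comm]
      gcongr
      exact (formCofactor_mem_Icc hp r b N g).2)
  rw [formSum_eq_tsum_add hp0, hC36]
  refine ⟨le_of_eq_of_le ?_ hbounds.1, hbounds.2.trans_eq (by ring)⟩
  field_simp

theorem eventually_formSum_ne_zero (hp : 2 ≤ |p|) (r b : ℕ) :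
    ∀ᶠ N in atTop, formSum p r b N ≠ 0 := by
  filter_upwards [eventually_formSum_bounds hp r b] with N hN
  have := formSize_pos (ne_zero_of_two_le_abs hp) r b N
  exact abs_pos.mp (lt_of_lt_of_le (by positivity) hN.1)

theorem tendsto_log_formSize (hp : p ≠ 0) (r b : ℕ) :
    Tendsto (fun N : ℕ => Real.log (formSize p r b N) / (N : ℝ) ^ 2) atTop
      (𝓝 ((-3 * poleOrder r b - 4 * r * poleOrder r b + 12 * r ^ 2 + 8 * r) * Real.log |p|)) := by
  have hpole : (poleOrder r b : ℝ) = 2 * (r + b) + 1 := by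
    rw [poleOrder]
    push_cast
    ring
  refine (tendsto_quadratic_div_sq
    ((-3 * poleOrder r b - 4 * r * poleOrder r b + 12 * r ^ 2 + 8 * r) * Real.log |p|)
    ((4 - 2 * poleOrder r b - (2 * b + 1) - 4 * r * (r + b)) * Real.log |p|)
    (-(r + b) * Real.log |p|)).congr fun N => ?_
  have : 0 < |p| := abs_pos.mpr hp
  rw [formSize, Real.log_mul (by positivity) (by positivity),
    Real.log_div (by positivity) (by positivity), Real.log_pow, Real.log_pow, Real.log_pow,
    Real.log_inv, zeroOrder]
  push_cast
  rw [hpole]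
  ring

theorem tendsto_log_formSum (hp : 2 ≤ |p|) (r b : ℕ) :
    Tendsto (fun N : ℕ => Real.log |2 * formSum p r b N| / (N : ℝ) ^ 2) atTop
      (𝓝 ((-3 * poleOrder r b - 4 * r * poleOrder r b + 12 * r ^ 2 + 8 * r) * Real.log |p|)) := by
  have hp0 := ne_zero_of_two_le_abs hp
  set C : ℝ := 36 * 3 ^ poleOrder r b with hC
  have hC0 : 0 < C := by positivity
  have hC1 : 0 ≤ Real.log C :=
    Real.log_nonneg (by linarith [one_le_pow₀ (n := poleOrder r b) (by norm_num : (1 : ℝ) ≤ 3)])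
  refine tendsto_div_sq_of_abs_sub_le (C := Real.log 2 + Real.log C) ?_
    (tendsto_log_formSize hp0 r b)
  filter_upwards [eventually_formSum_bounds hp r b] with N hN
  have hsize := formSize_pos hp0 r b N
  have hsum : 0 < |formSum p r b N| := lt_of_lt_of_le (by positivity) hN.1
  have hlower := Real.log_le_log (by positivity) hN.1
  have hupper := Real.log_le_log hsum hN.2
  rw [Real.log_mul hsize.ne' (by positivity), one_div, Real.log_inv, ← hC] at hlower
  rw [Real.log_mul hsize.ne' hC0.ne'] at hupper
  have hlog2 : 0 ≤ Real.log 2 := Real.log_nonneg one_le_two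
  rw [abs_mul, abs_two, Real.log_mul two_ne_zero hsum.ne']
  calc |Real.log 2 + Real.log |formSum p r b N| - Real.log (formSize p r b N)|
    _ ≤ Real.log 2 + Real.log C := abs_le.mpr ⟨by linarith, by linarith⟩
    _ ≤ (Real.log 2 + Real.log C) * (N + 1) :=
        le_mul_of_one_le_right (by positivity) (by linarith [N.cast_nonneg (α := ℝ)])

end Values

theorem tendsto_log_form {m : ℤ} (hm : 2 ≤ |m|) (r b : ℕ) :
    Tendsto (fun N : ℕ => Real.log |multiplier m r b N * (2 * formSum m r b N)| / (N : ℝ) ^ 2) atTop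
      (𝓝 ((poleOrder r b - 4 * r * poleOrder r b + 12 * r ^ 2 + 16 * r / 3
        + 48 / Real.pi ^ 2 * poleOrder r b - 16 / Real.pi ^ 2) * Real.log |(m : ℝ)|)) := by
  have hm' := two_le_abs_cast hm
  have hlim := (tendsto_log_multiplier hm r b).add (tendsto_log_formSum hm' r b)
  rw [← add_mul] at hlim
  convert hlim.congr' ?_ using 3
  · ring
  · filter_upwards [eventually_formSum_ne_zero hm' r b] with N hN
    rw [abs_mul (multiplier m r b N), Real.log_mul (abs_ne_zero.mpr (multiplier_ne_zero hm r b N))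
      (abs_ne_zero.mpr (mul_ne_zero two_ne_zero hN)), add_div]

/-! ### The lower bound for the dimension -/

section Dimension

/-- The denominator of `boundTerm r A`, which is also the rate of growth of the coefficients of the
linear forms. -/
noncomputable def boundDenom (r A : ℕ) : ℝ :=
  (48 / Real.pi ^ 2 + 2) * A + 8 * r ^ 2 - 16 / Real.pi ^ 2 + 16 * r / 3

theorem boundTerm_eq_div_boundDenom (r A : ℕ) :
    boundTerm r A = (4 * r * A + A - 4 * r ^ 2) / boundDenom r A :=
  rfl

theorem le_boundDenom {r : ℕ} (hr : 1 ≤ r) (A : ℕ) :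
    (48 / Real.pi ^ 2 + 2) * A + 8 * r ^ 2 ≤ boundDenom r A := by
  have hpi : 16 / Real.pi ^ 2 ≤ 16 / 3 :=
    div_le_div_of_nonneg_left (by norm_num) (by norm_num) (by nlinarith [Real.pi_gt_three])
  have : (1 : ℝ) ≤ r := Nat.one_le_cast.mpr hr
  unfold boundDenom
  linarith

theorem boundDenom_pos {r : ℕ} (hr : 1 ≤ r) (A : ℕ) : 0 < boundDenom r A :=
  lt_of_lt_of_le (by positivity) (le_boundDenom hr A)

theorem one_le_finrank_realBetaSpace (q : ℝ) (A : ℕ) :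
    1 ≤ Module.finrank ℚ (realBetaSpace q A) := by
  have := finiteDimensional_realBetaSpace q A
  have hone : (1 : ℝ) ∈ realBetaSpace q A := Submodule.subset_span (Set.mem_insert _ _)
  refine Submodule.one_le_finrank_iff.mpr fun hbot => ?_
  exact one_ne_zero ((Submodule.mem_bot ℚ).mp (hbot ▸ hone))

theorem formPoint_mem_realBetaSpace {p : ℝ} (hp : 2 ≤ |p|) (r b : ℕ)
    (i : Option (Fin (poleOrder r b))) :
    formPoint p r b i ∈ realBetaSpace p⁻¹ (poleOrder r b) := by
  rcases i with _ | k
  · exact Submodule.subset_span (Set.mem_insert _ _)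
  · exact formPeriod_mem_realBetaSpace hp ⟨r + b, rfl⟩ (by omega) (by omega)

variable {m : ℤ}

theorem one_add_div_boundDenom_le_finrank (hm : 2 ≤ |m|) {r : ℕ} (hr : 1 ≤ r) (b : ℕ)
    (hpos : 0 < 4 * r * poleOrder r b + poleOrder r b - 4 * r ^ 2 - boundDenom r (poleOrder r b)) :
    1 + (4 * r * poleOrder r b + poleOrder r b - 4 * r ^ 2 - boundDenom r (poleOrder r b)) /
        boundDenom r (poleOrder r b)
      ≤ Module.finrank ℚ (realBetaSpace (m : ℝ)⁻¹ (poleOrder r b)) := by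
  have hm' := two_le_abs_cast hm
  have := finiteDimensional_realBetaSpace (m : ℝ)⁻¹ (poleOrder r b)
  have hlog : 0 < Real.log |(m : ℝ)| := Real.log_pos (by linarith)
  have hsq : Tendsto (fun N : ℕ => (N : ℝ) ^ 2) atTop atTop :=
    (tendsto_pow_atTop two_ne_zero).comp tendsto_natCast_atTop_atTop
  have hsq_ratio : Tendsto (fun N : ℕ => (N : ℝ) ^ 2 / ((N + 1 : ℕ) : ℝ) ^ 2) atTop (𝓝 1) := by
    simpa [div_pow] using (tendsto_natCast_div_add_atTop (1 : ℝ)).pow 2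
  choose c hc using fun N i => Subring.mem_bot.mp (formCoeff_mem_bot hm r b N i)
  have hform : Tendsto
      (fun N : ℕ => Real.log |∑ i, (c N i : ℝ) * formPoint m r b i| / (N : ℝ) ^ 2) atTop
      (𝓝 (-((4 * r * poleOrder r b + poleOrder r b - 4 * r ^ 2 -
        boundDenom r (poleOrder r b)) * Real.log |(m : ℝ)|))) := by
    simp only [hc, sum_formCoeff_mul_formPoint hm hr]
    convert tendsto_log_form hm r b using 2
    rw [boundDenom]
    ring
  have hcoeff : ∀ ε > 0, ∀ᶠ N : ℕ in atTop, ∀ i, |(c N i : ℝ)| ≤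
      Real.exp ((boundDenom r (poleOrder r b) * Real.log |(m : ℝ)| + ε) * (N : ℝ) ^ 2) := by
    intro ε hε
    filter_upwards [eventually_abs_formCoeff_le hm r b hε] with N hN i
    rw [hc]
    convert hN i using 4
    rw [boundDenom]
    ring
  rw [← mul_div_mul_right _ _ hlog.ne']
  exact one_add_div_le_finrank_of_forms _ (formPoint_mem_realBetaSpace hm' r b) c hsq hsq_ratio
    (mul_pos hpos hlog) (mul_pos (boundDenom_pos hr _) hlog) hform hcoeff

theorem boundTerm_le_finrank_realBetaSpace (hm : 2 ≤ |m|) {r : ℕ} (hr : 1 ≤ r) (b : ℕ) :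
    boundTerm r (poleOrder r b)
      ≤ Module.finrank ℚ (realBetaSpace (m : ℝ)⁻¹ (poleOrder r b)) := by
  have hdenom := boundDenom_pos hr (poleOrder r b)
  rw [boundTerm_eq_div_boundDenom]
  rcases le_or_gt (4 * r * poleOrder r b + poleOrder r b - 4 * r ^ 2 : ℝ)
    (boundDenom r (poleOrder r b)) with hle | hlt
  · calc (4 * r * poleOrder r b + poleOrder r b - 4 * r ^ 2) / boundDenom r (poleOrder r b)
      _ ≤ 1 := (div_le_one hdenom).mpr hle
      _ ≤ _ := Nat.one_le_cast.mpr (one_le_finrank_realBetaSpace _ _)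
  · convert one_add_div_boundDenom_le_finrank hm hr b (sub_pos.mpr hlt) using 1
    rw [one_add_div hdenom.ne', add_sub_cancel]

theorem bound_le_finrank_qBetaSpace (hm : 2 ≤ |m|) {A : ℕ} (hA : 3 ≤ A) (hodd : Odd A) :
    bound A ≤ Module.finrank ℚ (qBetaSpace (m : ℂ)⁻¹ A) := by
  obtain ⟨r, ⟨hr, hrA⟩, hbound⟩ := (bound_isGreatest hA).1
  have : 2 * r < A := by
    have : (2 * r : ℝ) < A := by linarith
    exact_mod_cast this
  obtain ⟨c, rfl⟩ := hodd
  obtain ⟨b, rfl⟩ := Nat.exists_eq_add_of_le (show r ≤ c by omega)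
  have hq : (m : ℂ)⁻¹ = ((m : ℝ)⁻¹ : ℝ) := by push_cast; rfl
  rw [← hbound, hq, finrank_qBetaSpace]
  exact boundTerm_le_finrank_realBetaSpace hm hr b

end Dimension

/-! ### Asymptotics of the bound -/

section Asymptotics

/-- The constant `√(2 (48 / π² + 2)) = 2 √(π² + 24) / π`, the inverse of the leading coefficient of
`bound`. -/
noncomputable def boundConst : ℝ := Real.sqrt (2 * (48 / Real.pi ^ 2 + 2))

theorem boundConst_pos : 0 < boundConst :=
  Real.sqrt_pos.mpr (by positivity)

theorem boundConst_sq : boundConst ^ 2 = 2 * (48 / Real.pi ^ 2 + 2) :=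
  Real.sq_sqrt (by positivity)

theorem inv_boundConst :
    boundConst⁻¹ = Real.pi / (2 * Real.sqrt (Real.pi ^ 2 + 24)) := by
  have hsq : 2 * (48 / Real.pi ^ 2 + 2) = (2 / Real.pi) ^ 2 * (Real.pi ^ 2 + 24) := by
    field_simp
    ring
  rw [boundConst, hsq, Real.sqrt_mul (by positivity), Real.sqrt_sq (by positivity)]
  field_simp

theorem boundTerm_le {r A : ℕ} (hr : 1 ≤ r) (hA : 1 ≤ A) :
    boundTerm r A ≤ boundConst⁻¹ * Real.sqrt A + 1 := by
  have hdenom := le_boundDenom hr A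
  have : 0 < Real.sqrt A := Real.sqrt_pos.mpr (by positivity)
  have hsq : Real.sqrt A ^ 2 = A := Real.sq_sqrt A.cast_nonneg
  have hconst := boundConst_pos
  have hamgm : 4 * r * boundConst * Real.sqrt A ≤ boundDenom r A := by
    nlinarith [sq_nonneg (boundConst * Real.sqrt A - 4 * r), boundConst_sq]
  have hmain : 4 * r * A ≤ boundConst⁻¹ * Real.sqrt A * boundDenom r A := by
    calc 4 * r * A = boundConst⁻¹ * Real.sqrt A * (4 * r * boundConst * Real.sqrt A) := by
          field_simp
          rw [hsq]
      _ ≤ boundConst⁻¹ * Real.sqrt A * boundDenom r A := by gcongr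
  have hlower : (A : ℝ) ≤ boundDenom r A := by
    have : 0 ≤ 48 / Real.pi ^ 2 * A := by positivity
    nlinarith [sq_nonneg (r : ℝ), A.cast_nonneg (α := ℝ)]
  rw [boundTerm_eq_div_boundDenom, div_le_iff₀ (boundDenom_pos hr A), add_mul, one_mul]
  nlinarith [sq_nonneg (r : ℝ)]

theorem bound_le {A : ℕ} (hA : 3 ≤ A) : bound A ≤ boundConst⁻¹ * Real.sqrt A + 1 := by
  obtain ⟨r, ⟨hr, -⟩, hbound⟩ := (bound_isGreatest hA).1
  exact hbound ▸ boundTerm_le hr (by omega)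

theorem tendsto_sqrt_natCast_atTop : Tendsto (fun A : ℕ => Real.sqrt A) atTop atTop :=
  Real.tendsto_sqrt_atTop.comp tendsto_natCast_atTop_atTop

theorem tendsto_inv_sqrt_natCast : Tendsto (fun A : ℕ => (Real.sqrt A)⁻¹) atTop (𝓝 0) :=
  tendsto_inv_atTop_zero.comp tendsto_sqrt_natCast_atTop

theorem boundTerm_div_sqrt (r : ℕ) {A : ℕ} (hA : 0 < A) :
    boundTerm r A / Real.sqrt A
      = (4 * (r / Real.sqrt A) + (Real.sqrt A)⁻¹ - 4 * (r / Real.sqrt A) ^ 2 * (Real.sqrt A)⁻¹) /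
        (48 / Real.pi ^ 2 + 2 + 8 * (r / Real.sqrt A) ^ 2 -
          16 / Real.pi ^ 2 * (Real.sqrt A)⁻¹ ^ 2 +
          16 / 3 * (r / Real.sqrt A * (Real.sqrt A)⁻¹)) := by
  have hsqrt : 0 < Real.sqrt A := Real.sqrt_pos.mpr (Nat.cast_pos.mpr hA)
  have hsq : (A : ℝ) = Real.sqrt A ^ 2 := (Real.sq_sqrt A.cast_nonneg).symm
  rw [boundTerm]
  generalize Real.sqrt A = s at *
  have hnum : 4 * (r / s) + s⁻¹ - 4 * (r / s) ^ 2 * s⁻¹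
      = (4 * r * A + A - 4 * r ^ 2) / s ^ 3 := by
    rw [hsq]
    field_simp
  have hdenom : 48 / Real.pi ^ 2 + 2 + 8 * (r / s) ^ 2 - 16 / Real.pi ^ 2 * s⁻¹ ^ 2
        + 16 / 3 * (r / s * s⁻¹)
      = ((48 / Real.pi ^ 2 + 2) * A + 8 * r ^ 2 - 16 / Real.pi ^ 2 + 16 * r / 3) / s ^ 2 := by
    rw [hsq]
    field_simp
  rw [hnum, hdenom]
  field_simp

theorem tendsto_boundTerm_div_sqrt {r : ℕ → ℕ} {t : ℝ}
    (hr : Tendsto (fun A => r A / Real.sqrt A) atTop (𝓝 t)) :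
    Tendsto (fun A => boundTerm (r A) A / Real.sqrt A) atTop
      (𝓝 (4 * t / (48 / Real.pi ^ 2 + 2 + 8 * t ^ 2))) := by
  have hinv := tendsto_inv_sqrt_natCast
  have hnum := ((hr.const_mul 4).add hinv).sub (((hr.pow 2).const_mul 4).mul hinv)
  have hdenom := (((hr.pow 2).const_mul 8).const_add (48 / Real.pi ^ 2 + 2)).sub
    ((hinv.pow 2).const_mul (16 / Real.pi ^ 2)) |>.add ((hr.mul hinv).const_mul (16 / 3))
  have hlim := hnum.div hdenom (by
    simp only [mul_zero, add_zero, sub_zero, zero_pow two_ne_zero]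
    positivity)
  simp only [mul_zero, add_zero, sub_zero, zero_pow two_ne_zero] at hlim
  refine hlim.congr' ?_
  filter_upwards [eventually_gt_atTop 0] with A hA
  exact (boundTerm_div_sqrt (r A) hA).symm

theorem eventually_boundTerm_ceil_le_bound {t : ℝ} (ht : 0 < t) :
    ∀ᶠ A : ℕ in atTop, boundTerm ⌈t * Real.sqrt A⌉₊ A ≤ bound A := by
  filter_upwards [tendsto_sqrt_natCast_atTop.eventually_ge_atTop (2 * t + 2),
    eventually_ge_atTop 3] with A hsqrt hA
  have hceil : (⌈t * Real.sqrt A⌉₊ : ℝ) < t * Real.sqrt A + 1 :=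
    Nat.ceil_lt_add_one (by positivity)
  have hsq : Real.sqrt A ^ 2 = A := Real.sq_sqrt A.cast_nonneg
  refine (bound_isGreatest hA).2 ⟨_, ⟨Nat.one_le_ceil_iff.mpr ?_, ?_⟩, rfl⟩
  · exact mul_pos ht (by linarith)
  · nlinarith

theorem tendsto_bound_div_sqrt :
    Tendsto (fun A : ℕ => bound A / Real.sqrt A) atTop (𝓝 boundConst⁻¹) := by
  have hconst := boundConst_pos
  -- `t = boundConst / 4` maximizes the limit `4 * t / (48 / π ^ 2 + 2 + 8 * t ^ 2)`.
  have hlower := tendsto_boundTerm_div_sqrt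
    ((tendsto_nat_ceil_mul_div_atTop (by positivity : 0 ≤ boundConst / 4)).comp
      tendsto_sqrt_natCast_atTop)
  have hvalue : 4 * (boundConst / 4) / (48 / Real.pi ^ 2 + 2 + 8 * (boundConst / 4) ^ 2)
      = boundConst⁻¹ := by
    have hdenom : 48 / Real.pi ^ 2 + 2 + 8 * (boundConst / 4) ^ 2 = boundConst ^ 2 := by
      linarith [boundConst_sq]
    rw [hdenom]
    field_simp
  have hupper : Tendsto (fun A : ℕ => boundConst⁻¹ + (Real.sqrt A)⁻¹) atTop (𝓝 boundConst⁻¹) := by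
    simpa using tendsto_inv_sqrt_natCast.const_add boundConst⁻¹
  rw [hvalue] at hlower
  refine tendsto_of_tendsto_of_tendsto_of_le_of_le' hlower hupper ?_ ?_
  · filter_upwards [eventually_boundTerm_ceil_le_bound (by positivity : 0 < boundConst / 4)]
      with A hA
    exact div_le_div_of_nonneg_right hA (Real.sqrt_nonneg _)
  · filter_upwards [eventually_ge_atTop 3] with A hA
    have hsqrt : 0 < Real.sqrt A := Real.sqrt_pos.mpr (by positivity)
    rw [div_le_iff₀ hsqrt, add_mul, inv_mul_cancel₀ hsqrt.ne']
    exact bound_le hA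

theorem bound_isEquivalent : Asymptotics.IsEquivalent atTop bound
    (fun A : ℕ => Real.pi / (2 * Real.sqrt (Real.pi ^ 2 + 24)) * Real.sqrt (A : ℝ)) := by
  have hconst := boundConst_pos.ne'
  rw [← inv_boundConst]
  refine Asymptotics.isEquivalent_of_tendsto_one ?_
  have hlim := tendsto_bound_div_sqrt.mul_const boundConst
  rw [inv_mul_cancel₀ hconst] at hlim
  refine hlim.congr fun A => ?_
  simp only [Pi.div_apply]
  field_simp

end Asymptotics

theorem two_le_abs_of_one_div_eq {q : ℂ} (hq : q ≠ 0) {m : ℤ} (hneg : m ≠ -1) (hone : m ≠ 1)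
    (hqm : 1 / q = m) : 2 ≤ |m| := by
  have : m ≠ 0 := by
    rintro rfl
    exact one_div_ne_zero hq (by simpa using hqm)
  rw [le_abs]
  omega

theorem theorem1p1 :
    (∀ (q : ℂ), q ≠ 0 → (∃ m : ℤ, m ≠ -1 ∧ m ≠ 1 ∧ 1 / q = (m : ℂ)) →
      ∀ (A : ℕ), 3 ≤ A → Odd A →
        bound A ≤ (Module.finrank ℚ (qBetaSpace q A) : ℝ)) ∧
    Asymptotics.IsEquivalent Filter.atTop bound
      (fun A : ℕ => Real.pi / (2 * Real.sqrt (Real.pi ^ 2 + 24)) * Real.sqrt (A : ℝ)) := by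
  refine ⟨fun q hq ⟨m, hneg, hone, hqm⟩ A hA hodd => ?_, bound_isEquivalent⟩
  have hm : 2 ≤ |m| := two_le_abs_of_one_div_eq hq hneg hone hqm
  have hq_eq : q = (m : ℂ)⁻¹ := by rw [← hqm, one_div, inv_inv]
  rw [hq_eq]
  exact bound_le_finrank_qBetaSpace hm hA hodd
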